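/- For $n\ge 0$ and a function $f:\{0,1\}^n\to\mathbb{R}$, call $f$ submodular if $f(x\vee y)+f(x\wedge y)\le f(x)+f(y)$ for all $x,y$. For $f,h:\{0,1\}^n\to\mathbb R$ let $\|f-h\|_1=\mathbf{E}_x|f(x)-h(x)|$, where $x$ is uniform in $\{0,1\}^n$. A function is a $J$-junta, for $J\subseteq\{1,\dots,n\}$, if its value depends only on the coordinates in $J$. Write $\tilde O(g)$ for a bound of the form $C\,g\,\log^{c}(3+g)$ with absolute constants $C>0$ and $c\in\mathbb N$. Algorithms are programs for a unit-cost real RAM: storage consists of natural-number and real variables and arrays with indirect addressing; each addition, subtraction and multiplication of naturals or reals, division of reals, memory access and comparison costs one step; the constants in a program are natural and rational numbers, and there is no rounding of reals to integers. Requesting a random example $(x,f(x))$, with $x$ uniform in $\{0,1\}^n$ and independent of the earlier examples, costs $n+1$ steps. **Theorem.** There are a single algorithm $\mathcal A$ and absolute constants $C>0$, $c\in\mathbb N$ such that the following holds for every $n\ge 0$, every real $\epsilon>0$ and every submodular $f:\{0,1\}^n\to[0,1]$. Put $\delta=\min(\epsilon,1)$ (so $\delta=\epsilon$ whenever $\epsilon\le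 1$). Given $n$, $\epsilon$ and access to random uniform examples of $f$, the algorithm $\mathcal A$ always halts and outputs a set $J\subseteq\{1,\dots,n\}$ of size $$|J|\le C\cdot\frac{1}{\delta^2}\log\frac1\delta ,$$ together with a submodular $J$-junta $h:\{0,1\}^n\to[0,1]$ (given by its table of $2^{|J|}$ values); it always runs in time $$\tilde O\!\left(\frac{n^2}{\delta^{10}}\right)+2^{\tilde O(1/\delta^2)}$$ and always uses at most $$\tilde O\!\left(\frac{\log n}{\delta^{10}}\right)+2^{\tilde O(1/\delta^2)}$$ random examples (for $n=0$, read $\log n$ as $0$); and with probability at least $2/3$ over the examples, $\|f-h\|_1\le\epsilon$. -/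

import Mathlib

open MeasureTheory

/-! ### Functions on the discrete cube -/

/-- The discrete cube; a point is identified with the set of coordinates at which it is `true`,
so that `x ⊔ y` is the union and `x ⊓ y` the intersection. -/
abbrev Cube (n : ℕ) : Type := Fin n → Bool

/-- `f (A ∪ B) + f (A ∩ B) ≤ f A + f B` for all `A`, `B`. -/
def IsSubmodular {n : ℕ} (f : Cube n → ℝ) : Prop :=
  ∀ x y : Cube n, f (x ⊔ y) + f (x ⊓ y) ≤ f x + f y

/-- The `ℓ₁`-distance `𝔼 |f x - h x|` for `x` uniform in the cube. -/
noncomputable def l1Dist {n : ℕ} (f h : Cube n → ℝ) : ℝ :=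
  (∑ x : Cube n, |f x - h x|) / 2 ^ n

/-- The law of an infinite sequence of independent uniform points of the cube. -/
noncomputable def exampleLaw (n : ℕ) : Measure (ℕ → Cube n) :=
  Measure.infinitePi fun _ : ℕ => (PMF.uniformOfFintype (Cube n)).toMeasure

/-- The soft-O bound `C · g · (log (3 + g)) ^ c`. -/
noncomputable def softO (C : ℝ) (c : ℕ) (g : ℝ) : ℝ :=
  C * g * Real.log (3 + g) ^ c

/-! ### A real RAM with access to labelled random examples

Programs are finite texts of a structured language. Storage consists of natural-number and real
scalars and of natural-number and real arrays with indirect addressing. Arithmetic and comparisons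
have unit cost; the only constants are natural and rational numbers, there is no rounding of reals
to integers and no integer division. -/

namespace RealRAM

/-- A memory state, together with the number of examples drawn so far. -/
structure State where
  nvar : ℕ → ℕ
  rvar : ℕ → ℝ
  narr : ℕ → ℕ → ℕ
  rarr : ℕ → ℕ → ℝ
  drawn : ℕ

/-- Natural-number expressions; `sub` is truncated subtraction. -/
inductive NExp where
  | const (k : ℕ)
  | var (v : ℕ)
  | arr (a : ℕ) (i : NExp)
  | add (e₁ e₂ : NExp)
  | sub (e₁ e₂ : NExp)
  | mul (e₁ e₂ : NExp)

/-- Real expressions. -/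
inductive RExp where
  | const (q : ℚ)
  | var (v : ℕ)
  | arr (a : ℕ) (i : NExp)
  | ofNat (e : NExp)
  | add (e₁ e₂ : RExp)
  | sub (e₁ e₂ : RExp)
  | mul (e₁ e₂ : RExp)
  | div (e₁ e₂ : RExp)

/-- Tests. -/
inductive BExp where
  | nle (e₁ e₂ : NExp)
  | rle (e₁ e₂ : RExp)
  | not (b : BExp)
  | and (b₁ b₂ : BExp)

/-- Commands. `draw a v` requests a random example: its `n` bits go to the cells `0, …, n - 1` of
the natural-number array `a`, and its label goes to the real scalar `v`. -/
inductive Cmd where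
  | skip
  | setN (v : ℕ) (e : NExp)
  | setR (v : ℕ) (e : RExp)
  | putN (a : ℕ) (i : NExp) (e : NExp)
  | putR (a : ℕ) (i : NExp) (e : RExp)
  | draw (a v : ℕ)
  | seq (p q : Cmd)
  | ite (b : BExp) (p q : Cmd)
  | while (b : BExp) (p : Cmd)

namespace NExp

def eval (s : State) : NExp → ℕ
  | const k => k
  | var v => s.nvar v
  | arr a i => s.narr a (i.eval s)
  | add e₁ e₂ => e₁.eval s + e₂.eval s
  | sub e₁ e₂ => e₁.eval s - e₂.eval s
  | mul e₁ e₂ => e₁.eval s * e₂.eval s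

/-- The cost of an evaluation: the number of operations and memory accesses. -/
def cost : NExp → ℕ
  | const _ => 1
  | var _ => 1
  | arr _ i => i.cost + 1
  | add e₁ e₂ => e₁.cost + e₂.cost + 1
  | sub e₁ e₂ => e₁.cost + e₂.cost + 1
  | mul e₁ e₂ => e₁.cost + e₂.cost + 1

end NExp

namespace RExp

noncomputable def eval (s : State) : RExp → ℝ
  | const q => (q : ℝ)
  | var v => s.rvar v
  | arr a i => s.rarr a (i.eval s)
  | ofNat e => (e.eval s : ℝ)
  | add e₁ e₂ => e₁.eval s + e₂.eval s
  | sub e₁ e₂ => e₁.eval s - e₂.eval s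
  | mul e₁ e₂ => e₁.eval s * e₂.eval s
  | div e₁ e₂ => e₁.eval s / e₂.eval s

def cost : RExp → ℕ
  | const _ => 1
  | var _ => 1
  | arr _ i => i.cost + 1
  | ofNat e => e.cost + 1
  | add e₁ e₂ => e₁.cost + e₂.cost + 1
  | sub e₁ e₂ => e₁.cost + e₂.cost + 1
  | mul e₁ e₂ => e₁.cost + e₂.cost + 1
  | div e₁ e₂ => e₁.cost + e₂.cost + 1

end RExp

namespace BExp

def Holds (s : State) : BExp → Prop
  | nle e₁ e₂ => e₁.eval s ≤ e₂.eval s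
  | rle e₁ e₂ => e₁.eval s ≤ e₂.eval s
  | not b => ¬ b.Holds s
  | and b₁ b₂ => b₁.Holds s ∧ b₂.Holds s

def cost : BExp → ℕ
  | nle e₁ e₂ => e₁.cost + e₂.cost + 1
  | rle e₁ e₂ => e₁.cost + e₂.cost + 1
  | not b => b.cost + 1
  | and b₁ b₂ => b₁.cost + b₂.cost + 1

end BExp

namespace State

def setN (s : State) (v k : ℕ) : State :=
  { s with nvar := Function.update s.nvar v k }

noncomputable def setR (s : State) (v : ℕ) (r : ℝ) : State :=
  { s with rvar := Function.update s.rvar v r }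

def putN (s : State) (a i k : ℕ) : State :=
  { s with narr := Function.update s.narr a (Function.update (s.narr a) i k) }

noncomputable def putR (s : State) (a i : ℕ) (r : ℝ) : State :=
  { s with rarr := Function.update s.rarr a (Function.update (s.rarr a) i r) }

/-- The state after the example `(x, y)` was received in the array `a` and the scalar `v`. -/
noncomputable def receive {n : ℕ} (s : State) (a v : ℕ) (x : Cube n) (y : ℝ) : State :=
  { s with
    narr := Function.update s.narr a fun i =>
      if hi : i < n then (x ⟨i, hi⟩).toNat else s.narr a i
    rvar := Function.update s.rvar v y
    drawn := s.drawn + 1 }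

/-- The initial state: the natural scalar `0` holds `n`, the real scalar `0` holds `ε`, and
everything else is zero. -/
noncomputable def init (n : ℕ) (ε : ℝ) : State where
  nvar := Function.update (fun _ => 0) 0 n
  rvar := Function.update (fun _ => 0) 0 ε
  narr := fun _ _ => 0
  rarr := fun _ _ => 0
  drawn := 0

/-- The final state `s` represents the output `(J, h)`: the natural scalar `0` holds `|J|`, the
natural array `0` starts with an enumeration `v 0, v 1, …` of `J`, and the real array `0` starts
with the truth table of `h` as a function of `x (v 0), x (v 1), …`. -/
def Outputs {n : ℕ} (s : State) (J : Finset (Fin n)) (h : Cube n → ℝ) : Prop :=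
  ∃ (k : ℕ) (v : Fin k ↪ Fin n),
    s.nvar 0 = k ∧
    Finset.univ.map v = J ∧
    (∀ j : Fin k, s.narr 0 j = v j) ∧
    ∀ x : Cube n,
      h x = s.rarr 0 (∑ j : Fin k, if x (v j) = true then 2 ^ (j : ℕ) else 0)

end State

/-- `Exec f ω p s s' T`: started in state `s`, with target function `f` and with `ω 0, ω 1, …` as
the points of the examples, the program `p` halts in state `s'` after `T` steps. Requesting an
example costs `n + 1` steps. -/
inductive Exec {n : ℕ} (f : Cube n → ℝ) (ω : ℕ → Cube n) : Cmd → State → State → ℕ → Prop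
  | skip (s : State) : Exec f ω .skip s s 1
  | setN (v : ℕ) (e : NExp) (s : State) :
      Exec f ω (.setN v e) s (s.setN v (e.eval s)) (e.cost + 1)
  | setR (v : ℕ) (e : RExp) (s : State) :
      Exec f ω (.setR v e) s (s.setR v (e.eval s)) (e.cost + 1)
  | putN (a : ℕ) (i e : NExp) (s : State) :
      Exec f ω (.putN a i e) s (s.putN a (i.eval s) (e.eval s)) (i.cost + e.cost + 1)
  | putR (a : ℕ) (i : NExp) (e : RExp) (s : State) :
      Exec f ω (.putR a i e) s (s.putR a (i.eval s) (e.eval s)) (i.cost + e.cost + 1)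
  | draw (a v : ℕ) (s : State) :
      Exec f ω (.draw a v) s (s.receive a v (ω s.drawn) (f (ω s.drawn))) (n + 1)
  | seq {p q : Cmd} {s₁ s₂ s₃ : State} {T₁ T₂ : ℕ}
      (hp : Exec f ω p s₁ s₂ T₁) (hq : Exec f ω q s₂ s₃ T₂) :
      Exec f ω (.seq p q) s₁ s₃ (T₁ + T₂)
  | iteTrue {b : BExp} {p : Cmd} (q : Cmd) {s s' : State} {T : ℕ}
      (hb : b.Holds s) (hp : Exec f ω p s s' T) :
      Exec f ω (.ite b p q) s s' (b.cost + 1 + T)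
  | iteFalse {b : BExp} (p : Cmd) {q : Cmd} {s s' : State} {T : ℕ}
      (hb : ¬ b.Holds s) (hq : Exec f ω q s s' T) :
      Exec f ω (.ite b p q) s s' (b.cost + 1 + T)
  | whileTrue {b : BExp} {p : Cmd} {s₁ s₂ s₃ : State} {T₁ T₂ : ℕ}
      (hb : b.Holds s₁) (hp : Exec f ω p s₁ s₂ T₁) (hw : Exec f ω (.while b p) s₂ s₃ T₂) :
      Exec f ω (.while b p) s₁ s₃ (b.cost + 1 + T₁ + T₂)
  | whileFalse {b : BExp} (p : Cmd) {s : State} (hb : ¬ b.Holds s) :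
      Exec f ω (.while b p) s s (b.cost + 1)

end RealRAM

/-!
The learner rests on two facts about a submodular `f` with values in the unit interval, both of
which come from the monotonicity of its discrete derivatives.

*`f` is close to a junta.* For a set `I` of coordinates consider the expected maximum of `f` over
the subsets of a random `q`-biased subset of `I`. By submodularity, adding a coordinate `i` to `I`
raises this potential by at least `q` times the expectation of the positive part of `∂ᵢ f` at the
random subset (`potential_insert`), while the potential stays in `[0, 1]`. Hence a set `J` of size
`O(1 / (α q))` can be chosen so that, for every `i` outside of `J`, the event `∂ᵢ f > α` at the
random subset of `J` has probability at most `1 / 2` (`exists_greedy_set`). This event is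
decreasing, and the bias is chosen such that a uniform point is the union of `κ` independent biased
ones, so at a uniform point the event has probability at most `2 ^ (-κ)`, also relative to the
weight `(∂ᵢ f)⁺` (`bavg_boost`). The positive parts have a bounded sum, so that the sum of the
squares of the positive parts over the coordinates outside of `J` is `O(α + κ 2 ^ (-κ))`. Applied
to `f` and to `x ↦ f xᶜ`, this and the Efron–Stein inequality show that `f` is within `ε` of its
conditional average on `O(ε⁻² log (1 / ε))` coordinates (`exists_junta`).

*The relevant coordinates are visible in the coefficients of degree one and two.* Second
derivatives of a submodular function are nonpositive, so their `ℓ₁`-norms are Fourier coefficients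
of degree two up to the factor four. By the `ℓ₁` Poincaré inequality, a coordinate whose
coefficients of degree one and two are all small has small influence on the conditional average
(`avg_abs_der_condAvg_le`), and it may be dropped from the junta. By Bessel's inequality only few
coordinates remain (`card_mul_sq_le_two`). Since the conditional average is optimal among juntas on
the same coordinates up to a factor two, some set of relevant coordinates of the prescribed size
has a conditional average that is close to `f` (`exists_subset_approx`).

The program therefore estimates all coefficients of degree one and two, lists the relevant
coordinates, estimates the conditional average for every candidate set of relevant coordinates,
estimates on fresh examples how far these are from `f`, and keeps the best one. A table of
estimates is only nearly submodular. Adding a small multiple of `k² - |x|²`, which is strictly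
submodular, and rescaling makes it submodular with values in the unit interval
(`tableGood_outTable`), at a cost below `ε / 6`. The program checks the repaired table and falls
back on the zero function, so that its output is admissible for every sample. For `ε ≥ 1 / 2` it
returns the constant `1 / 2`.

The examples are good with probability at least `2 / 3` by Hoeffding's inequality and union bounds;
the list of relevant coordinates is a function of the first block of examples, and the later blocks
are independent of it (`measureReal_good_ge`). The running time is bounded with a calculus of
total-correctness triples `Reach`, which record what a program achieves and a bound for its number
of steps.
-/

namespace CubeFn

open Finset

variable {n : ℕ}

/-! ### Averages, discrete derivatives and conditional averages on the cube -/

/-- The expectation of `F` under the uniform law on the cube. -/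
noncomputable def avg (F : Cube n → ℝ) : ℝ := (∑ x, F x) / 2 ^ n

theorem l1Dist_eq_avg (f h : Cube n → ℝ) : l1Dist f h = avg fun x => |f x - h x| := rfl

theorem avg_add (F G : Cube n → ℝ) : avg (fun x => F x + G x) = avg F + avg G := by
  simp [avg, sum_add_distrib, add_div]

theorem avg_sub (F G : Cube n → ℝ) : avg (fun x => F x - G x) = avg F - avg G := by
  simp [avg, sum_sub_distrib, sub_div]

theorem avg_const_mul (c : ℝ) (F : Cube n → ℝ) : avg (fun x => c * F x) = c * avg F := by
  simp [avg, ← mul_sum, mul_div_assoc]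

theorem avg_neg (F : Cube n → ℝ) : avg (fun x => -F x) = -avg F := by
  simp [avg, neg_div]

theorem avg_sum {ι : Type*} (s : Finset ι) (F : ι → Cube n → ℝ) :
    avg (fun x => ∑ i ∈ s, F i x) = ∑ i ∈ s, avg (F i) := by
  simp only [avg]
  rw [sum_comm, sum_div]

theorem avg_mono {F G : Cube n → ℝ} (h : ∀ x, F x ≤ G x) : avg F ≤ avg G := by
  unfold avg
  gcongr with x
  exact h x

theorem avg_const (c : ℝ) : avg (fun _ : Cube n => c) = c := by
  simp [avg]

theorem avg_nonneg {F : Cube n → ℝ} (h : ∀ x, 0 ≤ F x) : 0 ≤ avg F := by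
  simpa [avg_const] using avg_mono (F := fun _ => 0) h

theorem avg_comp_equiv (e : Cube n ≃ Cube n) (F : Cube n → ℝ) :
    avg (fun x => F (e x)) = avg F := by
  simp only [avg]
  rw [Equiv.sum_comp e]

theorem abs_avg_le (F : Cube n → ℝ) : |avg F| ≤ avg fun x => |F x| := by
  unfold avg
  rw [abs_div, abs_of_pos (by positivity : (0 : ℝ) < 2 ^ n)]
  gcongr
  exact abs_sum_le_sum_abs _ _

theorem sq_avg_abs_le (F : Cube n → ℝ) : (avg fun x => |F x|) ^ 2 ≤ avg fun x => F x ^ 2 := by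
  set a := avg fun x => |F x| with ha
  have h0 : 0 ≤ avg fun x => (F x ^ 2 - (2 * a) * |F x| + a ^ 2) := by
    refine avg_nonneg fun x => ?_
    rw [← sq_abs (F x)]
    nlinarith [sq_nonneg (|F x| - a)]
  rw [avg_add (fun x => F x ^ 2 - (2 * a) * |F x|), avg_sub, avg_const_mul, avg_const, ← ha] at h0
  nlinarith

/-- Negation of one coordinate. -/
def flip (i : Fin n) : Cube n ≃ Cube n where
  toFun x := Function.update x i (!x i)
  invFun x := Function.update x i (!x i)
  left_inv x := by simp
  right_inv x := by simp

/-- The average of `F` over the coordinate `i`. -/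
noncomputable def smooth (i : Fin n) (F : Cube n → ℝ) (x : Cube n) : ℝ :=
  (F (Function.update x i true) + F (Function.update x i false)) / 2

/-- The discrete derivative of `F` in the direction `i`. -/
def der (i : Fin n) (F : Cube n → ℝ) (x : Cube n) : ℝ :=
  F (Function.update x i true) - F (Function.update x i false)

theorem smooth_eq (i : Fin n) (F : Cube n → ℝ) (x : Cube n) :
    smooth i F x = (F x + F (flip i x)) / 2 := by
  have hx : Function.update x i (x i) = x := by simp
  cases h : x i <;> rw [h] at hx <;> simp [smooth, flip, h, hx, add_comm]

theorem avg_smooth (i : Fin n) (F : Cube n → ℝ) : avg (smooth i F) = avg F := by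
  have h : smooth i F = fun x => (1 / 2) * (F x + F (flip i x)) := by
    funext x; rw [smooth_eq]; ring
  rw [h, avg_const_mul, avg_add, avg_comp_equiv (flip i) F]
  ring

theorem abs_sub_smooth (i : Fin n) (F : Cube n → ℝ) (x : Cube n) :
    |F x - smooth i F x| = 1 / 2 * |der i F x| := by
  have hx : Function.update x i (x i) = x := by simp
  have h2 : (1 / 2 : ℝ) = |1 / 2| := by norm_num
  rw [h2, ← abs_mul]
  cases h : x i <;> rw [h] at hx <;> simp only [smooth, der, hx]
  · rw [← abs_neg]; congr 1; ring
  · congr 1; ring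

@[simp] theorem smooth_update (i : Fin n) (F : Cube n → ℝ) (x : Cube n) (b : Bool) :
    smooth i F (Function.update x i b) = smooth i F x := by simp [smooth]

@[simp] theorem der_update (i : Fin n) (F : Cube n → ℝ) (x : Cube n) (b : Bool) :
    der i F (Function.update x i b) = der i F x := by simp [der]

/-- The conditional average of `f` given the coordinates in `J`. -/
noncomputable def condAvg (J : Finset (Fin n)) (f : Cube n → ℝ) (x : Cube n) : ℝ :=
  avg fun z => f (J.piecewise x z)

theorem condAvg_univ (f : Cube n → ℝ) : condAvg univ f = f := by
  funext x; simp [condAvg, avg_const]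

theorem condAvg_empty (f : Cube n → ℝ) (x : Cube n) : condAvg ∅ f x = avg f := by
  simp [condAvg]

/-- Conditional averages are obtained by averaging over one coordinate after another; this drives
the inductions for the Poincaré and the Efron–Stein inequality. -/
theorem condAvg_eq_smooth {J : Finset (Fin n)} {i : Fin n} (hi : i ∉ J) (f : Cube n → ℝ) :
    condAvg J f = smooth i (condAvg (insert i J) f) := by
  have key : ∀ (x z : Cube n) (b : Bool),
      (insert i J).piecewise (Function.update x i b) z = J.piecewise x (Function.update z i b) := by
    intro x z b
    funext j
    by_cases hj : j = i
    · subst hj; simp [hi]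
    · by_cases hJ : j ∈ J <;> simp [hj, hJ, Finset.piecewise]
  have key2 : ∀ (x z : Cube n) (b : Bool), J.piecewise x (Function.update z i b)
      = Function.update (J.piecewise x z) i b := by
    intro x z b
    funext j
    by_cases hj : j = i
    · subst hj; simp [hi]
    · by_cases hJ : j ∈ J <;> simp [hj, hJ, Finset.piecewise]
  funext x
  simp only [smooth, condAvg, key]
  rw [← avg_add, ← avg_smooth i]
  have : ∀ z, smooth i (fun z => f (J.piecewise x z)) z = (1 / 2) *
      (f (J.piecewise x (Function.update z i true)) +
        f (J.piecewise x (Function.update z i false))) := by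
    intro z; simp only [smooth]; ring
  rw [funext this, avg_const_mul]
  ring

theorem dependsOn_condAvg (J : Finset (Fin n)) (f : Cube n → ℝ) :
    DependsOn (condAvg J f) (J : Set (Fin n)) := by
  intro x y hxy
  unfold condAvg
  congr 1
  funext z
  congr 1
  funext j
  by_cases hJ : j ∈ J
  · simpa [hJ, Finset.piecewise] using hxy j hJ
  · simp [hJ, Finset.piecewise]

theorem condAvg_of_dependsOn {J : Finset (Fin n)} {f : Cube n → ℝ}
    (hf : DependsOn f (J : Set (Fin n))) : condAvg J f = f := by
  funext x
  have : ∀ z, f (J.piecewise x z) = f x := by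
    intro z
    refine hf fun j hj => ?_
    have hj' : j ∈ J := hj
    simp [hj', Finset.piecewise]
  simp [condAvg, this, avg_const]

/-- Exchanging the coordinates outside `J` of two independent points preserves their law. -/
theorem avg_condAvg (J : Finset (Fin n)) (f : Cube n → ℝ) : avg (condAvg J f) = avg f := by
  have e : Function.Involutive
      (fun p : Cube n × Cube n =>
        ((J.piecewise p.1 p.2, J.piecewise p.2 p.1) : Cube n × Cube n)) := by
    intro p
    ext j <;> by_cases hJ : j ∈ J <;> simp [hJ, Finset.piecewise]
  have h := Equiv.sum_comp e.toPerm (fun p : Cube n × Cube n => f p.1)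
  simp only [Function.Involutive.coe_toPerm, Fintype.sum_prod_type] at h
  have h1 : avg (condAvg J f) = (∑ x, ∑ y, f (J.piecewise x y)) / 2 ^ n / 2 ^ n := by
    simp only [condAvg, avg]
    rw [← sum_div]
  rw [h1, h]
  simp [avg, ← mul_sum]

theorem condAvg_sub (J : Finset (Fin n)) (f g : Cube n → ℝ) (x : Cube n) :
    condAvg J (fun x => f x - g x) x = condAvg J f x - condAvg J g x := by
  simp only [condAvg]; rw [avg_sub]

theorem avg_abs_condAvg_le (J : Finset (Fin n)) (f : Cube n → ℝ) :
    avg (fun x => |condAvg J f x|) ≤ avg fun x => |f x| := by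
  rw [← avg_condAvg J fun x => |f x|]
  exact avg_mono fun x => abs_avg_le _

theorem condAvg_mem_Icc {f : Cube n → ℝ} (hf : ∀ x, f x ∈ Set.Icc (0 : ℝ) 1)
    (J : Finset (Fin n)) (x : Cube n) : condAvg J f x ∈ Set.Icc (0 : ℝ) 1 := by
  constructor
  · exact avg_nonneg fun z => (hf _).1
  · have := avg_mono (F := fun z => f (J.piecewise x z)) (G := fun _ => 1) fun z => (hf _).2
    rwa [avg_const] at this

theorem isSubmodular_condAvg {f : Cube n → ℝ} (hf : IsSubmodular f) (J : Finset (Fin n)) :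
    IsSubmodular (condAvg J f) := by
  intro x y
  unfold condAvg
  rw [← avg_add, ← avg_add]
  refine avg_mono fun z => ?_
  have h1 : J.piecewise (x ⊔ y) z = J.piecewise x z ⊔ J.piecewise y z := by
    funext j; by_cases hJ : j ∈ J <;> simp [hJ, Finset.piecewise]
  have h2 : J.piecewise (x ⊓ y) z = J.piecewise x z ⊓ J.piecewise y z := by
    funext j; by_cases hJ : j ∈ J <;> simp [hJ, Finset.piecewise]
  rw [h1, h2]
  exact hf _ _

theorem der_condAvg_of_mem {J : Finset (Fin n)} {i : Fin n} (hi : i ∈ J) (f : Cube n → ℝ) :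
    der i (condAvg J f) = condAvg J (der i f) := by
  have key : ∀ (x z : Cube n) (b : Bool), J.piecewise (Function.update x i b) z
      = Function.update (J.piecewise x z) i b := by
    intro x z b
    funext j
    by_cases hj : j = i
    · subst hj; simp [hi]
    · by_cases hJ : j ∈ J <;> simp [hj, hJ, Finset.piecewise]
  funext x
  simp only [der, condAvg, key]
  rw [← avg_sub]

theorem der_condAvg_of_notMem {J : Finset (Fin n)} {i : Fin n} (hi : i ∉ J) (f : Cube n → ℝ)
    (x : Cube n) : der i (condAvg J f) x = 0 := by
  rw [condAvg_eq_smooth hi]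
  simp [der]

/-- The `ℓ₁` Poincaré inequality relative to a set of coordinates. -/
theorem avg_abs_sub_condAvg_le (J : Finset (Fin n)) (h : Cube n → ℝ) :
    avg (fun x => |h x - condAvg J h x|) ≤ 1 / 2 * ∑ i ∈ Jᶜ, avg fun x => |der i h x| := by
  suffices H : ∀ U : Finset (Fin n),
      avg (fun x => |h x - condAvg Uᶜ h x|) ≤ 1 / 2 * ∑ i ∈ U, avg fun x => |der i h x| by
    simpa using H Jᶜ
  intro U
  induction U using Finset.induction_on with
  | empty => simp [condAvg_univ, avg_const]
  | insert i U hi ih =>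
    have hi' : i ∉ (insert i U)ᶜ := by simp
    have hU : insert i (insert i U)ᶜ = Uᶜ := by
      ext j; simp only [mem_insert, mem_compl, not_or]
      by_cases hj : j = i
      · subst hj; simp [hi]
      · simp [hj]
    rw [sum_insert hi, condAvg_eq_smooth hi', hU]
    set g := condAvg Uᶜ h
    have h1 : ∀ x, |h x - smooth i g x| ≤
        1 / 2 * |der i h x| + smooth i (fun x => |h x - g x|) x := by
      intro x
      have : h x - smooth i g x = (h x - smooth i h x) + smooth i (fun x => h x - g x) x := by
        simp only [smooth]; ring
      rw [this]
      refine (abs_add_le _ _).trans (add_le_add (abs_sub_smooth i h x).le ?_)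
      simp only [smooth]
      rw [abs_div, abs_of_pos (by norm_num : (0 : ℝ) < 2)]
      gcongr
      exact abs_add_le _ _
    refine (avg_mono h1).trans ?_
    rw [avg_add, avg_const_mul, avg_smooth]
    linarith

/-- The Efron–Stein inequality relative to a set of coordinates. -/
theorem avg_sq_sub_condAvg_le (J : Finset (Fin n)) (h : Cube n → ℝ) :
    avg (fun x => (h x - condAvg J h x) ^ 2) ≤ 1 / 4 * ∑ i ∈ Jᶜ, avg fun x => der i h x ^ 2 := by
  suffices H : ∀ U : Finset (Fin n),
      avg (fun x => (h x - condAvg Uᶜ h x) ^ 2) ≤ 1 / 4 * ∑ i ∈ U, avg fun x => der i h x ^ 2 by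
    simpa using H Jᶜ
  intro U
  induction U using Finset.induction_on with
  | empty => simp [condAvg_univ, avg_const]
  | insert i U hi ih =>
    have hi' : i ∉ (insert i U)ᶜ := by simp
    have hU : insert i (insert i U)ᶜ = Uᶜ := by
      ext j; simp only [mem_insert, mem_compl, not_or]
      by_cases hj : j = i
      · subst hj; simp [hi]
      · simp [hj]
    rw [sum_insert hi, condAvg_eq_smooth hi', hU]
    set g := condAvg Uᶜ h
    -- averaging over the coordinate `i` kills the cross term
    have h1 : ∀ x, smooth i (fun x => (h x - smooth i g x) ^ 2) x ≤
        1 / 4 * der i h x ^ 2 + smooth i (fun x => (h x - g x) ^ 2) x := by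
      intro x
      simp only [smooth, der, Function.update_idem]
      nlinarith [sq_nonneg ((h (Function.update x i true) - g (Function.update x i true)) -
        (h (Function.update x i false) - g (Function.update x i false)))]
    rw [← avg_smooth i]
    refine (avg_mono h1).trans ?_
    rw [avg_add, avg_const_mul, avg_smooth]
    linarith

/-! ### Derivatives of submodular functions -/

/-- Submodularity means diminishing returns. -/
theorem der_antitone {f : Cube n → ℝ} (hf : IsSubmodular f) (i : Fin n) : Antitone (der i f) := by
  intro x y hxy
  have h := hf (Function.update x i true) (Function.update y i false)
  have h1 : Function.update x i true ⊔ Function.update y i false = Function.update y i true := by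
    funext j
    by_cases hj : j = i
    · subst hj; simp
    · have hj' := hxy j
      rw [Bool.le_iff_imp] at hj'
      simpa [hj] using hj'
  have h2 : Function.update x i true ⊓ Function.update y i false = Function.update x i false := by
    funext j
    by_cases hj : j = i
    · subst hj; simp
    · have hj' := hxy j
      rw [Bool.le_iff_imp] at hj'
      simpa [hj] using hj'
  rw [h1, h2] at h
  simp only [der]
  linarith

theorem der_der_nonpos {f : Cube n → ℝ} (hf : IsSubmodular f) (i j : Fin n) (x : Cube n) :
    der j (der i f) x ≤ 0 := by
  have : Function.update x j false ≤ Function.update x j true := by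
    intro k; by_cases hk : k = j
    · subst hk; simp
    · simp [hk]
  have := der_antitone hf i this
  simp only [der] at this ⊢
  linarith

theorem abs_der_le_one {f : Cube n → ℝ} (hf : ∀ x, f x ∈ Set.Icc (0 : ℝ) 1) (i : Fin n)
    (x : Cube n) : |der i f x| ≤ 1 := by
  have h1 := hf (Function.update x i true)
  have h2 := hf (Function.update x i false)
  simp only [Set.mem_Icc] at h1 h2
  rw [der, abs_le]
  constructor <;> linarith

/-- The `±1`-valued coordinate function: `1` at `false` and `-1` at `true`. -/
def sgn (b : Bool) : ℝ := if b then -1 else 1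

theorem avg_der (i : Fin n) (F : Cube n → ℝ) :
    avg (der i F) = -2 * avg fun x => F x * sgn (x i) := by
  rw [← avg_smooth i fun x => F x * sgn (x i), ← avg_const_mul]
  congr 1
  funext x
  simp [smooth, der, sgn]
  ring

theorem avg_der_der {i j : Fin n} (hij : i ≠ j) (F : Cube n → ℝ) :
    avg (der j (der i F)) = 4 * avg fun x => F x * sgn (x i) * sgn (x j) := by
  rw [avg_der]
  have h : (fun x => der i F x * sgn (x j)) = der i fun x => F x * sgn (x j) := by
    funext x
    simp only [der, Function.update_of_ne hij.symm]
    ring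
  rw [h, avg_der]
  have : (fun x : Cube n => F x * sgn (x j) * sgn (x i))
      = fun x => F x * sgn (x i) * sgn (x j) := by funext x; ring
  rw [this]; ring

end CubeFn

namespace CubeFn

open Finset

variable {n : ℕ}

/-! ### Biased averages on the cube -/

/-- The probability of `x` when the coordinates are independent and `true` with probability `q`. -/
def wt (q : ℝ) (x : Cube n) : ℝ := ∏ i, if x i then q else 1 - q

/-- The expectation of `F` under the `q`-biased product law. -/
def bavg (q : ℝ) (F : Cube n → ℝ) : ℝ := ∑ x, wt q x * F x

theorem wt_nonneg {q : ℝ} (h0 : 0 ≤ q) (h1 : q ≤ 1) (x : Cube n) : 0 ≤ wt q x := by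
  refine prod_nonneg fun i _ => ?_
  split_ifs <;> linarith

theorem sum_wt (q : ℝ) : ∑ x : Cube n, wt q x = 1 := by
  have h := prod_univ_sum (fun _ : Fin n => (univ : Finset Bool))
    (fun _ b => if b then q else 1 - q)
  simp only [Fintype.piFinset_univ] at h
  unfold wt
  rw [← h]
  simp

theorem bavg_mono {q : ℝ} (h0 : 0 ≤ q) (h1 : q ≤ 1) {F G : Cube n → ℝ} (h : ∀ x, F x ≤ G x) :
    bavg q F ≤ bavg q G :=
  sum_le_sum fun x _ => mul_le_mul_of_nonneg_left (h x) (wt_nonneg h0 h1 x)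

theorem bavg_const (q c : ℝ) : bavg q (fun _ : Cube n => c) = c := by
  simp [bavg, ← sum_mul, sum_wt]

theorem bavg_nonneg {q : ℝ} (h0 : 0 ≤ q) (h1 : q ≤ 1) {F : Cube n → ℝ} (h : ∀ x, 0 ≤ F x) :
    0 ≤ bavg q F := sum_nonneg fun x _ => mul_nonneg (wt_nonneg h0 h1 x) (h x)

theorem bavg_add (q : ℝ) (F G : Cube n → ℝ) :
    bavg q (fun x => F x + G x) = bavg q F + bavg q G := by
  simp [bavg, mul_add, sum_add_distrib]

theorem bavg_const_mul (q c : ℝ) (F : Cube n → ℝ) :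
    bavg q (fun x => c * F x) = c * bavg q F := by
  simp only [bavg, mul_sum]
  exact sum_congr rfl fun x _ => by ring

theorem bavg_half (F : Cube n → ℝ) : bavg (1 / 2) F = avg F := by
  have : ∀ x : Cube n, wt (1 / 2) x = (1 / 2) ^ n := by
    intro x
    have h : ∀ b : Bool, (if b then (1 / 2 : ℝ) else 1 - 1 / 2) = 1 / 2 := by
      intro b; cases b <;> norm_num
    simp only [wt, h, prod_const, card_univ, Fintype.card_fin]
  simp only [bavg, avg, this, sum_div]
  refine sum_congr rfl fun x _ => ?_
  rw [div_pow, one_pow]; ring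

/-- The union of independent `p`-biased and `q`-biased sets is a biased set. -/
theorem bavg_sup (p q : ℝ) (F : Cube n → ℝ) :
    bavg p (fun x => bavg q fun y => F (x ⊔ y)) = bavg (1 - (1 - p) * (1 - q)) F := by
  have key : ∀ z : Cube n, (∑ x : Cube n, ∑ y : Cube n,
      if x ⊔ y = z then wt p x * wt q y else 0) = wt (1 - (1 - p) * (1 - q)) z := by
    intro z
    have h1 : ∀ x y : Cube n, (if x ⊔ y = z then wt p x * wt q y else 0) =
        ∏ i, if (x i || y i) = z i then
          (if x i then p else 1 - p) * (if y i then q else 1 - q) else 0 := by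
      intro x y
      split_ifs with h
      · subst h
        rw [wt, wt, ← prod_mul_distrib]
        exact prod_congr rfl fun i _ => (if_pos rfl).symm
      · have : ∃ i, (x i || y i) ≠ z i := by
          by_contra hc
          push Not at hc
          exact h (funext hc)
        obtain ⟨i, hi⟩ := this
        exact (prod_eq_zero (mem_univ i) (if_neg hi)).symm
    simp only [h1]
    have h2 : ∀ x : Cube n, (∑ y : Cube n, ∏ i, if (x i || y i) = z i then
          (if x i then p else 1 - p) * (if y i then q else 1 - q) else 0)
        = ∏ i, ∑ c : Bool, if (x i || c) = z i then
          (if x i then p else 1 - p) * (if c then q else 1 - q) else 0 := by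
      intro x
      have h := prod_univ_sum (fun _ : Fin n => (univ : Finset Bool))
        (fun i c => if (x i || c) = z i then
          (if x i then p else 1 - p) * (if c then q else 1 - q) else 0)
      simp only [Fintype.piFinset_univ] at h
      exact h.symm
    simp only [h2]
    have h3 := prod_univ_sum (fun _ : Fin n => (univ : Finset Bool))
        (fun i b => ∑ c : Bool, if (b || c) = z i then
          (if b then p else 1 - p) * (if c then q else 1 - q) else 0)
    simp only [Fintype.piFinset_univ] at h3
    rw [← h3]
    refine prod_congr rfl fun i _ => ?_
    cases z i <;> simp
    ring
  calc bavg p (fun x => bavg q fun y => F (x ⊔ y))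
      = ∑ x : Cube n, ∑ y : Cube n, ∑ z : Cube n,
          (if x ⊔ y = z then wt p x * wt q y else 0) * F z := by
        unfold bavg
        refine sum_congr rfl fun x _ => ?_
        rw [mul_sum]
        refine sum_congr rfl fun y _ => ?_
        simp [ite_mul, mul_assoc]
    _ = ∑ z : Cube n, ∑ x : Cube n, ∑ y : Cube n,
          (if x ⊔ y = z then wt p x * wt q y else 0) * F z := by
        rw [sum_congr rfl fun x _ => sum_comm, sum_comm]
    _ = _ := by
        unfold bavg
        refine sum_congr rfl fun z _ => ?_
        rw [← key z, sum_mul]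
        exact sum_congr rfl fun x _ => (sum_mul _ _ _).symm

/-- Resampling one coordinate. -/
theorem bavg_update (q : ℝ) (i : Fin n) (F : Cube n → ℝ) :
    bavg q F = bavg q fun x =>
      q * F (Function.update x i true) + (1 - q) * F (Function.update x i false) := by
  have hs : ∀ H : Cube n → ℝ, ∑ x, H x = ∑ x, smooth i H x := by
    intro H
    have h := avg_smooth i H
    unfold avg at h
    have h2 : (2 : ℝ) ^ n ≠ 0 := by positivity
    field_simp at h
    exact h.symm
  have hw : ∀ (x : Cube n) (b : Bool), wt q (Function.update x i b) =
      (if b then q else 1 - q) * ∏ j ∈ univ.erase i, if x j then q else 1 - q := by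
    intro x b
    unfold wt
    rw [← mul_prod_erase univ _ (mem_univ i)]
    congr 1
    · simp
    · refine prod_congr rfl fun j hj => ?_
      rw [Function.update_of_ne (ne_of_mem_erase hj)]
  unfold bavg
  rw [hs, hs fun x => wt q x * _]
  refine sum_congr rfl fun x _ => ?_
  simp only [smooth, hw, Function.update_idem]
  simp only [if_true, Bool.false_eq_true, if_false]
  ring

/-! ### The greedy junta -/

open Classical in
/-- The largest value of `f` on the subsets of `x`. -/
noncomputable def supBelow (f : Cube n → ℝ) (x : Cube n) : ℝ :=
  (univ.filter (· ≤ x)).sup' ⟨x, by simp⟩ f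

open Classical in
theorem le_supBelow (f : Cube n → ℝ) {x y : Cube n} (h : y ≤ x) : f y ≤ supBelow f x :=
  le_sup' f (mem_filter.mpr ⟨mem_univ y, h⟩)

theorem exists_supBelow (f : Cube n → ℝ) (x : Cube n) : ∃ y ≤ x, supBelow f x = f y := by
  classical
  obtain ⟨y, hy, h⟩ := exists_mem_eq_sup' (s := univ.filter (· ≤ x)) ⟨x, by simp⟩ f
  exact ⟨y, by simpa using hy, h⟩

theorem supBelow_mem_Icc {f : Cube n → ℝ} (hf : ∀ x, f x ∈ Set.Icc (0 : ℝ) 1) (x : Cube n) :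
    supBelow f x ∈ Set.Icc (0 : ℝ) 1 := by
  obtain ⟨y, -, h⟩ := exists_supBelow f x
  rw [h]; exact hf y

/-- Adding `i` to a maximizer below `u` gains at least the derivative at `u`, since the derivatives
decrease. -/
theorem supBelow_add_le {f : Cube n → ℝ} (hf : IsSubmodular f) {u : Cube n} {i : Fin n}
    (hu : u i = false) :
    supBelow f u + max (der i f u) 0 ≤ supBelow f (Function.update u i true) := by
  obtain ⟨y, hy, h⟩ := exists_supBelow f u
  have hle : u ≤ Function.update u i true := by
    intro j
    by_cases hj : j = i
    · subst hj; simp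
    · simp [hj]
  rw [h]
  rcases le_total (der i f u) 0 with h0 | h0
  · rw [max_eq_right h0, add_zero]
    exact le_supBelow f (hy.trans hle)
  · rw [max_eq_left h0]
    have hyi : y i = false := by
      have := hy i
      rw [hu] at this
      exact le_bot_iff.mp this
    have h1 : Function.update y i false = y := by rw [← hyi]; simp
    have h2 := der_antitone hf i hy
    have h3 : der i f y = f (Function.update y i true) - f y := by rw [der, h1]
    have h4 : Function.update y i true ≤ Function.update u i true := by
      intro j
      by_cases hj : j = i
      · subst hj; simp
      · simpa [hj] using hy j
    have := le_supBelow f h4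
    linarith

/-- The expected largest value of `f` on the subsets of a random `q`-biased subset of `I`: the
potential function that bounds the size of the junta. -/
noncomputable def potential (q : ℝ) (f : Cube n → ℝ) (I : Finset (Fin n)) : ℝ :=
  bavg q fun x => supBelow f (I.piecewise x ⊥)

theorem potential_mem_Icc {q : ℝ} (h0 : 0 ≤ q) (h1 : q ≤ 1) {f : Cube n → ℝ}
    (hf : ∀ x, f x ∈ Set.Icc (0 : ℝ) 1) (I : Finset (Fin n)) :
    potential q f I ∈ Set.Icc (0 : ℝ) 1 := by
  constructor
  · exact bavg_nonneg h0 h1 fun x => (supBelow_mem_Icc hf _).1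
  · have := bavg_mono h0 h1 (F := fun x => supBelow f (I.piecewise x ⊥)) (G := fun _ => 1)
      fun x => (supBelow_mem_Icc hf _).2
    rwa [bavg_const] at this

/-- The growth of the potential: with probability `q` the new coordinate is selected. -/
theorem potential_insert {q : ℝ} (h0 : 0 ≤ q) (h1 : q ≤ 1) {f : Cube n → ℝ}
    (hf : IsSubmodular f) {I : Finset (Fin n)} {i : Fin n} (hi : i ∉ I) :
    potential q f I + q * bavg q (fun x => max (der i f (I.piecewise x ⊥)) 0) ≤
      potential q f (insert i I) := by
  unfold potential
  rw [bavg_update q i fun x => supBelow f ((insert i I).piecewise x ⊥), ← bavg_const_mul,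
    ← bavg_add]
  refine bavg_mono h0 h1 fun x => ?_
  have hb : ∀ b : Bool, (insert i I).piecewise (Function.update x i b) ⊥ =
      Function.update (I.piecewise x (⊥ : Cube n)) i b := by
    intro b
    funext j
    by_cases hj : j = i
    · subst hj; simp
    · by_cases hI : j ∈ I <;> simp [hj, hI, Finset.piecewise]
  rw [hb, hb]
  set u := I.piecewise x (⊥ : Cube n) with hudef
  have hu : u i = false := by simp [hudef, hi]
  have hu2 : Function.update u i false = u := by rw [← hu]; simp
  have := supBelow_add_le hf hu
  rw [hu2]
  nlinarith

theorem piecewise_bot_le (I : Finset (Fin n)) (x : Cube n) : I.piecewise x ⊥ ≤ x := by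
  intro j
  by_cases hI : j ∈ I <;> simp [hI, Finset.piecewise]

/-- The positive parts of the derivatives of a bounded submodular function have bounded sum. -/
theorem sum_bavg_pos_der_le {q : ℝ} (h0 : 0 < q) (h1 : q ≤ 1) {f : Cube n → ℝ}
    (hf : IsSubmodular f) (hf1 : ∀ x, f x ∈ Set.Icc (0 : ℝ) 1) :
    ∑ i, bavg q (fun x => max (der i f x) 0) ≤ 1 / q := by
  have H : ∀ I : Finset (Fin n),
      q * ∑ i ∈ I, bavg q (fun x => max (der i f x) 0) ≤ potential q f I := by
    intro I
    induction I using Finset.induction_on with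
    | empty => simpa using (potential_mem_Icc h0.le h1 hf1 ∅).1
    | insert i I hi ih =>
      rw [sum_insert hi, mul_add]
      have h2 := potential_insert h0.le h1 hf hi
      have h3 : bavg q (fun x => max (der i f x) 0) ≤
          bavg q fun x => max (der i f (I.piecewise x ⊥)) 0 :=
        bavg_mono h0.le h1 fun x => max_le_max (der_antitone hf i (piecewise_bot_le I x)) le_rfl
      nlinarith
  rw [le_div_iff₀ h0, mul_comm]
  exact (H univ).trans (potential_mem_Icc h0.le h1 hf1 univ).2

/-- A set outside of which every positive derivative is small with probability `1/2`: a set `J` of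
the largest size for which the potential has grown by `α q / 2` per element. -/
theorem exists_greedy_set {q α : ℝ} (h0 : 0 < q) (h1 : q ≤ 1) (hα : 0 < α) {f : Cube n → ℝ}
    (hf : IsSubmodular f) (hf1 : ∀ x, f x ∈ Set.Icc (0 : ℝ) 1) :
    ∃ J : Finset (Fin n), (J.card : ℝ) * (α * q / 2) ≤ 1 ∧ ∀ i ∉ J,
      bavg q (fun x => if α < der i f (J.piecewise x ⊥) then (1 : ℝ) else 0) ≤ 1 / 2 := by
  classical
  -- maximality: another coordinate with a likely large derivative would keep the lower bound
  obtain ⟨J, hJ, hmax⟩ := exists_max_image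
    (univ.filter fun J : Finset (Fin n) => (J.card : ℝ) * (α * q / 2) ≤ potential q f J)
    card ⟨∅, by simpa using (potential_mem_Icc h0.le h1 hf1 ∅).1⟩
  simp only [mem_filter, mem_univ, true_and] at hJ hmax
  refine ⟨J, hJ.trans (potential_mem_Icc h0.le h1 hf1 J).2, fun i hi => ?_⟩
  by_contra hc
  push Not at hc
  have h2 := potential_insert h0.le h1 hf hi
  have h3 : α * bavg q (fun x => if α < der i f (J.piecewise x ⊥) then (1 : ℝ) else 0) ≤
      bavg q fun x => max (der i f (J.piecewise x ⊥)) 0 := by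
    rw [← bavg_const_mul]
    refine bavg_mono h0.le h1 fun x => ?_
    split_ifs with h
    · simpa using Or.inl h.le
    · simp
  have h4 := hmax (insert i J) (by
    rw [card_insert_of_notMem hi]
    push_cast
    nlinarith [mul_pos hα h0, mul_lt_mul_of_pos_left hc (mul_pos hα h0)])
  rw [card_insert_of_notMem hi] at h4
  omega

/-- Boosting: a decreasing event that has probability at most `1/2` for a `q`-biased set is
exponentially unlikely for the union of many independent such sets. -/
theorem bavg_boost {q : ℝ} (h0 : 0 ≤ q) (h1 : q ≤ 1) {G u : Cube n → ℝ} (hG : Antitone G)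
    (hG0 : ∀ x, 0 ≤ G x) (hu0 : ∀ x, 0 ≤ u x) (hu1 : ∀ x, u x ≤ 1)
    (hu : ∀ x y, u (x ⊔ y) ≤ u x * u y) (m : ℕ) :
    bavg (1 - (1 - q) ^ (m + 1)) (fun x => G x * u x) ≤ bavg q G * bavg q u ^ m := by
  induction m with
  | zero =>
    simp only [zero_add, pow_one, sub_sub_cancel, pow_zero, mul_one]
    exact bavg_mono h0 h1 fun x => mul_le_of_le_one_right (hG0 x) (hu1 x)
  | succ m ih =>
    have hr0 : 0 ≤ 1 - (1 - q) ^ (m + 1) := by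
      have := pow_le_one₀ (n := m + 1) (by linarith : 0 ≤ 1 - q) (by linarith)
      linarith
    have hr1 : 1 - (1 - q) ^ (m + 1) ≤ 1 := by
      have : 0 ≤ (1 - q) ^ (m + 1) := pow_nonneg (by linarith) _
      linarith
    have hr : 1 - (1 - q) ^ (m + 1 + 1) = 1 - (1 - (1 - (1 - q) ^ (m + 1))) * (1 - q) := by ring
    rw [hr, ← bavg_sup]
    calc _ ≤ bavg (1 - (1 - q) ^ (m + 1)) (fun x => bavg q u * (G x * u x)) := by
          refine bavg_mono hr0 hr1 fun x => ?_
          rw [mul_comm (bavg q u), ← bavg_const_mul]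
          refine bavg_mono h0 h1 fun y => ?_
          calc G (x ⊔ y) * u (x ⊔ y) ≤ G x * (u x * u y) :=
                mul_le_mul (hG le_sup_left) (hu x y) (hu0 _) (hG0 x)
            _ = _ := by ring
      _ ≤ bavg q u * (bavg q G * bavg q u ^ m) := by
          rw [bavg_const_mul]
          exact mul_le_mul_of_nonneg_left ih (bavg_nonneg h0 h1 hu0)
      _ = _ := by ring

/-- The bias for which the union of `κ` independent biased sets is uniform. -/
theorem exists_bias {κ : ℕ} (hκ : 0 < κ) :
    ∃ q : ℝ, 0 < q ∧ q ≤ 1 ∧ 1 / (2 * κ) ≤ q ∧ (1 - q) ^ κ = 1 / 2 := by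
  have hk : (0 : ℝ) < κ := by exact_mod_cast hκ
  have hk1 : (1 : ℝ) ≤ κ := by exact_mod_cast hκ
  set r : ℝ := (1 / 2 : ℝ) ^ (1 / κ : ℝ) with hr
  have hr0 : 0 ≤ r := by positivity
  have hpow : r ^ κ = 1 / 2 := by
    rw [hr, ← Real.rpow_natCast, ← Real.rpow_mul (by norm_num)]
    rw [one_div_mul_cancel hk.ne', Real.rpow_one]
  have hb : 1 / (2 * κ) ≤ 1 - r := by
    by_contra hc
    push Not at hc
    have h2 : 1 - 1 / (2 * (κ : ℝ)) < r := by linarith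
    have h3 : (1 : ℝ) / (2 * κ) ≤ 1 := by
      rw [div_le_one (by positivity)]; linarith
    have h4 : (1 - 1 / (2 * (κ : ℝ))) ^ κ < r ^ κ :=
      pow_lt_pow_left₀ h2 (by linarith) hκ.ne'
    have h5 := one_add_mul_le_pow (a := -(1 / (2 * (κ : ℝ)))) (by linarith) κ
    have h6 : (1 : ℝ) + κ * -(1 / (2 * κ)) = 1 / 2 := by field_simp; ring
    rw [h6, ← sub_eq_add_neg] at h5
    linarith
  exact ⟨1 - r, lt_of_lt_of_le (by positivity) hb, by linarith, hb, by rw [sub_sub_cancel, hpow]⟩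

/-- One half of the junta theorem: the squares of the positive parts of the derivatives have a small
sum outside of a small set. The negative parts are covered by the same statement for `x ↦ f xᶜ`. -/
theorem exists_set_sum_sq_pos_der_le {κ : ℕ} (hκ : 0 < κ) {α : ℝ} (hα : 0 < α) {f : Cube n → ℝ}
    (hf : IsSubmodular f) (hf1 : ∀ x, f x ∈ Set.Icc (0 : ℝ) 1) :
    ∃ J₁ : Finset (Fin n), (J₁.card : ℝ) * α ≤ 4 * κ ∧ ∀ U : Finset (Fin n), Disjoint U J₁ →
      ∑ i ∈ U, avg (fun x => max (der i f x) 0 ^ 2) ≤ 2 * α + 4 * κ / 2 ^ κ := by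
  obtain ⟨q, hq0, hq1, hqκ, hpow⟩ := exists_bias hκ
  have hk : (0 : ℝ) < κ := by exact_mod_cast hκ
  have hqi : 1 / q ≤ 2 * κ := by
    rw [div_le_iff₀ hq0]
    rw [div_le_iff₀ (by positivity)] at hqκ
    linarith
  obtain ⟨J, hJ, hJ2⟩ := exists_greedy_set hq0 hq1 hα hf hf1
  refine ⟨J, ?_, fun U hU => ?_⟩
  · have h2 : (J.card : ℝ) * α * q ≤ 2 := by linarith
    rw [← le_div_iff₀ hq0] at h2
    have : 2 / q = 2 * (1 / q) := by ring
    linarith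
  · -- the square is at most `α` times the positive part unless the derivative exceeds `α`, and then
    -- it does so below the restriction to `J` as well
    have hdec : ∀ i, ∀ x, max (der i f x) 0 ^ 2 ≤ α * max (der i f x) 0 +
        max (der i f x) 0 * (if α < der i f (J.piecewise x ⊥) then (1 : ℝ) else 0) := by
      intro i x
      have hd0 : 0 ≤ max (der i f x) 0 := le_max_right _ _
      have hd1 : max (der i f x) 0 ≤ 1 :=
        max_le ((le_abs_self _).trans (abs_der_le_one hf1 i x)) zero_le_one
      split_ifs with h
      · nlinarith
      · have h2 : der i f x ≤ α := (der_antitone hf i (piecewise_bot_le J x)).trans (not_lt.mp h)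
        have h3 : max (der i f x) 0 ≤ α := max_le h2 hα.le
        nlinarith
    -- the uniform law is the biased law with `q = 1 / 2`
    have hS1 : ∑ i, avg (fun x => max (der i f x) 0) ≤ 2 := by
      have := sum_bavg_pos_der_le (q := 1 / 2) (by norm_num) (by norm_num) hf hf1
      simp only [bavg_half] at this
      linarith
    have hS2 : ∀ i ∈ U, avg (fun x => max (der i f x) 0 *
        (if α < der i f (J.piecewise x ⊥) then (1 : ℝ) else 0)) ≤
          bavg q (fun x => max (der i f x) 0) * (1 / 2) ^ (κ - 1) := by
      intro i hi
      have hiJ : i ∉ J := disjoint_left.mp hU hi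
      -- the `κ`-fold union of `q`-biased sets is uniform by the choice of `q`
      have hb := bavg_boost hq0.le hq1 (G := fun x => max (der i f x) 0)
        (u := fun x => if α < der i f (J.piecewise x ⊥) then (1 : ℝ) else 0)
        (fun x y h => max_le_max (der_antitone hf i h) le_rfl) (fun x => le_max_right _ _)
        (fun x => by positivity) (fun x => by split_ifs <;> norm_num) (fun x y => by
          have hm : ∀ a b : Cube n, a ≤ b → J.piecewise a (⊥ : Cube n) ≤ J.piecewise b ⊥ := by
            intro a b hab j
            by_cases hI : j ∈ J
            · simpa [hI, Finset.piecewise] using hab j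
            · simp [hI, Finset.piecewise]
          have hx := der_antitone hf i (hm x (x ⊔ y) le_sup_left)
          have hy := der_antitone hf i (hm y (x ⊔ y) le_sup_right)
          split_ifs <;> linarith) (κ - 1)
      rw [Nat.sub_add_cancel hκ, hpow] at hb
      norm_num only at hb
      rw [bavg_half] at hb
      refine hb.trans ?_
      gcongr
      · exact bavg_nonneg hq0.le hq1 fun x => le_max_right _ _
      · exact bavg_nonneg hq0.le hq1 fun x => by positivity
      · exact hJ2 i hiJ
    calc ∑ i ∈ U, avg (fun x => max (der i f x) 0 ^ 2)
        ≤ ∑ i ∈ U, (α * avg (fun x => max (der i f x) 0) +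
            bavg q (fun x => max (der i f x) 0) * (1 / 2) ^ (κ - 1)) := by
          refine sum_le_sum fun i hi => ?_
          refine (avg_mono (hdec i)).trans ?_
          rw [avg_add, avg_const_mul]
          linarith [hS2 i hi]
      _ ≤ α * 2 + (1 / q) * (1 / 2) ^ (κ - 1) := by
          rw [sum_add_distrib, ← mul_sum, ← sum_mul]
          gcongr
          · exact (sum_le_univ_sum_of_nonneg fun i =>
              avg_nonneg fun x => le_max_right _ _).trans hS1
          · exact (sum_le_univ_sum_of_nonneg fun i => bavg_nonneg hq0.le hq1 fun x =>
              le_max_right _ _).trans (sum_bavg_pos_der_le hq0 hq1 hf hf1)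
      _ ≤ α * 2 + (2 * κ) * (1 / 2) ^ (κ - 1) := by gcongr
      _ = _ := by
          obtain ⟨m, rfl⟩ : ∃ m, κ = m + 1 := ⟨κ - 1, by omega⟩
          rw [Nat.add_sub_cancel, pow_succ, one_div_pow]
          field_simp
          ring

theorem isSubmodular_compl {f : Cube n → ℝ} (hf : IsSubmodular f) :
    IsSubmodular fun x => f xᶜ := by
  intro x y
  have := hf xᶜ yᶜ
  simp only [compl_sup, compl_inf]
  linarith

theorem der_compl (i : Fin n) (f : Cube n → ℝ) (x : Cube n) :
    der i (fun x => f xᶜ) x = -der i f xᶜ := by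
  have h : ∀ b, (Function.update x i b)ᶜ = Function.update xᶜ i (!b) := by
    intro b
    funext j
    by_cases hj : j = i
    · subst hj; simp
    · simp [hj]
  simp [der, h]

/-- A bounded submodular function is close in `ℓ₂` to its conditional average on few coordinates. -/
theorem exists_junta {κ : ℕ} (hκ : 0 < κ) {α : ℝ} (hα : 0 < α) {f : Cube n → ℝ}
    (hf : IsSubmodular f) (hf1 : ∀ x, f x ∈ Set.Icc (0 : ℝ) 1) :
    ∃ J : Finset (Fin n), (J.card : ℝ) * α ≤ 8 * κ ∧
      avg (fun x => (f x - condAvg J f x) ^ 2) ≤ α + 2 * κ / 2 ^ κ := by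
  classical
  obtain ⟨J₁, hc1, h1⟩ := exists_set_sum_sq_pos_der_le hκ hα hf hf1
  obtain ⟨J₂, hc2, h2⟩ := exists_set_sum_sq_pos_der_le hκ hα (isSubmodular_compl hf)
    fun x => hf1 xᶜ
  refine ⟨J₁ ∪ J₂, ?_, (avg_sq_sub_condAvg_le _ f).trans ?_⟩
  · have : ((J₁ ∪ J₂).card : ℝ) ≤ J₁.card + J₂.card := by exact_mod_cast card_union_le _ _
    nlinarith
  · have hd1 : Disjoint (J₁ ∪ J₂)ᶜ J₁ :=
      disjoint_left.mpr fun i hi h => by simp [h] at hi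
    have hd2 : Disjoint (J₁ ∪ J₂)ᶜ J₂ :=
      disjoint_left.mpr fun i hi h => by simp [h] at hi
    -- the derivatives of `x ↦ f xᶜ` are those of `f` with the opposite sign
    have hsum : ∀ i, avg (fun x => der i f x ^ 2) = avg (fun x => max (der i f x) 0 ^ 2) +
        avg (fun x => max (der i (fun x => f xᶜ) x) 0 ^ 2) := by
      intro i
      have he := avg_comp_equiv (⟨compl, compl, compl_compl, compl_compl⟩ : Cube n ≃ Cube n)
        fun x => max (-der i f x) 0 ^ 2
      simp only [Equiv.coe_fn_mk] at he
      simp only [der_compl]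
      rw [he, ← avg_add]
      congr 1
      funext x
      rcases le_total (der i f x) 0 with h | h
      · rw [max_eq_right h, max_eq_left (by linarith)]; ring
      · rw [max_eq_left h, max_eq_right (by linarith)]; ring
    rw [sum_congr rfl fun i _ => hsum i, sum_add_distrib]
    have e1 := h1 _ hd1
    have e2 := h2 _ hd2
    have e3 : 1 / 4 * ((2 * α + 4 * κ / 2 ^ κ) + (2 * α + 4 * κ / 2 ^ κ)) =
        α + 2 * κ / 2 ^ κ := by ring
    linarith

end CubeFn

namespace CubeFn

open Finset

variable {n : ℕ}

/-! ### Low-degree coefficients and the relevant coordinates -/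

/-- The `±1`-valued coordinate function with a natural-number index; the indices from `n` on stand
for the constant function `1`. -/
noncomputable def chi (x : Cube n) (j : ℕ) : ℝ := if h : j < n then sgn (x ⟨j, h⟩) else 1

/-- The Fourier coefficient of `f` at `{i, j}`; for `j = n` this is the coefficient at `{i}`. -/
noncomputable def coef (f : Cube n → ℝ) (i j : ℕ) : ℝ := avg fun x => f x * chi x i * chi x j

theorem sgn_mul_self (b : Bool) : sgn b * sgn b = 1 := by cases b <;> simp [sgn]

theorem abs_sgn (b : Bool) : |sgn b| = 1 := by cases b <;> simp [sgn]

theorem abs_chi (x : Cube n) (j : ℕ) : |chi x j| = 1 := by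
  unfold chi; split_ifs
  · exact abs_sgn _
  · simp

/-- A coordinate whose coefficients of degree one and two are small has a small influence on the
conditional average: the second derivatives have a constant sign, so that their `ℓ₁`-norms are
coefficients. -/
theorem avg_abs_der_condAvg_le {f : Cube n → ℝ} (hf : IsSubmodular f) {J : Finset (Fin n)}
    {i : Fin n} (hi : i ∈ J) {τ : ℝ} (hτ : ∀ j ≤ n, j ≠ (i : ℕ) → |coef f i j| ≤ τ) :
    avg (fun x => |der i (condAvg J f) x|) ≤ 2 * (J.card + 1) * τ := by
  set u := der i (condAvg J f) with hu
  have hτ0 : 0 ≤ τ := (abs_nonneg _).trans (hτ n le_rfl i.2.ne')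
  have hmean : |avg u| ≤ 2 * τ := by
    rw [hu, der_condAvg_of_mem hi, avg_condAvg, avg_der]
    have h := hτ n le_rfl i.2.ne'
    simp only [coef, chi, i.2, dite_true, lt_irrefl, dite_false, mul_one, Fin.eta] at h
    rw [abs_mul]
    norm_num
    exact h
  have hsecond : ∀ j, avg (fun x => |der j u x|) ≤ if j ∈ J then 4 * τ else 0 := by
    intro j
    split_ifs with hj
    · by_cases hji : j = i
      · subst hji
        have : ∀ x, der j u x = 0 := by
          intro x; rw [hu]; conv_lhs => rw [der]
          simp
        simp only [this, abs_zero, avg_const]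
        positivity
      · have h1 : ∀ x, |der j u x| = -der j u x := fun x =>
          abs_of_nonpos (der_der_nonpos (isSubmodular_condAvg hf J) i j x)
        simp only [h1]
        rw [avg_neg, hu, der_condAvg_of_mem hi, der_condAvg_of_mem hj, avg_condAvg,
          avg_der_der (Ne.symm hji)]
        have h := hτ j j.2.le (fun h => hji (Fin.ext h))
        simp only [coef, chi, i.2, j.2, dite_true, Fin.eta] at h
        have := (abs_le.mp h).1
        linarith
    · have : ∀ x, der j u x = 0 := by
        intro x
        rw [hu, der_condAvg_of_mem hi]
        exact der_condAvg_of_notMem hj _ x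
      simp [this, avg_const]
  -- the Poincaré inequality for the derivative `u`
  have hpoinc := avg_abs_sub_condAvg_le ∅ u
  simp only [condAvg_empty, compl_empty] at hpoinc
  have hsum : ∑ j, avg (fun x => |der j u x|) ≤ J.card * (4 * τ) := by
    refine (sum_le_sum fun j _ => hsecond j).trans ?_
    rw [← sum_filter]
    simp
  have htri : avg (fun x => |u x|) ≤ avg (fun x => |u x - avg u|) + |avg u| := by
    rw [← avg_const (n := n) |avg u|, ← avg_add]
    refine avg_mono fun x => ?_
    have := abs_add_le (u x - avg u) (avg u)
    rw [sub_add_cancel] at this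
    simpa [avg_const] using this
  nlinarith

/-- Coordinates with small coefficients can be dropped from a junta. -/
theorem exists_junta_inter {f : Cube n → ℝ} (hf : IsSubmodular f) (J T : Finset (Fin n)) {τ : ℝ}
    (hτ : ∀ i ∉ T, ∀ j ≤ n, j ≠ (i : ℕ) → |coef f i j| ≤ τ) (hτ0 : 0 ≤ τ) :
    ∃ r : Cube n → ℝ, DependsOn r ((J ∩ T : Finset (Fin n)) : Set (Fin n)) ∧
      avg (fun x => |f x - r x|) ≤
        avg (fun x => |f x - condAvg J f x|) + J.card * (J.card + 1) * τ := by
  set g := condAvg J f with hg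
  refine ⟨condAvg (J ∩ T) g, dependsOn_condAvg _ _, ?_⟩
  have h1 := avg_abs_sub_condAvg_le (J ∩ T) g
  have h2 : ∑ i ∈ (J ∩ T)ᶜ, avg (fun x => |der i g x|) ≤ J.card * (2 * (J.card + 1) * τ) := by
    calc ∑ i ∈ (J ∩ T)ᶜ, avg (fun x => |der i g x|)
        ≤ ∑ i ∈ (J ∩ T)ᶜ, if i ∈ J then 2 * (J.card + 1) * τ else 0 := by
          refine sum_le_sum fun i hi => ?_
          split_ifs with hJ
          · have hT : i ∉ T := fun h => by simp [hJ, h] at hi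
            exact avg_abs_der_condAvg_le hf hJ (hτ i hT)
          · simp [hg, der_condAvg_of_notMem hJ, avg_const]
      _ ≤ ∑ i, if i ∈ J then 2 * (J.card + 1) * τ else 0 :=
          sum_le_univ_sum_of_nonneg fun i => by positivity
      _ = _ := by rw [← sum_filter]; simp
  have h3 : avg (fun x => |f x - condAvg (J ∩ T) g x|) ≤
      avg (fun x => |f x - g x|) + avg (fun x => |g x - condAvg (J ∩ T) g x|) := by
    rw [← avg_add]
    exact avg_mono fun x => abs_sub_le _ _ _
  nlinarith

/-- Up to a factor two, the conditional average is the best junta approximation in `ℓ₁`. -/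
theorem avg_abs_sub_condAvg_le_two_mul {f r : Cube n → ℝ} {S J : Finset (Fin n)} (hSJ : S ⊆ J)
    (hr : DependsOn r (S : Set (Fin n))) :
    avg (fun x => |f x - condAvg J f x|) ≤ 2 * avg (fun x => |f x - r x|) := by
  have hr' : condAvg J r = r := condAvg_of_dependsOn fun x y h => hr fun i hi => h i (hSJ hi)
  have h1 : avg (fun x => |r x - condAvg J f x|) ≤ avg (fun x => |r x - f x|) := by
    refine le_trans (le_of_eq ?_) (avg_abs_condAvg_le J fun x => r x - f x)
    congr 1; funext x
    rw [condAvg_sub, hr']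
  have h2 : avg (fun x => |f x - condAvg J f x|) ≤
      avg (fun x => |f x - r x|) + avg (fun x => |r x - condAvg J f x|) := by
    rw [← avg_add]
    exact avg_mono fun x => abs_sub_le _ _ _
  simp only [abs_sub_comm (r _) (f _)] at h1
  linarith

/-- The character of the cube at `S`. -/
noncomputable def charFn (S : Finset (Fin n)) (x : Cube n) : ℝ := ∏ i ∈ S, sgn (x i)

theorem charFn_mul_self (S : Finset (Fin n)) (x : Cube n) : charFn S x * charFn S x = 1 := by
  simp [charFn, ← prod_mul_distrib, sgn_mul_self]

theorem charFn_update_of_mem {S : Finset (Fin n)} {i : Fin n} (hi : i ∈ S) (x : Cube n) (b : Bool) :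
    charFn S (Function.update x i b) = sgn b * charFn (S.erase i) x := by
  unfold charFn
  rw [← mul_prod_erase S _ hi]
  simp only [Function.update_self]
  congr 1
  exact prod_congr rfl fun j hj => by rw [Function.update_of_ne (ne_of_mem_erase hj)]

theorem charFn_update_of_notMem {S : Finset (Fin n)} {i : Fin n} (hi : i ∉ S) (x : Cube n)
    (b : Bool) : charFn S (Function.update x i b) = charFn S x := by
  unfold charFn
  refine prod_congr rfl fun j hj => ?_
  rw [Function.update_of_ne]
  rintro rfl
  exact hi hj

theorem avg_charFn_mul_charFn_of_mem {S S' : Finset (Fin n)} {i : Fin n} (hi : i ∈ S)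
    (hi' : i ∉ S') : avg (fun x => charFn S x * charFn S' x) = 0 := by
  rw [← avg_smooth i, ← avg_const (n := n) 0]
  congr 1
  funext x
  simp [smooth, charFn_update_of_mem hi, charFn_update_of_notMem hi', sgn]

theorem avg_charFn_mul_charFn (S S' : Finset (Fin n)) :
    avg (fun x => charFn S x * charFn S' x) = if S = S' then 1 else 0 := by
  split_ifs with h
  · subst h
    simp [charFn_mul_self, avg_const]
  · by_cases hsub : S ⊆ S'
    · have : ¬ S' ⊆ S := fun h' => h (hsub.antisymm h')
      obtain ⟨i, hi, hi'⟩ := not_subset.mp this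
      simp only [mul_comm (charFn S _)]
      exact avg_charFn_mul_charFn_of_mem hi hi'
    · obtain ⟨i, hi, hi'⟩ := not_subset.mp hsub
      exact avg_charFn_mul_charFn_of_mem hi hi'

/-- Bessel's inequality for the characters of the cube. -/
theorem sum_sq_avg_mul_charFn_le (A : Finset (Finset (Fin n))) (f : Cube n → ℝ) :
    ∑ S ∈ A, avg (fun x => f x * charFn S x) ^ 2 ≤ avg fun x => f x ^ 2 := by
  set c := fun S => avg fun x => f x * charFn S x with hc
  have h0 : 0 ≤ avg fun x => (f x - ∑ S ∈ A, c S * charFn S x) ^ 2 :=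
    avg_nonneg fun x => sq_nonneg _
  have hexp : ∀ x, (f x - ∑ S ∈ A, c S * charFn S x) ^ 2 =
      (f x ^ 2 - 2 * ∑ S ∈ A, c S * (f x * charFn S x)) +
        ∑ S ∈ A, ∑ S' ∈ A, (c S * c S') * (charFn S x * charFn S' x) := by
    intro x
    have h1 : ∑ S ∈ A, ∑ S' ∈ A, (c S * c S') * (charFn S x * charFn S' x) =
        (∑ S ∈ A, c S * charFn S x) * ∑ S ∈ A, c S * charFn S x := by
      rw [sum_mul_sum]
      exact sum_congr rfl fun S _ => sum_congr rfl fun S' _ => by ring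
    have h2 : ∑ S ∈ A, c S * (f x * charFn S x) = f x * ∑ S ∈ A, c S * charFn S x := by
      rw [mul_sum]
      exact sum_congr rfl fun S _ => by ring
    rw [h1, h2]; ring
  simp only [hexp] at h0
  rw [avg_add, avg_sub, avg_const_mul, avg_sum, avg_sum] at h0
  simp only [avg_const_mul, avg_sum, avg_charFn_mul_charFn] at h0
  simp only [mul_ite, mul_one, mul_zero, sum_ite_eq] at h0
  have h3 : ∑ S ∈ A, (if S ∈ A then c S * c S else 0) = ∑ S ∈ A, c S ^ 2 :=
    sum_congr rfl fun S hS => by rw [if_pos hS, sq]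
  have h4 : ∑ S ∈ A, c S * avg (fun x => f x * charFn S x) = ∑ S ∈ A, c S ^ 2 :=
    sum_congr rfl fun S hS => by rw [sq]
  rw [h3, h4] at h0
  linarith

/-- Few coordinates have a large coefficient of degree one or two. -/
theorem card_mul_sq_le_two {f : Cube n → ℝ} (hf : ∀ x, f x ∈ Set.Icc (0 : ℝ) 1) {θ : ℝ}
    (hθ : 0 ≤ θ) (A : Finset (Fin n)) (hA : ∀ i ∈ A, ∃ j ≤ n, j ≠ (i : ℕ) ∧ θ ≤ |coef f i j|) :
    (A.card : ℝ) * θ ^ 2 ≤ 2 := by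
  classical
  -- each `i` lies in a set of size at most two with a large coefficient, and so each set serves at
  -- most two coordinates
  have hS : ∀ i ∈ A, ∃ S : Finset (Fin n), i ∈ S ∧ S.card ≤ 2 ∧
      θ ≤ |avg fun x => f x * charFn S x| := by
    intro i hi
    obtain ⟨j, hjn, hji, hj⟩ := hA i hi
    rcases hjn.lt_or_eq with hlt | rfl
    · refine ⟨{i, ⟨j, hlt⟩}, by simp, card_le_two, hj.trans (le_of_eq ?_)⟩
      have hne : i ≠ ⟨j, hlt⟩ := fun h => hji (by rw [h])
      simp [coef, chi, hlt, charFn, prod_pair hne, mul_assoc]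
    · refine ⟨{i}, by simp, by simp, hj.trans (le_of_eq ?_)⟩
      simp [coef, chi, charFn]
  choose! S hS1 hS2 hS3 using hS
  have hfib : A.card ≤ 2 * (A.image S).card := by
    refine card_le_mul_card_image A 2 fun B hB => ?_
    obtain ⟨i, hi, rfl⟩ := mem_image.mp hB
    refine (card_le_card fun i' hi' => ?_).trans (hS2 i hi)
    simp only [mem_filter] at hi'
    rw [← hi'.2]
    exact hS1 i' hi'.1
  have hb := sum_sq_avg_mul_charFn_le (A.image S) f
  have h1 : ((A.image S).card : ℝ) * θ ^ 2 ≤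
      ∑ B ∈ A.image S, avg (fun x => f x * charFn B x) ^ 2 := by
    rw [← nsmul_eq_mul]
    refine card_nsmul_le_sum _ _ _ fun B hB => ?_
    obtain ⟨i, hi, rfl⟩ := mem_image.mp hB
    rw [← sq_abs (avg _)]
    exact pow_le_pow_left₀ hθ (hS3 i hi) 2
  have h2 : avg (fun x => f x ^ 2) ≤ 1 := by
    rw [← avg_const (n := n) 1]
    refine avg_mono fun x => ?_
    have := hf x
    simp only [Set.mem_Icc] at this
    nlinarith
  have h3 : (A.card : ℝ) ≤ 2 * (A.image S).card := by exact_mod_cast hfib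
  nlinarith [sq_nonneg θ]

/-! ### The approximation that the algorithm looks for -/

/-- The bound on the size of the junta, in terms of a power `K = 2 ^ l` that exceeds `1 / ε`. -/
def juntaSize (K l : ℕ) : ℕ := 10240 * (K * K) * l

/-- The inverse of the threshold for the coefficients of degree one and two. -/
def invThr (K l : ℕ) : ℕ := 16 * K * (juntaSize K l * juntaSize K l)

/-- If the coordinates outside of `T` have small coefficients, then some candidate, a subset of `T`
of the prescribed size, has a conditional average close to `f`. -/
theorem exists_subset_approx {f : Cube n → ℝ} (hf : IsSubmodular f)
    (hf1 : ∀ x, f x ∈ Set.Icc (0 : ℝ) 1) {K l : ℕ} (hl : 2 ≤ l) (hK : K = 2 ^ l)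
    (T : Finset (Fin n))
    (hT : ∀ i ∉ T, ∀ j ≤ n, j ≠ (i : ℕ) → |coef f i j| ≤ 1 / invThr K l) :
    ∃ J ⊆ T, J.card = min (juntaSize K l) T.card ∧
      avg (fun x => |f x - condAvg J f x|) ≤ 1 / (2 * K) := by
  have hK4 : (4 : ℝ) ≤ K := by
    rw [hK]
    push_cast
    calc (4 : ℝ) = 2 ^ 2 := by norm_num
      _ ≤ 2 ^ l := pow_le_pow_right₀ (by norm_num) hl
  have hK0 : (0 : ℝ) < K := by linarith
  have hl0 : (0 : ℝ) < l := by exact_mod_cast (by omega : 0 < l)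
  -- the squared `ℓ₂`-error `1 / (64 K²)` is split evenly between the two terms of the bound; for
  -- the second one note that `2 ^ κ = K ^ 10`
  obtain ⟨J, hJ, hJ2⟩ := exists_junta (κ := 10 * l) (by omega) (α := 1 / (128 * K ^ 2))
    (by positivity) hf hf1
  have hcard : (J.card : ℝ) ≤ juntaSize K l := by
    rw [mul_one_div, div_le_iff₀ (by positivity)] at hJ
    unfold juntaSize
    push_cast at hJ ⊢
    linarith
  have hpow : (2 : ℝ) ^ (10 * l) = K ^ 10 := by
    rw [hK]; push_cast; rw [← pow_mul, mul_comm]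
  have hlK : (l : ℝ) ≤ K := by
    rw [hK]; exact_mod_cast (Nat.lt_two_pow_self (n := l)).le
  have hsq : avg (fun x => (f x - condAvg J f x) ^ 2) ≤ (1 / (8 * K)) ^ 2 := by
    refine hJ2.trans ?_
    rw [hpow]
    push_cast
    have h1 : 2 * (10 * (l : ℝ)) / K ^ 10 ≤ 1 / (128 * K ^ 2) := by
      rw [div_le_div_iff₀ (by positivity) (by positivity)]
      have h7 : (4 : ℝ) ^ 7 ≤ K ^ 7 := pow_le_pow_left₀ (by norm_num) hK4 7
      have h3 : (0 : ℝ) < K ^ 3 := by positivity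
      calc 2 * (10 * (l : ℝ)) * (128 * K ^ 2) ≤ 2 * (10 * (K : ℝ)) * (128 * K ^ 2) := by gcongr
        _ = 2560 * (K : ℝ) ^ 3 := by ring
        _ ≤ 1 * (K : ℝ) ^ 10 := by nlinarith
    have h2 : (1 / (8 * (K : ℝ))) ^ 2 = 1 / (128 * K ^ 2) + 1 / (128 * K ^ 2) := by
      field_simp; norm_num
    linarith
  have hL1 : avg (fun x => |f x - condAvg J f x|) ≤ 1 / (8 * K) :=
    abs_le_of_sq_le_sq' ((sq_avg_abs_le _).trans hsq) (by positivity) |>.2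
  have hk1 : (1 : ℝ) ≤ juntaSize K l := by
    unfold juntaSize; push_cast
    have : (2 : ℝ) ≤ l := by exact_mod_cast hl
    nlinarith [mul_pos hK0 hK0]
  obtain ⟨r, hr, hr2⟩ := exists_junta_inter hf J T hT (by positivity)
  have hr3 : avg (fun x => |f x - r x|) ≤ 1 / (4 * K) := by
    have h1 : (J.card : ℝ) * (J.card + 1) * (1 / invThr K l) ≤ 1 / (8 * K) := by
      rw [mul_one_div]
      unfold invThr
      push_cast
      set k : ℝ := (juntaSize K l : ℝ)
      rw [div_le_div_iff₀ (by positivity) (by positivity)]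
      have : (J.card : ℝ) * (J.card + 1) ≤ k * (2 * k) := by
        gcongr
        linarith
      nlinarith
    have h2 : (1 : ℝ) / (4 * K) = 1 / (8 * K) + 1 / (8 * K) := by field_simp; norm_num
    linarith
  -- enlarge `J ∩ T` within `T` to the prescribed size; the error at most doubles
  have hc : (J ∩ T).card ≤ min (juntaSize K l) T.card :=
    le_min ((card_le_card inter_subset_left).trans (by exact_mod_cast hcard))
      (card_le_card inter_subset_right)
  obtain ⟨J', h1, h2, h3⟩ := exists_subsuperset_card_eq inter_subset_right hc (min_le_right _ _)
  refine ⟨J', h2, h3, (avg_abs_sub_condAvg_le_two_mul h1 hr).trans ?_⟩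
  have h4 : (1 : ℝ) / (2 * K) = 2 * (1 / (4 * K)) := by field_simp; norm_num
  linarith

end CubeFn

namespace CubeFn

open Finset ProbabilityTheory

variable {n : ℕ}

/-! ### Concentration of empirical averages -/

instance : IsProbabilityMeasure (exampleLaw n) := by
  unfold exampleLaw; infer_instance

theorem integral_uniform (φ : Cube n → ℝ) :
    ∫ x, φ x ∂(PMF.uniformOfFintype (Cube n)).toMeasure = avg φ := by
  rw [PMF.integral_eq_sum]
  simp [avg, ← mul_sum, div_eq_inv_mul]

theorem integral_eval (φ : Cube n → ℝ) (t : ℕ) : ∫ ω, φ (ω t) ∂exampleLaw n = avg φ := by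
  rw [← integral_uniform φ]
  have h := Measure.infinitePi_map_eval
    (fun _ : ℕ => (PMF.uniformOfFintype (Cube n)).toMeasure) t
  rw [← h, integral_map (measurable_pi_apply t).aemeasurable]
  · rfl
  · exact (measurable_of_countable φ).aestronglyMeasurable

/-- Hoeffding's inequality for the examples `a, …, a + m - 1`. -/
theorem measure_abs_sum_sub_ge_le {φ : Cube n → ℝ} (hφ : ∀ x, |φ x| ≤ 1) (a : ℕ) {m : ℕ}
    (hm : 0 < m) {s : ℝ} (hs : 0 ≤ s) :
    (exampleLaw n).real {ω | m * s ≤ |∑ t ∈ range m, φ (ω (a + t)) - m * avg φ|} ≤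
      2 * Real.exp (-(m * s ^ 2 / 2)) := by
  have hm' : (0 : ℝ) < m := by exact_mod_cast hm
  have key : ∀ ψ : Cube n → ℝ, (∀ x, |ψ x| ≤ 1) →
      (exampleLaw n).real {ω | m * s ≤ ∑ t ∈ range m, (ψ (ω (a + t)) - avg ψ)} ≤
        Real.exp (-(m * s ^ 2 / 2)) := by
    intro ψ hψ
    have hind : iIndepFun (fun (t : ℕ) (ω : ℕ → Cube n) => ψ (ω (a + t)) - avg ψ)
        (exampleLaw n) := by
      have h := iIndepFun_infinitePi (P := fun _ : ℕ => (PMF.uniformOfFintype (Cube n)).toMeasure)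
        (X := fun _ x => ψ x - avg ψ) fun _ => measurable_of_countable _
      exact h.precomp (g := fun t => a + t) (fun _ _ h => Nat.add_left_cancel h)
    have hsub : ∀ t < m, HasSubgaussianMGF
        (fun ω : ℕ → Cube n => ψ (ω (a + t)) - avg ψ) 1 (exampleLaw n) := by
      intro t _
      have h := hasSubgaussianMGF_of_mem_Icc (μ := exampleLaw n) (a := -1) (b := 1)
        (X := fun ω : ℕ → Cube n => ψ (ω (a + t)))
        ((measurable_of_countable ψ).comp
          (measurable_pi_apply (X := fun _ : ℕ => Cube n) (a + t))).aemeasurable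
        (Filter.Eventually.of_forall fun ω => abs_le.mp (hψ _))
      rw [integral_eval] at h
      convert h using 1
      ext
      norm_num
    refine (HasSubgaussianMGF.measure_sum_range_ge_le_of_iIndepFun hind hsub
      (by positivity)).trans (le_of_eq ?_)
    congr 1
    simp only [NNReal.coe_one]
    field_simp
  have hsplit : {ω : ℕ → Cube n | m * s ≤ |∑ t ∈ range m, φ (ω (a + t)) - m * avg φ|} ⊆
      {ω | m * s ≤ ∑ t ∈ range m, (φ (ω (a + t)) - avg φ)} ∪
      {ω | m * s ≤ ∑ t ∈ range m, (-φ (ω (a + t)) - avg fun x => -φ x)} := by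
    intro ω hω
    simp only [Set.mem_ofPred_eq, Set.mem_union] at hω ⊢
    have h2 : ∑ t ∈ range m, (φ (ω (a + t)) - avg φ) =
        ∑ t ∈ range m, φ (ω (a + t)) - m * avg φ := by simp
    have h3 : ∑ t ∈ range m, (-φ (ω (a + t)) - avg fun x => -φ x) =
        -(∑ t ∈ range m, φ (ω (a + t)) - m * avg φ) := by
      simp [avg_neg, sum_add_distrib]; ring
    rw [h2, h3]
    exact le_abs.mp hω
  refine (measureReal_mono hsplit (measure_ne_top _ _)).trans ((measureReal_union_le _ _).trans ?_)
  have h1 := key φ hφ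
  have h2 := key (fun x => -φ x) (fun x => by rw [abs_neg]; exact hφ x)
  linarith

/-- Events about disjoint blocks of examples are independent. -/
theorem measureReal_inter_eq_mul {A B : Set (ℕ → Cube n)} {m L : ℕ}
    (hA : ∀ ω ω' : ℕ → Cube n, (∀ t < m, ω t = ω' t) → ω ∈ A → ω' ∈ A)
    (hB : ∀ ω ω' : ℕ → Cube n, (∀ t, m ≤ t → t < L → ω t = ω' t) → ω ∈ B → ω' ∈ B) :
    (exampleLaw n).real (A ∩ B) = (exampleLaw n).real A * (exampleLaw n).real B := by
  have hind : iIndepFun (fun (t : ℕ) (ω : ℕ → Cube n) => ω t) (exampleLaw n) :=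
    iIndepFun_infinitePi (P := fun _ : ℕ => (PMF.uniformOfFintype (Cube n)).toMeasure)
      (X := fun _ x => x) fun _ => measurable_id
  have hdis : Disjoint (range m) (Ico m L) := by
    rw [disjoint_left]; intro t h1 h2
    simp only [mem_range, mem_Ico] at h1 h2; omega
  have h := hind.indepFun_finset (range m) (Ico m L) hdis fun t => measurable_pi_apply t
  set πA := fun (ω : ℕ → Cube n) (i : range m) => ω i with hπA
  set πB := fun (ω : ℕ → Cube n) (i : Ico m L) => ω i with hπB
  have eA : A = πA ⁻¹' (πA '' A) := by
    refine Set.Subset.antisymm (Set.subset_preimage_image _ _) ?_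
    rintro ω ⟨ω', hω', he⟩
    refine hA ω' ω (fun t ht => ?_) hω'
    exact congrFun he ⟨t, mem_range.mpr ht⟩
  have eB : B = πB ⁻¹' (πB '' B) := by
    refine Set.Subset.antisymm (Set.subset_preimage_image _ _) ?_
    rintro ω ⟨ω', hω', he⟩
    refine hB ω' ω (fun t ht ht' => ?_) hω'
    exact congrFun he ⟨t, mem_Ico.mpr ⟨ht, ht'⟩⟩
  -- the events depend on finitely many values of a finite type, so they are measurable
  rw [eA, eB]
  have := h.measure_inter_preimage_eq_mul (πA '' A) (πB '' B) (Set.toFinite _).measurableSet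
    (Set.toFinite _).measurableSet
  simp only [measureReal_def]
  rw [this, ENNReal.toReal_mul]

theorem measureReal_biUnion_le {ι : Type*} (s : Finset ι) (E : ι → Set (ℕ → Cube n)) {β : ℝ}
    (h : ∀ i ∈ s, (exampleLaw n).real (E i) ≤ β) :
    (exampleLaw n).real (⋃ i ∈ s, E i) ≤ s.card * β := by
  refine (measureReal_biUnion_finset_le s E).trans ?_
  rw [← nsmul_eq_mul]
  exact sum_le_card_nsmul _ _ _ h

/-- If a random index `T` is determined by the first `m` examples, and for each fixed index the bad
event about the next examples has probability at most `β`, then so has the bad event at `T`. -/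
theorem measureReal_random_index_le {ι : Type*} [Fintype ι] {m L : ℕ} (T : (ℕ → Cube n) → ι)
    (hT : ∀ ω ω' : ℕ → Cube n, (∀ t < m, ω t = ω' t) → T ω = T ω') (B : ι → Set (ℕ → Cube n))
    (hB : ∀ i, ∀ ω ω' : ℕ → Cube n, (∀ t, m ≤ t → t < L → ω t = ω' t) → ω ∈ B i → ω' ∈ B i)
    {β : ℝ} (hβ : ∀ ω, (exampleLaw n).real (B (T ω)) ≤ β) :
    (exampleLaw n).real {ω | ω ∈ B (T ω)} ≤ β := by
  classical
  have hmeas : ∀ i, MeasurableSet {ω | T ω = i} := by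
    intro i
    have : {ω | T ω = i} = (fun (ω : ℕ → Cube n) (j : range m) => ω j) ⁻¹'
        ((fun (ω : ℕ → Cube n) (j : range m) => ω j) '' {ω | T ω = i}) := by
      refine Set.Subset.antisymm (Set.subset_preimage_image _ _) ?_
      rintro ω ⟨ω', hω', he⟩
      rw [Set.mem_ofPred_eq, ← hω']
      exact hT ω ω' fun t ht => (congrFun he ⟨t, mem_range.mpr ht⟩).symm
    rw [this]
    exact (measurable_pi_lambda _ fun j => measurable_pi_apply _) (Set.toFinite _).measurableSet
  have hcov : {ω | ω ∈ B (T ω)} = ⋃ i ∈ (univ : Finset ι), {ω | T ω = i} ∩ B i := by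
    ext ω; simp
  have hone : ∑ i, (exampleLaw n).real {ω | T ω = i} = 1 := by
    rw [← measureReal_biUnion_finset (fun i _ j _ hij => Set.disjoint_left.mpr fun ω h1 h2 =>
      hij (h1.symm.trans h2)) fun i _ => hmeas i]
    have : (⋃ i ∈ (univ : Finset ι), {ω : ℕ → Cube n | T ω = i}) = Set.univ := by
      ext ω; simp
    rw [this]; simp
  rw [hcov]
  refine (measureReal_biUnion_finset_le _ _).trans ?_
  calc ∑ i, (exampleLaw n).real ({ω | T ω = i} ∩ B i)
      ≤ ∑ i, (exampleLaw n).real {ω | T ω = i} * β := by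
        refine sum_le_sum fun i _ => ?_
        rw [measureReal_inter_eq_mul (m := m) (L := L) (fun ω ω' h h' => by
          rw [Set.mem_ofPred_eq, ← hT ω ω' h]; exact h') (hB i)]
        by_cases hne : ∃ ω, T ω = i
        · obtain ⟨ω, rfl⟩ := hne
          exact mul_le_mul_of_nonneg_left (hβ ω) measureReal_nonneg
        · push Not at hne
          have : {ω : ℕ → Cube n | T ω = i} = ∅ := by
            ext ω; simpa using hne ω
          simp [this]
    _ = β := by rw [← sum_mul, hone, one_mul]

/-! ### The good samples -/

/-- The indicator of the points that agree with `A` on the coordinates in `J`. -/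
noncomputable def agree (J A : Finset (Fin n)) (x : Cube n) : ℝ :=
  if ∀ i ∈ J, (x i = true ↔ i ∈ A) then 1 else 0

/-- The first `m` examples estimate all coefficients of degree one and two within `1 / (4 Q)`. -/
def GoodCoef (f : Cube n → ℝ) (m Q : ℕ) (ω : ℕ → Cube n) : Prop :=
  ∀ i < n, ∀ j < n + 1,
    |∑ t ∈ range m, f (ω t) * chi (ω t) i * chi (ω t) j - m * coef f i j| < m * (1 / (4 * Q))

/-- The examples `m, …, m + M - 1` estimate the conditional average of `f` on `J` within `1 / N`,
and the next `M` examples estimate its `ℓ₁`-error within `1 / N`. -/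
def GoodCond (f : Cube n → ℝ) (m M N : ℕ) (J : Finset (Fin n)) (ω : ℕ → Cube n) : Prop :=
  (∀ A ⊆ J, |∑ t ∈ range M, f (ω (m + t)) * agree J A (ω (m + t)) -
      M * avg (fun x => f x * agree J A x)| < M * (1 / (N * 2 ^ J.card))) ∧
  |∑ t ∈ range M, |f (ω (m + M + t)) - condAvg J f (ω (m + M + t))| -
      M * avg (fun x => |f x - condAvg J f x|)| < M * (1 / N)

theorem abs_mul_chi_le {f : Cube n → ℝ} (hf : ∀ x, f x ∈ Set.Icc (0 : ℝ) 1) (i j : ℕ)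
    (x : Cube n) : |f x * chi x i * chi x j| ≤ 1 := by
  rw [abs_mul, abs_mul, abs_chi, abs_chi, mul_one, mul_one, abs_of_nonneg (hf x).1]
  exact (hf x).2

/-- The union bound runs over the `n (n + 1) ≤ 2 · 4 ^ Λ` coefficients. -/
theorem measureReal_not_goodCoef_le {f : Cube n → ℝ} (hf : ∀ x, f x ∈ Set.Icc (0 : ℝ) 1)
    {Q Λ m : ℕ} (hQ : 0 < Q) (hn : n ≤ 2 ^ Λ) (hm : m = 160 * (Q * Q) * (Λ + 1)) :
    (exampleLaw n).real {ω | ¬ GoodCoef f m Q ω} ≤ 1 / 6 := by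
  have hm0 : 0 < m := by rw [hm]; positivity
  have hQ' : (0 : ℝ) < Q := by exact_mod_cast hQ
  have hsub : {ω | ¬ GoodCoef f m Q ω} ⊆ ⋃ p ∈ range n ×ˢ range (n + 1),
      {ω | m * (1 / (4 * Q) : ℝ) ≤ |∑ t ∈ range m, f (ω (0 + t)) * chi (ω (0 + t)) p.1 *
        chi (ω (0 + t)) p.2 - m * avg fun x => f x * chi x p.1 * chi x p.2|} := by
    intro ω hω
    simp only [GoodCoef, Set.mem_ofPred_eq] at hω
    push Not at hω
    obtain ⟨i, hi, j, hj, h⟩ := hω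
    simp only [Set.mem_iUnion]
    refine ⟨(i, j), by simp [hi, hj], ?_⟩
    simpa [coef] using h
  refine (measureReal_mono hsub (measure_ne_top _ _)).trans ?_
  refine (measureReal_biUnion_le _ _ fun p _ =>
    measure_abs_sum_sub_ge_le (abs_mul_chi_le hf p.1 p.2) 0 hm0 (by positivity)).trans ?_
  have hexp : (m : ℝ) * (1 / (4 * Q)) ^ 2 / 2 = 5 * (Λ + 1) := by
    rw [hm]; push_cast; field_simp; norm_num
  rw [hexp, card_product, card_range, card_range]
  have h1 : Real.exp (-(5 * (Λ + 1))) ≤ (1 / 32) ^ (Λ + 1) := by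
    have h2 : Real.exp (-(5 * ((Λ : ℝ) + 1))) = Real.exp (-5) ^ (Λ + 1) := by
      rw [← Real.exp_nat_mul]; push_cast; congr 1; ring
    rw [h2]
    refine pow_le_pow_left₀ (Real.exp_nonneg _) ?_ _
    have h3 : Real.exp (-5) = Real.exp (-1) ^ 5 := by
      rw [← Real.exp_nat_mul]; norm_num
    rw [h3]
    calc Real.exp (-1) ^ 5 ≤ (1 / 2) ^ 5 := by
          refine pow_le_pow_left₀ (Real.exp_nonneg _) ?_ _
          have := Real.exp_neg_one_lt_d9
          linarith
      _ = 1 / 32 := by norm_num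
  have h4 : ((n * (n + 1) : ℕ) : ℝ) ≤ 2 * 4 ^ Λ := by
    have h5 : n * (n + 1) ≤ 2 * 4 ^ Λ := by
      have : (4 : ℕ) ^ Λ = 2 ^ Λ * 2 ^ Λ := by rw [← mul_pow]; norm_num
      rw [this]
      have := Nat.one_le_two_pow (n := Λ)
      nlinarith
    exact_mod_cast h5
  calc ((n * (n + 1) : ℕ) : ℝ) * (2 * Real.exp (-(5 * (Λ + 1))))
      ≤ (2 * 4 ^ Λ) * (2 * (1 / 32) ^ (Λ + 1)) := by gcongr
    _ = (1 / 8) * (4 * (1 / 32)) ^ Λ := by rw [mul_pow, pow_succ]; ring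
    _ ≤ (1 / 8) * 1 := by
        gcongr
        exact pow_le_one₀ (by norm_num) (by norm_num)
    _ ≤ 1 / 6 := by norm_num

/-- The union bound runs over the `2 ^ J.card` cells of the table and the error; each estimate fails
with probability at most `2 exp (-X)`. -/
theorem measureReal_not_goodCond_le {f : Cube n → ℝ} (hf : ∀ x, f x ∈ Set.Icc (0 : ℝ) 1)
    {m M N k X : ℕ} (hN : 0 < N) (hX : 0 < X) (hM : M = 2 * 4 ^ k * (N * N) * X)
    {J : Finset (Fin n)} (hJ : J.card ≤ k) :
    (exampleLaw n).real {ω | ¬ GoodCond f m M N J ω} ≤ (2 ^ k + 1) * (2 * Real.exp (-X)) := by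
  classical
  have hM0 : 0 < M := by rw [hM]; positivity
  have hN' : (0 : ℝ) < N := by exact_mod_cast hN
  have hsub : {ω | ¬ GoodCond f m M N J ω} ⊆ (⋃ A ∈ J.powerset,
      {ω | M * (1 / (N * 2 ^ J.card) : ℝ) ≤ |∑ t ∈ range M, f (ω (m + t)) *
        agree J A (ω (m + t)) - M * avg (fun x => f x * agree J A x)|}) ∪
      {ω | M * (1 / N : ℝ) ≤ |∑ t ∈ range M, |f (ω (m + M + t)) - condAvg J f (ω (m + M + t))| -
        M * avg (fun x => |f x - condAvg J f x|)|} := by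
    intro ω hω
    simp only [Set.mem_union, Set.mem_iUnion, mem_powerset, exists_prop, Set.mem_ofPred_eq]
    by_contra hc
    push Not at hc
    exact hω ⟨hc.1, hc.2⟩
  have hexp : ∀ s : ℝ, 1 / (N * 2 ^ k) ≤ s → (X : ℝ) ≤ M * s ^ 2 / 2 := by
    intro s hs
    calc (X : ℝ) = M * (1 / (N * 2 ^ k)) ^ 2 / 2 := by
          have h4 : (4 : ℝ) ^ k = 2 ^ k * 2 ^ k := by rw [← mul_pow]; norm_num
          rw [hM]; push_cast; rw [h4]; field_simp
      _ ≤ M * s ^ 2 / 2 := by gcongr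
  have hb1 := measureReal_biUnion_le (n := n) J.powerset (fun A =>
      {ω | M * (1 / (N * 2 ^ J.card) : ℝ) ≤ |∑ t ∈ range M, f (ω (m + t)) *
        agree J A (ω (m + t)) - M * avg (fun x => f x * agree J A x)|})
      (β := 2 * Real.exp (-X)) fun A _ => by
    refine (measure_abs_sum_sub_ge_le (φ := fun x => f x * agree J A x) (fun x => ?_) m hM0
      (by positivity)).trans ?_
    · have h0 := (hf x).1
      have h1 := (hf x).2
      unfold agree
      split_ifs
      · rw [mul_one, abs_of_nonneg h0]; exact h1
      · simp
    · gcongr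
      refine hexp _ ?_
      gcongr
      norm_num
  have hb2 := measure_abs_sum_sub_ge_le (φ := fun x => |f x - condAvg J f x|) (fun x => by
      have h0 := hf x
      have h1 := condAvg_mem_Icc hf J x
      simp only [Set.mem_Icc] at h0 h1
      rw [abs_abs, abs_le]
      constructor <;> linarith) (m + M) hM0 (s := 1 / N) (by positivity)
  have hb3 : Real.exp (-(M * (1 / N : ℝ) ^ 2 / 2)) ≤ Real.exp (-X) := by
    gcongr
    refine hexp _ ?_
    gcongr
    exact le_mul_of_one_le_right hN'.le (one_le_pow₀ (by norm_num))
  refine (measureReal_mono hsub (measure_ne_top _ _)).trans ((measureReal_union_le _ _).trans ?_)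
  have hc : (J.powerset.card : ℝ) ≤ 2 ^ k := by
    rw [card_powerset]; push_cast
    exact pow_le_pow_right₀ (by norm_num) hJ
  have hc2 : (J.powerset.card : ℝ) * (2 * Real.exp (-X)) ≤ 2 ^ k * (2 * Real.exp (-X)) := by
    gcongr
  nlinarith

/-- With probability at least `2 / 3` all the estimates of the algorithm are accurate, for a set
`T` of relevant coordinates that is computed from the first `m` examples. -/
theorem measureReal_good_ge {f : Cube n → ℝ} (hf : ∀ x, f x ∈ Set.Icc (0 : ℝ) 1)
    {Q Λ m M N k cap : ℕ} (hQ : 0 < Q) (hn : n ≤ 2 ^ Λ) (hm : m = 160 * (Q * Q) * (Λ + 1))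
    (hN : 0 < N) (hM : M = 2 * 4 ^ k * (N * N) * (4 + k + k * cap)) (hcap : 0 < cap)
    (T : (ℕ → Cube n) → Finset (Fin n))
    (hT : ∀ ω ω' : ℕ → Cube n, (∀ t < m, ω t = ω' t) → T ω = T ω') (hTc : ∀ ω, (T ω).card ≤ cap) :
    2 / 3 ≤ (exampleLaw n).real {ω | GoodCoef f m Q ω ∧
      ∀ J ∈ powersetCard (min k (T ω).card) (T ω), GoodCond f m M N J ω} := by
  have h1 := measureReal_not_goodCoef_le hf hQ hn hm
  have h2 : (exampleLaw n).real {ω | ω ∈ (fun T' : Finset (Fin n) =>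
      ⋃ J ∈ powersetCard (min k T'.card) T', {ω | ¬ GoodCond f m M N J ω}) (T ω)} ≤ 1 / 6 := by
    refine measureReal_random_index_le (m := m) (L := m + M + M) T hT (fun T' : Finset (Fin n) =>
      ⋃ J ∈ powersetCard (min k T'.card) T', {ω | ¬ GoodCond f m M N J ω}) ?_ ?_
    · intro T' ω ω' hω h
      simp only [Set.mem_iUnion] at h ⊢
      obtain ⟨J, hJ, h⟩ := h
      refine ⟨J, hJ, ?_⟩
      have e1 : ∀ t ∈ range M, ω (m + t) = ω' (m + t) := fun t ht =>
        hω _ (by omega) (by have := mem_range.mp ht; omega)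
      have e2 : ∀ t ∈ range M, ω (m + M + t) = ω' (m + M + t) := fun t ht =>
        hω _ (by omega) (by have := mem_range.mp ht; omega)
      have s1 : ∀ A, ∑ t ∈ range M, f (ω (m + t)) * agree J A (ω (m + t)) =
          ∑ t ∈ range M, f (ω' (m + t)) * agree J A (ω' (m + t)) := fun A =>
        sum_congr rfl fun t ht => by rw [e1 t ht]
      have s2 : ∑ t ∈ range M, |f (ω (m + M + t)) - condAvg J f (ω (m + M + t))| =
          ∑ t ∈ range M, |f (ω' (m + M + t)) - condAvg J f (ω' (m + M + t))| :=
        sum_congr rfl fun t ht => by rw [e2 t ht]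
      simp only [Set.mem_ofPred_eq, GoodCond, s1, s2] at h ⊢
      exact h
    · intro ω
      set X := 4 + k + k * cap with hXdef
      have hb := measureReal_biUnion_le (n := n) (powersetCard (min k (T ω).card) (T ω))
        (fun J => {ω | ¬ GoodCond f m M N J ω}) (β := (2 ^ k + 1) * (2 * Real.exp (-X)))
        fun J hJ => measureReal_not_goodCond_le hf hN (by omega) hM (by
          rw [(mem_powersetCard.mp hJ).2]; exact min_le_left _ _)
      refine hb.trans ?_
      -- there are at most `cap ^ k` candidates
      have hcnt : ((powersetCard (min k (T ω).card) (T ω)).card : ℝ) ≤ (cap : ℝ) ^ k := by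
        rw [card_powersetCard]
        have : (T ω).card.choose (min k (T ω).card) ≤ cap ^ k :=
          calc _ ≤ (T ω).card ^ (min k (T ω).card) := Nat.choose_le_pow _ _
            _ ≤ cap ^ (min k (T ω).card) := Nat.pow_le_pow_left (hTc ω) _
            _ ≤ cap ^ k := Nat.pow_le_pow_right hcap (min_le_left _ _)
        exact_mod_cast this
      have hk : (2 : ℝ) ^ k + 1 ≤ 2 * Real.exp k := by
        have h3 : (2 : ℝ) ^ k ≤ Real.exp k := by
          have : Real.exp k = Real.exp 1 ^ k := by rw [← Real.exp_nat_mul]; simp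
          rw [this]
          refine pow_le_pow_left₀ (by norm_num) ?_ _
          have := Real.exp_one_gt_d9
          linarith
        have h4 : (1 : ℝ) ≤ 2 ^ k := one_le_pow₀ (by norm_num)
        linarith
      have hcp : (cap : ℝ) ^ k ≤ Real.exp (k * cap) := by
        rw [Real.exp_nat_mul]
        refine pow_le_pow_left₀ (by positivity) ?_ _
        have := Real.add_one_le_exp (cap : ℝ)
        linarith
      calc _ ≤ Real.exp (k * cap) * ((2 * Real.exp k) * (2 * Real.exp (-X))) := by
            gcongr
            exact hcnt.trans hcp
        _ = 4 * Real.exp (-4) := by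
            rw [hXdef]
            push_cast
            rw [show Real.exp (k * cap) * ((2 * Real.exp k) * (2 * Real.exp (-(4 + k + k * cap)))) =
              4 * (Real.exp (k * cap) * Real.exp k * Real.exp (-(4 + k + k * cap))) by ring,
              ← Real.exp_add, ← Real.exp_add]
            congr 2; ring
        _ ≤ 4 * (1 / 2) ^ 4 * (1 / 2) := by
            have h3 : Real.exp (-4) = Real.exp (-1) ^ 4 := by
              rw [← Real.exp_nat_mul]; norm_num
            have h5 : Real.exp (-1) ^ 4 ≤ (2 / 5) ^ 4 := by
              refine pow_le_pow_left₀ (Real.exp_nonneg _) ?_ _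
              have := Real.exp_neg_one_lt_d9
              linarith
            rw [h3]
            norm_num at h5 ⊢
            linarith
        _ ≤ 1 / 6 := by norm_num
  have hcov : (Set.univ : Set (ℕ → Cube n)) ⊆ {ω | GoodCoef f m Q ω ∧
      ∀ J ∈ powersetCard (min k (T ω).card) (T ω), GoodCond f m M N J ω} ∪
      ({ω | ¬ GoodCoef f m Q ω} ∪ {ω | ω ∈ (fun T' : Finset (Fin n) =>
      ⋃ J ∈ powersetCard (min k T'.card) T', {ω | ¬ GoodCond f m M N J ω}) (T ω)}) := by
    intro ω _
    by_cases hg : GoodCoef f m Q ω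
    · by_cases hg2 : ∀ J ∈ powersetCard (min k (T ω).card) (T ω), GoodCond f m M N J ω
      · exact Or.inl ⟨hg, hg2⟩
      · push Not at hg2
        obtain ⟨J, hJ, hJ2⟩ := hg2
        refine Or.inr (Or.inr ?_)
        simp only [Set.mem_ofPred_eq, Set.mem_iUnion]
        exact ⟨J, hJ, hJ2⟩
    · exact Or.inr (Or.inl hg)
  have h3 := (measureReal_mono (μ := exampleLaw n) hcov (measure_ne_top _ _)).trans
    ((measureReal_union_le _ _).trans (add_le_add le_rfl (measureReal_union_le _ _)))
  rw [probReal_univ] at h3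
  linarith

end CubeFn

namespace RealRAM

/-! ### Reasoning about programs -/

namespace Cmd

/-- The natural scalars that a program may change. -/
def wN : Cmd → List ℕ
  | setN v _ => [v]
  | seq p q => p.wN ++ q.wN
  | ite _ p q => p.wN ++ q.wN
  | .while _ p => p.wN
  | _ => []

/-- The real scalars that a program may change. -/
def wR : Cmd → List ℕ
  | setR v _ => [v]
  | draw _ v => [v]
  | seq p q => p.wR ++ q.wR
  | ite _ p q => p.wR ++ q.wR
  | .while _ p => p.wR
  | _ => []

/-- The natural arrays that a program may change. -/
def wNA : Cmd → List ℕ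
  | putN a _ _ => [a]
  | draw a _ => [a]
  | seq p q => p.wNA ++ q.wNA
  | ite _ p q => p.wNA ++ q.wNA
  | .while _ p => p.wNA
  | _ => []

/-- The real arrays that a program may change. -/
def wRA : Cmd → List ℕ
  | putR a _ _ => [a]
  | seq p q => p.wRA ++ q.wRA
  | ite _ p q => p.wRA ++ q.wRA
  | .while _ p => p.wRA
  | _ => []

/-- Whether a program may request an example. -/
def draws : Cmd → Bool
  | draw _ _ => true
  | seq p q => p.draws || q.draws
  | ite _ p q => p.draws || q.draws
  | .while _ p => p.draws
  | _ => false

end Cmd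

/-- The states `s` and `s'` differ at most in what `p` may change. -/
structure Agree (p : Cmd) (s s' : State) : Prop where
  nvar : ∀ v, v ∉ p.wN → s'.nvar v = s.nvar v
  rvar : ∀ v, v ∉ p.wR → s'.rvar v = s.rvar v
  narr : ∀ a, a ∉ p.wNA → s'.narr a = s.narr a
  rarr : ∀ a, a ∉ p.wRA → s'.rarr a = s.rarr a
  drawn : p.draws = false → s'.drawn = s.drawn

namespace Agree

theorem refl (p : Cmd) (s : State) : Agree p s s :=
  ⟨fun _ _ => rfl, fun _ _ => rfl, fun _ _ => rfl, fun _ _ => rfl, fun _ => rfl⟩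

theorem trans {p : Cmd} {s₁ s₂ s₃ : State} (h : Agree p s₁ s₂) (h' : Agree p s₂ s₃) :
    Agree p s₁ s₃ :=
  ⟨fun v hv => (h'.nvar v hv).trans (h.nvar v hv), fun v hv => (h'.rvar v hv).trans (h.rvar v hv),
    fun v hv => (h'.narr v hv).trans (h.narr v hv), fun v hv => (h'.rarr v hv).trans (h.rarr v hv),
    fun hd => (h'.drawn hd).trans (h.drawn hd)⟩

theorem mono {p q : Cmd} {s s' : State} (h : Agree p s s') (h1 : p.wN ⊆ q.wN) (h2 : p.wR ⊆ q.wR)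
    (h3 : p.wNA ⊆ q.wNA) (h4 : p.wRA ⊆ q.wRA) (h5 : q.draws = false → p.draws = false) :
    Agree q s s' :=
  ⟨fun v hv => h.nvar v fun hm => hv (h1 hm), fun v hv => h.rvar v fun hm => hv (h2 hm),
    fun v hv => h.narr v fun hm => hv (h3 hm), fun v hv => h.rarr v fun hm => hv (h4 hm),
    fun hd => h.drawn (h5 hd)⟩

theorem seq_left {p q : Cmd} {s s' : State} (h : Agree p s s') : Agree (p.seq q) s s' :=
  h.mono (List.subset_append_left _ _) (List.subset_append_left _ _)
    (List.subset_append_left _ _) (List.subset_append_left _ _)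
    fun hd => (Bool.or_eq_false_iff.mp hd).1

theorem seq_right {p q : Cmd} {s s' : State} (h : Agree q s s') : Agree (p.seq q) s s' :=
  h.mono (List.subset_append_right _ _) (List.subset_append_right _ _)
    (List.subset_append_right _ _) (List.subset_append_right _ _)
    fun hd => (Bool.or_eq_false_iff.mp hd).2

end Agree

variable {n : ℕ} {f : Cube n → ℝ} {ω : ℕ → Cube n}

theorem Exec.agree {p : Cmd} {s s' : State} {T : ℕ} (h : Exec f ω p s s' T) : Agree p s s' := by
  induction h with
  | skip s => exact Agree.refl _ _
  | setN v e s =>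
    refine ⟨fun w hw => ?_, fun _ _ => rfl, fun _ _ => rfl, fun _ _ => rfl, fun _ => rfl⟩
    simp only [Cmd.wN, List.mem_singleton] at hw
    exact Function.update_of_ne hw _ _
  | setR v e s =>
    refine ⟨fun _ _ => rfl, fun w hw => ?_, fun _ _ => rfl, fun _ _ => rfl, fun _ => rfl⟩
    simp only [Cmd.wR, List.mem_singleton] at hw
    exact Function.update_of_ne hw _ _
  | putN a i e s =>
    refine ⟨fun _ _ => rfl, fun _ _ => rfl, fun w hw => ?_, fun _ _ => rfl, fun _ => rfl⟩
    simp only [Cmd.wNA, List.mem_singleton] at hw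
    exact Function.update_of_ne hw _ _
  | putR a i e s =>
    refine ⟨fun _ _ => rfl, fun _ _ => rfl, fun _ _ => rfl, fun w hw => ?_, fun _ => rfl⟩
    simp only [Cmd.wRA, List.mem_singleton] at hw
    exact Function.update_of_ne hw _ _
  | draw a v s =>
    refine ⟨fun _ _ => rfl, fun w hw => ?_, fun w hw => ?_, fun _ _ => rfl, fun h => ?_⟩
    · simp only [Cmd.wR, List.mem_singleton] at hw
      exact Function.update_of_ne hw _ _
    · simp only [Cmd.wNA, List.mem_singleton] at hw
      exact Function.update_of_ne hw _ _
    · simp [Cmd.draws] at h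
  | seq _ _ ih₁ ih₂ => exact ih₁.seq_left.trans ih₂.seq_right
  | iteTrue q hb _ ih =>
    exact ih.mono (List.subset_append_left _ _) (List.subset_append_left _ _)
      (List.subset_append_left _ _) (List.subset_append_left _ _)
      fun hd => (Bool.or_eq_false_iff.mp hd).1
  | iteFalse p hb _ ih =>
    exact ih.mono (List.subset_append_right _ _) (List.subset_append_right _ _)
      (List.subset_append_right _ _) (List.subset_append_right _ _)
      fun hd => (Bool.or_eq_false_iff.mp hd).2
  | whileTrue hb _ _ ih₁ ih₂ =>
    exact Agree.trans ⟨ih₁.nvar, ih₁.rvar, ih₁.narr, ih₁.rarr, ih₁.drawn⟩ ih₂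
  | whileFalse p hb => exact Agree.refl _ _

/-- Started in `s`, the program `p` halts after at most `B` steps in a state that satisfies `Q`. -/
def Reach (f : Cube n → ℝ) (ω : ℕ → Cube n) (p : Cmd) (s : State) (B : ℕ) (Q : State → Prop) :
    Prop :=
  ∃ (s' : State) (T : ℕ), Exec f ω p s s' T ∧ T ≤ B ∧ Q s'

namespace Reach

/-- The frame rule: what a program does not write keeps its value. -/
theorem frame {p : Cmd} {s : State} {B : ℕ} {Q : State → Prop} (h : Reach f ω p s B Q) :
    Reach f ω p s B fun s' => Q s' ∧ Agree p s s' := by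
  obtain ⟨s', T, h1, h2, h3⟩ := h
  exact ⟨s', T, h1, h2, h3, h1.agree⟩

theorem mono {p : Cmd} {s : State} {B B' : ℕ} {Q Q' : State → Prop} (h : Reach f ω p s B Q)
    (hB : B ≤ B') (hQ : ∀ s', Q s' → Q' s') : Reach f ω p s B' Q' := by
  obtain ⟨s', T, h1, h2, h3⟩ := h
  exact ⟨s', T, h1, h2.trans hB, hQ _ h3⟩

theorem seq {p q : Cmd} {s : State} {B₁ B₂ : ℕ} {Q : State → Prop}
    (h : Reach f ω p s B₁ fun s₁ => Reach f ω q s₁ B₂ Q) : Reach f ω (p.seq q) s (B₁ + B₂) Q := by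
  obtain ⟨s₁, T₁, h1, h2, s₂, T₂, h3, h4, h5⟩ := h
  exact ⟨s₂, T₁ + T₂, .seq h1 h3, Nat.add_le_add h2 h4, h5⟩

theorem draw (a v : ℕ) {s : State} {Q : State → Prop}
    (h : Q (s.receive a v (ω s.drawn) (f (ω s.drawn)))) : Reach f ω (.draw a v) s (n + 1) Q :=
  ⟨_, _, .draw a v s, le_rfl, h⟩

theorem ite {b : BExp} {p q : Cmd} {s : State} {B : ℕ} {Q : State → Prop}
    (ht : b.Holds s → Reach f ω p s B Q) (hf : ¬ b.Holds s → Reach f ω q s B Q) :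
    Reach f ω (.ite b p q) s (b.cost + 1 + B) Q := by
  by_cases hb : b.Holds s
  · obtain ⟨s', T, h1, h2, h3⟩ := ht hb
    exact ⟨s', _, .iteTrue q hb h1, Nat.add_le_add_left h2 _, h3⟩
  · obtain ⟨s', T, h1, h2, h3⟩ := hf hb
    exact ⟨s', _, .iteFalse p hb h1, Nat.add_le_add_left h2 _, h3⟩

/-- A loop that runs exactly `N` times. -/
theorem whileLoop {b : BExp} {p : Cmd} {s : State} {N B : ℕ} (Inv : ℕ → State → Prop)
    (h0 : Inv 0 s)
    (hstep : ∀ i < N, ∀ s', Agree p s s' → Inv i s' →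
      b.Holds s' ∧ Reach f ω p s' B (Inv (i + 1)))
    (hend : ∀ s', Agree p s s' → Inv N s' → ¬ b.Holds s') :
    Reach f ω (.while b p) s (N * (b.cost + 1 + B) + (b.cost + 1)) (Inv N) := by
  suffices H : ∀ r i, i + r = N → ∀ s', Agree p s s' → Inv i s' →
      Reach f ω (.while b p) s' (r * (b.cost + 1 + B) + (b.cost + 1)) (Inv N) from
    H N 0 (Nat.zero_add N) s (Agree.refl p s) h0
  intro r
  induction r with
  | zero =>
    intro i hi s' hA hs'
    obtain rfl : i = N := by omega
    exact ⟨s', _, .whileFalse p (hend s' hA hs'), by omega, hs'⟩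
  | succ r ih =>
    intro i hi s' hA hs'
    obtain ⟨hb, s₁, T₁, h1, h2, h3⟩ := hstep i (by omega) s' hA hs'
    obtain ⟨s₂, T₂, h4, h5, h6⟩ := ih (i + 1) (by omega) s₁ (hA.trans h1.agree) h3
    refine ⟨s₂, _, .whileTrue hb h1 h4, ?_, h6⟩
    rw [Nat.succ_mul]
    omega

end Reach

/-! ### Straight-line code -/

section Expressions

-- arithmetic notation for the expressions of the programs

instance : Add NExp := ⟨.add⟩
instance : Sub NExp := ⟨.sub⟩
instance : Mul NExp := ⟨.mul⟩
instance (k : ℕ) : OfNat NExp k := ⟨.const k⟩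
instance : Add RExp := ⟨.add⟩
instance : Sub RExp := ⟨.sub⟩
instance : Mul RExp := ⟨.mul⟩
instance : Div RExp := ⟨.div⟩
instance (k : ℕ) : OfNat RExp k := ⟨.const k⟩

end Expressions

section Eval

variable (s : State)

@[simp] theorem NExp.eval_var (v : ℕ) : (NExp.var v).eval s = s.nvar v := rfl
@[simp] theorem NExp.eval_arr (a : ℕ) (i : NExp) :
    (NExp.arr a i).eval s = s.narr a (i.eval s) := rfl
@[simp] theorem NExp.eval_add (a b : NExp) : (a + b).eval s = a.eval s + b.eval s := rfl
@[simp] theorem NExp.eval_sub (a b : NExp) : (a - b).eval s = a.eval s - b.eval s := rfl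
@[simp] theorem NExp.eval_mul (a b : NExp) : (a * b).eval s = a.eval s * b.eval s := rfl
@[simp] theorem NExp.eval_ofNat (k : ℕ) :
    NExp.eval s (no_index (OfNat.ofNat k)) = OfNat.ofNat k := rfl
@[simp] theorem NExp.cost_add (a b : NExp) : (a + b).cost = a.cost + b.cost + 1 := rfl
@[simp] theorem NExp.cost_sub (a b : NExp) : (a - b).cost = a.cost + b.cost + 1 := rfl
@[simp] theorem NExp.cost_mul (a b : NExp) : (a * b).cost = a.cost + b.cost + 1 := rfl
@[simp] theorem NExp.cost_var (v : ℕ) : (NExp.var v).cost = 1 := rfl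
@[simp] theorem NExp.cost_ofNat (k : ℕ) : NExp.cost (no_index (OfNat.ofNat k)) = 1 := rfl
@[simp] theorem RExp.eval_var (v : ℕ) : (RExp.var v).eval s = s.rvar v := rfl
@[simp] theorem RExp.eval_arr (a : ℕ) (i : NExp) :
    (RExp.arr a i).eval s = s.rarr a (i.eval s) := rfl
@[simp] theorem RExp.eval_nat (e : NExp) : (RExp.ofNat e).eval s = (e.eval s : ℝ) := rfl
@[simp] theorem RExp.eval_add (a b : RExp) : (a + b).eval s = a.eval s + b.eval s := rfl
@[simp] theorem RExp.eval_sub (a b : RExp) : (a - b).eval s = a.eval s - b.eval s := rfl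
@[simp] theorem RExp.eval_mul (a b : RExp) : (a * b).eval s = a.eval s * b.eval s := rfl
@[simp] theorem RExp.eval_div (a b : RExp) : (a / b).eval s = a.eval s / b.eval s := rfl
@[simp] theorem RExp.eval_ofNat (k : ℕ) :
    RExp.eval s (no_index (OfNat.ofNat k)) = ((OfNat.ofNat k : ℕ) : ℝ) := by
  change (((k : ℚ) : ℝ)) = (k : ℕ)
  norm_cast
@[simp] theorem BExp.holds_nle (a b : NExp) :
    (BExp.nle a b).Holds s ↔ a.eval s ≤ b.eval s := Iff.rfl
@[simp] theorem BExp.holds_rle (a b : RExp) :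
    (BExp.rle a b).Holds s ↔ a.eval s ≤ b.eval s := Iff.rfl
@[simp] theorem BExp.holds_not (b : BExp) : (BExp.not b).Holds s ↔ ¬ b.Holds s := Iff.rfl
@[simp] theorem BExp.holds_and (b c : BExp) :
    (BExp.and b c).Holds s ↔ b.Holds s ∧ c.Holds s := Iff.rfl

end Eval

section State

variable (s : State) (v w k a i b j : ℕ) (r : ℝ)

@[simp] theorem State.setN_nvar : (s.setN v k).nvar w = if w = v then k else s.nvar w :=
  Function.update_apply ..
@[simp] theorem State.setN_rvar : (s.setN v k).rvar = s.rvar := rfl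
@[simp] theorem State.setN_narr : (s.setN v k).narr = s.narr := rfl
@[simp] theorem State.setN_rarr : (s.setN v k).rarr = s.rarr := rfl
@[simp] theorem State.setN_drawn : (s.setN v k).drawn = s.drawn := rfl
@[simp] theorem State.setR_nvar : (s.setR v r).nvar = s.nvar := rfl
@[simp] theorem State.setR_rvar : (s.setR v r).rvar w = if w = v then r else s.rvar w :=
  Function.update_apply ..
@[simp] theorem State.setR_narr : (s.setR v r).narr = s.narr := rfl
@[simp] theorem State.setR_rarr : (s.setR v r).rarr = s.rarr := rfl
@[simp] theorem State.setR_drawn : (s.setR v r).drawn = s.drawn := rfl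
@[simp] theorem State.putN_nvar : (s.putN a i k).nvar = s.nvar := rfl
@[simp] theorem State.putN_rvar : (s.putN a i k).rvar = s.rvar := rfl
@[simp] theorem State.putN_narr : (s.putN a i k).narr b j =
    if b = a then if j = i then k else s.narr a j else s.narr b j := by
  by_cases h : b = a
  · subst h; simp [State.putN, Function.update_apply]
  · simp [State.putN, h]
@[simp] theorem State.putN_rarr : (s.putN a i k).rarr = s.rarr := rfl
@[simp] theorem State.putN_drawn : (s.putN a i k).drawn = s.drawn := rfl
@[simp] theorem State.putR_nvar : (s.putR a i r).nvar = s.nvar := rfl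
@[simp] theorem State.putR_rvar : (s.putR a i r).rvar = s.rvar := rfl
@[simp] theorem State.putR_narr : (s.putR a i r).narr = s.narr := rfl
@[simp] theorem State.putR_rarr : (s.putR a i r).rarr b j =
    if b = a then if j = i then r else s.rarr a j else s.rarr b j := by
  by_cases h : b = a
  · subst h; simp [State.putR, Function.update_apply]
  · simp [State.putR, h]
@[simp] theorem State.putR_drawn : (s.putR a i r).drawn = s.drawn := rfl
@[simp] theorem State.receive_nvar (x : Cube n) : (s.receive a v x r).nvar = s.nvar := rfl
@[simp] theorem State.receive_rvar (x : Cube n) :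
    (s.receive a v x r).rvar w = if w = v then r else s.rvar w :=
  Function.update_apply ..
@[simp] theorem State.receive_narr (x : Cube n) : (s.receive a v x r).narr b j =
    if b = a then if h : j < n then (x ⟨j, h⟩).toNat else s.narr a j else s.narr b j := by
  by_cases h : b = a
  · subst h; simp [State.receive]
  · simp [State.receive, h]
@[simp] theorem State.receive_rarr (x : Cube n) : (s.receive a v x r).rarr = s.rarr := rfl
@[simp] theorem State.receive_drawn (x : Cube n) :
    (s.receive a v x r).drawn = s.drawn + 1 := rfl

end State

namespace Cmd

/-- A program without loops and without requests for examples. -/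
def straight : Cmd → Bool
  | draw _ _ => false
  | .while _ _ => false
  | seq p q => p.straight && q.straight
  | ite _ p q => p.straight && q.straight
  | _ => true

/-- An upper bound for the running time of a straight-line program; the value `0` on loops and on
requests for examples has no meaning. -/
def maxCost : Cmd → ℕ
  | skip => 1
  | setN _ e => e.cost + 1
  | setR _ e => e.cost + 1
  | putN _ i e => i.cost + e.cost + 1
  | putR _ i e => i.cost + e.cost + 1
  | seq p q => p.maxCost + q.maxCost
  | ite b p q => b.cost + 1 + max p.maxCost q.maxCost
  | _ => 0

open Classical in
/-- The effect of a straight-line program; loops and requests for examples are ignored. -/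
noncomputable def run : Cmd → State → State
  | setN v e, s => s.setN v (e.eval s)
  | setR v e, s => s.setR v (e.eval s)
  | putN a i e, s => s.putN a (i.eval s) (e.eval s)
  | putR a i e, s => s.putR a (i.eval s) (e.eval s)
  | seq p q, s => q.run (p.run s)
  | ite b p q, s => if b.Holds s then p.run s else q.run s
  | _, s => s

/-- Running `p` with the scalar `v` going from `0` to the value of the scalar `w`. -/
def forTo (v w : ℕ) (p : Cmd) : Cmd :=
  seq (setN v 0) (.while (.not (.nle (.var w) (.var v))) (seq p (setN v (.var v + 1))))

end Cmd

namespace Reach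

/-- The rule for straight-line code: compute the final state and the worst-case cost. -/
theorem straight {p : Cmd} (hp : p.straight = true) {s : State} {B : ℕ} (hB : p.maxCost ≤ B)
    {Q : State → Prop} (hQ : Q (p.run s)) : Reach f ω p s B Q := by
  suffices H : ∀ p : Cmd, p.straight = true → ∀ s, ∃ T ≤ p.maxCost, Exec f ω p s (p.run s) T by
    obtain ⟨T, hT, h⟩ := H p hp s
    exact ⟨_, T, h, hT.trans hB, hQ⟩
  intro p
  induction p with
  | skip => exact fun _ s => ⟨1, le_rfl, .skip s⟩
  | setN v e => exact fun _ s => ⟨_, le_rfl, .setN v e s⟩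
  | setR v e => exact fun _ s => ⟨_, le_rfl, .setR v e s⟩
  | putN a i e => exact fun _ s => ⟨_, le_rfl, .putN a i e s⟩
  | putR a i e => exact fun _ s => ⟨_, le_rfl, .putR a i e s⟩
  | seq p q ihp ihq =>
    intro h s
    obtain ⟨h1, h2⟩ := Bool.and_eq_true_iff.mp h
    obtain ⟨T₁, hT₁, e₁⟩ := ihp h1 s
    obtain ⟨T₂, hT₂, e₂⟩ := ihq h2 (p.run s)
    exact ⟨_, Nat.add_le_add hT₁ hT₂, .seq e₁ e₂⟩
  | ite b p q ihp ihq =>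
    intro h s
    obtain ⟨h1, h2⟩ := Bool.and_eq_true_iff.mp h
    by_cases hb : b.Holds s
    · obtain ⟨T, hT, e⟩ := ihp h1 s
      refine ⟨_, Nat.add_le_add_left (hT.trans (le_max_left _ _)) _, ?_⟩
      simp only [Cmd.run, if_pos hb]
      exact .iteTrue q hb e
    · obtain ⟨T, hT, e⟩ := ihq h2 s
      refine ⟨_, Nat.add_le_add_left (hT.trans (le_max_right _ _)) _, ?_⟩
      simp only [Cmd.run, if_neg hb]
      exact .iteFalse p hb e
  | _ => intro h; simp [Cmd.straight] at h

theorem seq_draw {a v : ℕ} {q : Cmd} {s : State} {B : ℕ} {Q : State → Prop}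
    (h : Reach f ω q (s.receive a v (ω s.drawn) (f (ω s.drawn))) B Q) :
    Reach f ω (.seq (.draw a v) q) s (n + 1 + B) Q :=
  seq (draw a v h)

theorem seq_straight {p q : Cmd} (hp : p.straight = true) {s : State} {B₁ B₂ : ℕ}
    (hB : p.maxCost ≤ B₁) {Q : State → Prop} (h : Reach f ω q (p.run s) B₂ Q) :
    Reach f ω (.seq p q) s (B₁ + B₂) Q :=
  seq (straight hp hB h)

/-- The rule for counting loops. The body may change neither the counter `v` nor the bound `w`; an
iteration adds `9` steps for the test and the increment. -/
theorem forTo {v w : ℕ} {p : Cmd} {s : State} {N B : ℕ} (hw : s.nvar w = N) (hvw : w ≠ v)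
    (hv : v ∉ p.wN) (hwp : w ∉ p.wN) (Inv : ℕ → State → Prop) (h0 : Inv 0 (s.setN v 0))
    (hstep : ∀ i < N, ∀ s', Agree (p.seq (.setN v 0)) s s' → s'.nvar v = i → Inv i s' →
      Reach f ω p s' B fun s'' => Inv (i + 1) (s''.setN v (i + 1)))
    {B' : ℕ} (hB : N * (B + 9) + 7 ≤ B') {Q : State → Prop}
    (hQ : ∀ s', Agree (p.seq (.setN v 0)) s s' → Inv N s' → Q s') :
    Reach f ω (.forTo v w p) s B' Q := by
  have hset : Agree (p.seq (.setN v 0)) s (s.setN v 0) :=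
    Agree.seq_right (Exec.agree (f := f) (ω := ω) (.setN v 0 s))
  have hw' : ∀ s', Agree (p.seq (.setN v 0)) s s' → s'.nvar w = N := fun s' h => by
    rw [h.nvar w (by simp [Cmd.wN, hvw, hwp]), hw]
  have hconv : ∀ s', Agree (p.seq (.setN v (.var v + 1))) (s.setN v 0) s' →
      Agree (p.seq (.setN v 0)) s s' := fun s' h =>
    hset.trans ⟨h.nvar, h.rvar, h.narr, h.rarr, h.drawn⟩
  refine (Reach.seq (B₁ := 2) (straight rfl le_rfl ((whileLoop (B := B + 4)
    (N := N) (fun i s' => s'.nvar v = i ∧ Inv i s') ⟨by simp, h0⟩ ?_ ?_).frame))).mono ?_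
    fun s' h => hQ s' (hconv s' ⟨h.2.nvar, h.2.rvar, h.2.narr, h.2.rarr, h.2.drawn⟩) h.1.2
  · rintro i hi s' hA ⟨hvi, hI⟩
    have hA' := hconv s' hA
    refine ⟨by simp [hw' s' hA', hvi, hi], Reach.seq ?_⟩
    refine (hstep i hi s' hA' hvi hI).frame.mono le_rfl ?_
    rintro s'' ⟨h1, h2⟩
    have hvi' : s''.nvar v = i := by rw [h2.nvar v hv, hvi]
    refine straight rfl le_rfl ?_
    simp only [Cmd.run, NExp.eval_add, NExp.eval_var, NExp.eval_ofNat, hvi']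
    exact ⟨by simp, h1⟩
  · rintro s' hA ⟨hvi, -⟩
    simp [hw' s' (hconv s' hA), hvi]
  · refine le_trans (le_of_eq ?_) hB
    simp only [BExp.cost, NExp.cost]
    ring

end Reach

end RealRAM

namespace RealRAM

open Finset CubeFn

variable {n : ℕ} {f : Cube n → ℝ} {ω : ℕ → Cube n}

/-! ### Estimating the coefficients -/

/-- A matrix with rows of length `w` is stored row by row: the cells do not collide. -/
theorem pair_index_inj {w i j i' j' : ℕ} (hj : j < w) (hj' : j' < w) :
    i' * w + j' = i * w + j ↔ i' = i ∧ j' = j := by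
  constructor
  · intro h
    have hw : 0 < w := by omega
    have h1 := congrArg (· / w) h
    have h2 := congrArg (· % w) h
    simp only [Nat.mul_comm _ w, Nat.mul_add_div hw, Nat.mul_add_mod, Nat.div_eq_of_lt hj,
      Nat.div_eq_of_lt hj', Nat.mod_eq_of_lt hj, Nat.mod_eq_of_lt hj'] at h1 h2
    omega
  · rintro ⟨rfl, rfl⟩; rfl

/-- Add the contributions of `m` examples to the sums for the coefficients. The cell `n` of the
array of the example keeps the value `0`, and so stands for the constant function `1`. -/
def coefStage : Cmd :=
  .forTo 9 8 (.seq (.draw 1 1) (.forTo 10 0 (.forTo 11 12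
    (.putR 1 (.var 10 * .var 12 + .var 11)
      (.arr 1 (.var 10 * .var 12 + .var 11) +
        .var 1 * (1 - 2 * .ofNat (.arr 1 (.var 10))) * (1 - 2 * .ofNat (.arr 1 (.var 11))))))))

theorem chi_eq_of_receive {s : State} {x : Cube n} {y : ℝ} (h : s.narr 1 n = 0) {j : ℕ}
    (hj : j < n + 1) : (1 : ℝ) - 2 * ((s.receive 1 1 x y).narr 1 j : ℝ) = chi x j := by
  simp only [State.receive_narr, if_true, chi]
  split_ifs with h1
  · cases x ⟨j, h1⟩ <;> norm_num [sgn]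
  · obtain rfl : j = n := by omega
    simp [h]

theorem reach_coefStage {s : State} {m : ℕ} (h0 : s.nvar 0 = n) (h12 : s.nvar 12 = n + 1)
    (h8 : s.nvar 8 = m) (hz : ∀ i, s.rarr 1 i = 0) (h1 : s.narr 1 n = 0) (hd : s.drawn = 0) :
    Reach f ω coefStage s (m * (n + 1 + (n * ((n + 1) * 59 + 16) + 7) + 9) + 7) fun s' =>
      s'.drawn = m ∧ ∀ i < n, ∀ j < n + 1, s'.rarr 1 (i * (n + 1) + j) =
        ∑ t ∈ range m, f (ω t) * chi (ω t) i * chi (ω t) j := by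
  refine Reach.forTo h8 (by decide) (by decide) (by decide) (fun t s' => s'.drawn = t ∧
    s'.narr 1 n = 0 ∧ ∀ i < n, ∀ j < n + 1, s'.rarr 1 (i * (n + 1) + j) =
        ∑ t ∈ range t, f (ω t) * chi (ω t) i * chi (ω t) j) ?_ ?_ le_rfl
        fun s' _ h => ⟨h.1, h.2.2⟩
  · simp [hd, h1, hz]
  rintro t ht s₁ hA - ⟨hd₁, hn₁, hI₁⟩
  refine Reach.seq_draw ?_
  have h0₁ : s₁.nvar 0 = n := (hA.nvar 0 (by decide)).trans h0
  have h12₁ : s₁.nvar 12 = n + 1 := (hA.nvar 12 (by decide)).trans h12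
  rw [hd₁]
  set s₂ := s₁.receive 1 1 (ω t) (f (ω t)) with hs₂
  have hchi : ∀ j < n + 1, (1 : ℝ) - 2 * (s₂.narr 1 j : ℝ) = chi (ω t) j := fun j hj =>
    chi_eq_of_receive hn₁ hj
  have h0₂ : s₂.nvar 0 = n := h0₁
  have h12₂ : s₂.nvar 12 = n + 1 := h12₁
  refine Reach.forTo (B := (n + 1) * 59 + 7) (N := n) h0₂ (by decide) (by decide) (by decide)
    (fun i s' => ∀ i' < n, ∀ j' < n + 1, s'.rarr 1 (i' * (n + 1) + j') =
      ∑ t ∈ range t, f (ω t) * chi (ω t) i' * chi (ω t) j' +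
        if i' < i then f (ω t) * chi (ω t) i' * chi (ω t) j' else 0) ?_ ?_ le_rfl ?_
  · intro i' hi' j' hj'
    simpa [hs₂] using hI₁ i' hi' j' hj'
  · intro i hi s₃ hA₃ hi₃ hI₃
    have h12₃ : s₃.nvar 12 = n + 1 := (hA₃.nvar 12 (by decide)).trans h12₂
    refine Reach.forTo (B := 50) h12₃ (by decide) (by decide) (by decide)
      (fun j s' => ∀ i' < n, ∀ j' < n + 1, s'.rarr 1 (i' * (n + 1) + j') =
      ∑ t ∈ range t, f (ω t) * chi (ω t) i' * chi (ω t) j' +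
        if i' < i ∨ i' = i ∧ j' < j then f (ω t) * chi (ω t) i' * chi (ω t) j' else 0) ?_ ?_
        le_rfl ?_
    · intro i' hi' j' hj'
      simpa using hI₃ i' hi' j' hj'
    · intro j hj s₄ hA₄ hj₄ hI₄
      have hi₄ : s₄.nvar 10 = i := (hA₄.nvar 10 (by decide)).trans hi₃
      have h12₄ : s₄.nvar 12 = n + 1 := (hA₄.nvar 12 (by decide)).trans h12₃
      have hx₄ : s₄.narr 1 = s₂.narr 1 :=
        (hA₄.narr 1 (by decide)).trans (hA₃.narr 1 (by decide))
      have hy₄ : s₄.rvar 1 = f (ω t) := by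
        rw [hA₄.rvar 1 (by decide), hA₃.rvar 1 (by decide)]; simp [hs₂]
      refine Reach.straight rfl (by decide) ?_
      intro i' hi' j' hj'
      simp [Cmd.run, hi₄, h12₄, hj₄, hx₄, hy₄, pair_index_inj hj hj', hI₄ i' hi' j' hj']
      have e1 := hchi i (by omega)
      have e2 := hchi j hj
      by_cases h : i' = i ∧ j' = j
      · obtain ⟨rfl, rfl⟩ := h
        simp [hI₄ i' hi' j' hj', e1, e2]
      · rw [if_neg h]
        congr 1
        refine if_congr ?_ rfl rfl
        omega
    · rintro s' - hs' i' hi' j' hj'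
      rw [State.setN_rarr, hs' i' hi' j' hj']
      congr 1
      refine if_congr ?_ rfl rfl
      omega
  · rintro s' hA' hs'
    refine ⟨by simp [hA'.drawn (by decide), hs₂, hd₁], ?_, ?_⟩
    · rw [State.setN_narr, hA'.narr 1 (by decide), hs₂]
      simpa using hn₁
    · intro i hi j hj
      rw [State.setN_rarr, hs' i hi j hj, if_pos hi, sum_range_succ]

end RealRAM

namespace RealRAM

open Finset CubeFn

variable {n : ℕ} {f : Cube n → ℝ} {ω : ℕ → Cube n}

/-! ### Selecting the relevant coordinates -/

/-- The coordinate `i` has a large estimated coefficient of degree one or two; `A i j` is the sum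
of `m` products. The test says `3 / (4 Q) ≤ |A i j / m|`, without division and absolute value. -/
def Relevant (A : ℕ → ℕ → ℝ) (n m Q i : ℕ) : Prop :=
  ∃ j < n + 1, j ≠ i ∧ (9 * (m * m) : ℝ) ≤ 16 * (Q * Q) * (A i j * A i j)

open Classical in
/-- The first `cap` relevant coordinates below `i`. -/
noncomputable def relevantList (A : ℕ → ℕ → ℝ) (n m Q cap i : ℕ) : List ℕ :=
  ((List.range i).filter fun i => decide (Relevant A n m Q i)).take cap

theorem relevantList_succ_of_relevant {A : ℕ → ℕ → ℝ} {n m Q cap i : ℕ}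
    (h : Relevant A n m Q i) (hcap : (relevantList A n m Q cap i).length + 1 ≤ cap) :
    relevantList A n m Q cap (i + 1) = relevantList A n m Q cap i ++ [i] := by
  unfold relevantList at *
  rw [List.range_succ, List.filter_append]
  rw [List.length_take] at hcap
  rw [List.take_append, List.take_of_length_le (by omega)]
  simp only [List.filter_cons, h, decide_true, if_true, List.filter_nil]
  rw [List.take_of_length_le (by simp; omega)]

theorem relevantList_succ_of_not {A : ℕ → ℕ → ℝ} {n m Q cap i : ℕ}
    (h : ¬ (Relevant A n m Q i ∧ (relevantList A n m Q cap i).length + 1 ≤ cap)) :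
    relevantList A n m Q cap (i + 1) = relevantList A n m Q cap i := by
  unfold relevantList at *
  rw [List.range_succ, List.filter_append]
  by_cases hr : Relevant A n m Q i
  · have h2 : ¬ _ := fun h' => h ⟨hr, h'⟩
    rw [List.length_take] at h2
    rw [List.take_append_of_le_length (by omega)]
  · simp [hr]

/-- List the relevant coordinates. -/
def selectStage : Cmd :=
  .seq (.setN 14 0) (.forTo 10 0 (.seq (.setN 13 0) (.seq
    (.forTo 11 12 (.ite
      (.and (.not (.and (.nle (.var 10) (.var 11)) (.nle (.var 11) (.var 10))))
        (.rle (.ofNat (9 * (.var 8 * .var 8))) (.ofNat (16 * (.var 6 * .var 6)) *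
          (.arr 1 (.var 10 * .var 12 + .var 11) * .arr 1 (.var 10 * .var 12 + .var 11)))))
      (.setN 13 1) .skip))
    (.ite (.and (.nle 1 (.var 13)) (.nle (.var 14 + 1) (.var 7)))
      (.seq (.putN 2 (.var 14) (.var 10)) (.setN 14 (.var 14 + 1))) .skip))))

theorem reach_selectStage {s : State} {m Q cap : ℕ} {A : ℕ → ℕ → ℝ} (h0 : s.nvar 0 = n)
    (h12 : s.nvar 12 = n + 1) (h8 : s.nvar 8 = m) (h6 : s.nvar 6 = Q) (h7 : s.nvar 7 = cap)
    (hA : ∀ i < n, ∀ j < n + 1, s.rarr 1 (i * (n + 1) + j) = A i j) :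
    Reach f ω selectStage s (2 + (n * ((2 + ((n + 1) * 59 + 7 + 30)) + 9) + 7)) fun s' =>
      s'.nvar 14 = (relevantList A n m Q cap n).length ∧
      ∀ a < (relevantList A n m Q cap n).length,
        s'.narr 2 a = (relevantList A n m Q cap n).getD a 0 := by
  refine Reach.seq_straight rfl (by decide) ?_
  have h0' : ((Cmd.setN 14 0).run s).nvar 0 = n := by simpa [Cmd.run] using h0
  refine Reach.forTo h0' (by decide) (by decide) (by decide) (fun i s' =>
    s'.nvar 14 = (relevantList A n m Q cap i).length ∧
      ∀ a < (relevantList A n m Q cap i).length,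
        s'.narr 2 a = (relevantList A n m Q cap i).getD a 0)
    ?_ ?_ le_rfl fun s' _ h => h
  · simp [Cmd.run, relevantList]
  rintro i hi s₁ hA₁ hi₁ ⟨hL₁, hl₁⟩
  refine Reach.seq_straight rfl (by decide) ?_
  have h12₁ : ((Cmd.setN 13 0).run s₁).nvar 12 = n + 1 := by
    simp [Cmd.run, hA₁.nvar 12 (by decide), h12]
  refine Reach.seq ?_
  refine Reach.forTo (B := 50) h12₁ (by decide) (by decide) (by decide) (fun j s' =>
    s'.nvar 13 = 1 ∧ (∃ j' < j, j' ≠ i ∧ (9 * (m * m) : ℝ) ≤ 16 * (Q * Q) * (A i j' * A i j')) ∨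
    s'.nvar 13 = 0 ∧ ¬ (∃ j' < j, j' ≠ i ∧ (9 * (m * m) : ℝ) ≤ 16 * (Q * Q) * (A i j' * A i j')))
    ?_ ?_ le_rfl ?_
  · simp [Cmd.run]
  · intro j hj s₂ hA₂ hj₂ hI₂
    have h10₂ : s₂.nvar 10 = i := by
      rw [hA₂.nvar 10 (by decide)]; simpa [Cmd.run] using hi₁
    have h12₂ : s₂.nvar 12 = n + 1 := (hA₂.nvar 12 (by decide)).trans h12₁
    have h8₂ : s₂.nvar 8 = m := by
      rw [hA₂.nvar 8 (by decide)]; simp [Cmd.run, hA₁.nvar 8 (by decide), h8]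
    have h6₂ : s₂.nvar 6 = Q := by
      rw [hA₂.nvar 6 (by decide)]; simp [Cmd.run, hA₁.nvar 6 (by decide), h6]
    have hr₂ : s₂.rarr 1 (i * (n + 1) + j) = A i j := by
      rw [hA₂.rarr 1 (by decide), ← hA i hi j hj]; simp [Cmd.run, hA₁.rarr 1 (by decide)]
    have hcond : (BExp.and (.not (.and (.nle (.var 10) (.var 11)) (.nle (.var 11) (.var 10))))
        (.rle (.ofNat (9 * (.var 8 * .var 8))) (.ofNat (16 * (.var 6 * .var 6)) *
          (.arr 1 (.var 10 * .var 12 + .var 11) * .arr 1 (.var 10 * .var 12 + .var 11))))).Holds s₂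
        ↔ j ≠ i ∧ (9 * (m * m) : ℝ) ≤ 16 * (Q * Q) * (A i j * A i j) := by
      simp only [BExp.holds_and, BExp.holds_not, BExp.holds_nle, BExp.holds_rle, NExp.eval_var,
        RExp.eval_nat, RExp.eval_mul, RExp.eval_arr, NExp.eval_mul, NExp.eval_add,
        NExp.eval_ofNat, h10₂, h12₂, h8₂, h6₂, hj₂, hr₂]
      push_cast
      refine and_congr_left fun _ => ?_
      omega
    refine Reach.straight rfl (by decide) ?_
    by_cases hc : j ≠ i ∧ (9 * (m * m) : ℝ) ≤ 16 * (Q * Q) * (A i j * A i j)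
    · simp only [Cmd.run, if_pos (hcond.mpr hc)]
      exact Or.inl ⟨by simp, j, Nat.lt_succ_self j, hc⟩
    · simp only [Cmd.run, if_neg (fun h => hc (hcond.mp h))]
      rcases hI₂ with ⟨h13, j', hj', h'⟩ | ⟨h13, h'⟩
      · exact Or.inl ⟨by simpa using h13, j', by omega, h'⟩
      · refine Or.inr ⟨by simpa using h13, ?_⟩
        rintro ⟨j', hj', h''⟩
        rcases Nat.lt_succ_iff_lt_or_eq.mp hj' with h | rfl
        · exact h' ⟨j', h, h''⟩
        · exact hc h''
  · intro s₂ hA₂ hI₂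
    have h10₂ : s₂.nvar 10 = i := by
      rw [hA₂.nvar 10 (by decide)]; simpa [Cmd.run] using hi₁
    have h14₂ : s₂.nvar 14 = (relevantList A n m Q cap i).length := by
      rw [hA₂.nvar 14 (by decide)]; simpa [Cmd.run] using hL₁
    have h7₂ : s₂.nvar 7 = cap := by
      rw [hA₂.nvar 7 (by decide)]; simp [Cmd.run, hA₁.nvar 7 (by decide), h7]
    have h2₂ : s₂.narr 2 = s₁.narr 2 := by
      rw [hA₂.narr 2 (by decide)]; simp [Cmd.run]
    have h13₂ : 1 ≤ s₂.nvar 13 ↔ Relevant A n m Q i := by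
      rcases hI₂ with ⟨h, h'⟩ | ⟨h, h'⟩
      · simp only [h, le_refl, true_iff]; exact h'
      · exact iff_of_false (by omega) h'
    have hcond : (BExp.and (.nle 1 (.var 13)) (.nle (.var 14 + 1) (.var 7))).Holds s₂ ↔
        Relevant A n m Q i ∧ (relevantList A n m Q cap i).length + 1 ≤ cap := by
      rw [← h13₂]
      simp [h14₂, h7₂]
    refine Reach.straight rfl (by decide) ?_
    by_cases hc : Relevant A n m Q i ∧ (relevantList A n m Q cap i).length + 1 ≤ cap
    · simp only [Cmd.run, if_pos (hcond.mpr hc)]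
      rw [relevantList_succ_of_relevant hc.1 hc.2]
      refine ⟨by simp [h14₂], fun a ha => ?_⟩
      simp only [List.length_append, List.length_singleton] at ha
      simp only [State.setN_narr, State.putN_narr, if_true, NExp.eval_var, h14₂, h10₂, h2₂]
      split_ifs with h
      · subst h; simp
      · rw [hl₁ a (by omega), List.getD_append _ _ _ _ (by omega)]
    · simp only [Cmd.run, if_neg (fun h => hc (hcond.mp h))]
      rw [relevantList_succ_of_not hc]
      refine ⟨by simpa using h14₂, fun a ha => ?_⟩
      rw [State.setN_narr, h2₂, hl₁ a ha]

/-! ### Powers and digits -/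

/-- The scalar `v` becomes the power of `base` whose exponent is the value of the scalar `w`. -/
def powStage (v w : ℕ) (base : NExp) : Cmd :=
  .seq (.setN v 1) (.forTo 10 w (.setN v (.var v * base)))

/-- The base may refer to the scalar `14`, which the program does not change. -/
theorem reach_powStage {s : State} {v w N b : ℕ} {base : NExp} (hw : s.nvar w = N) (hv : v ≠ 10)
    (hwv : w ≠ v) (hw10 : w ≠ 10) (hc : base.cost = 1)
    (hb : ∀ s' : State, s'.nvar 14 = s.nvar 14 → base.eval s' = b) (h14 : v ≠ 14) :
    Reach f ω (powStage v w base) s (2 + (N * (4 + 9) + 7)) fun s' => s'.nvar v = b ^ N := by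
  refine Reach.seq_straight rfl le_rfl ?_
  refine Reach.forTo (N := N) (by simpa [Cmd.run, hwv] using hw) hw10
    (by simpa [Cmd.wN] using hv.symm) (by simpa [Cmd.wN] using hwv)
    (fun i s' => s'.nvar v = b ^ i) ?_ ?_ le_rfl fun s' _ h => h
  · simp [Cmd.run, hv]
  · intro i hi s₁ hA₁ hi₁ hI₁
    refine Reach.straight rfl (by simp [Cmd.maxCost, hc]) ?_
    have : s₁.nvar 14 = s.nvar 14 := by
      rw [hA₁.nvar 14 (by simp [Cmd.wN, h14.symm])]; simp [Cmd.run, h14.symm]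
    simp [Cmd.run, hv, hI₁, hb s₁ this, pow_succ]

/-- The cells of the array `a` become the digits in the given base of the numbers below the value
of the scalar `w`. In the absence of an integer division, the inner loop divides by repeated
subtraction. -/
def digitStage (a w : ℕ) (base : NExp) : Cmd :=
  .forTo 19 w (.seq (.setN 22 (.var 19)) (.forTo 10 15
    (.seq (.setN 23 0)
    (.seq (.while (.nle base (.var 22)) (.seq (.setN 22 (.var 22 - base))
      (.setN 23 (.var 23 + 1))))
    (.seq (.putN a (.var 19 * .var 15 + .var 10) (.var 22))
      (.setN 22 (.var 23)))))))

theorem reach_digitStage {s : State} {a w N b k : ℕ} {base : NExp} (hw : s.nvar w = N)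
    (hww : w = 16 ∨ w = 17) (h15 : s.nvar 15 = k) (hc : base.cost = 1)
    (hb : ∀ s' : State, s'.nvar 14 = s.nvar 14 → base.eval s' = b) (hb0 : k ≠ 0 → 0 < b) :
    Reach f ω (digitStage a w base) s (N * ((2 + (k * ((N * 12 + 15) + 9) + 7)) + 9) + 7)
      fun s' => ∀ c < N, ∀ j < k, s'.narr a (c * k + j) = c / b ^ j % b := by
  refine Reach.forTo hw (by rcases hww with rfl | rfl <;> decide)
    (by simp [Cmd.wN, Cmd.forTo]) (by rcases hww with rfl | rfl <;> simp [Cmd.wN, Cmd.forTo])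
    (fun c s' => ∀ c' < c, ∀ j < k, s'.narr a (c' * k + j) = c' / b ^ j % b) ?_ ?_ le_rfl
    fun s' _ h => h
  · intro c' hc'; exact absurd hc' (Nat.not_lt_zero _)
  intro c hcN s₁ hA₁ hc₁ hI₁
  refine Reach.seq_straight rfl (by decide) ?_
  have h15₁ : ((Cmd.setN 22 (.var 19)).run s₁).nvar 15 = k := by
    simp [Cmd.run, hA₁.nvar 15 (by simp [Cmd.wN, Cmd.forTo]), h15]
  refine Reach.forTo (B := N * 12 + 15) h15₁ (by decide) (by simp [Cmd.wN]) (by simp [Cmd.wN])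
    (fun j s' => s'.nvar 22 = c / b ^ j ∧ ∀ c' ≤ c, ∀ j' < k, (c' < c ∨ j' < j) →
      s'.narr a (c' * k + j') = c' / b ^ j' % b) ?_ ?_ le_rfl ?_
  · refine ⟨by simp [Cmd.run, hc₁], fun c' _ j' hj' h => ?_⟩
    simpa [Cmd.run] using hI₁ c' (h.resolve_right (Nat.not_lt_zero _)) j' hj'
  · rintro j hj s₂ hA₂ hj₂ ⟨h22₂, hI₂⟩
    have hb0' := hb0 (by omega)
    have h19₂ : s₂.nvar 19 = c := by
      rw [hA₂.nvar 19 (by simp [Cmd.wN])]; simpa [Cmd.run] using hc₁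
    have h15₂ : s₂.nvar 15 = k := (hA₂.nvar 15 (by simp [Cmd.wN])).trans h15₁
    have h14₂ : s₂.nvar 14 = s.nvar 14 := by
      rw [hA₂.nvar 14 (by simp [Cmd.wN])]
      simp [Cmd.run, hA₁.nvar 14 (by simp [Cmd.wN, Cmd.forTo])]
    refine (Reach.seq_straight (B₁ := 2) (B₂ := (N * 12 + 4) + (7 + 2)) rfl (by decide) ?_).mono
      (by omega) fun _ h => h
    set r := c / b ^ j with hr
    refine Reach.seq ?_
    refine (Reach.whileLoop (N := r / b) (B := 8)
      (fun i s' => s'.nvar 22 = r - i * b ∧ s'.nvar 23 = i) ?_ ?_ ?_).frame.mono ?_ ?_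
    · simp [Cmd.run, h22₂]
    · rintro i hi s₃ hA₃ ⟨h22₃, h23₃⟩
      have hb₃ : base.eval s₃ = b := hb s₃ (by
        rw [hA₃.nvar 14 (by simp [Cmd.wN])]; simpa [Cmd.run] using h14₂)
      have hle : (i + 1) * b ≤ r := (Nat.le_div_iff_mul_le hb0').mp hi
      rw [Nat.add_mul, Nat.one_mul] at hle
      refine ⟨by simp [hb₃, h22₃]; omega, ?_⟩
      refine Reach.straight rfl (by simp [Cmd.maxCost, hc]) ?_
      constructor
      · simp [Cmd.run, hb₃, h22₃, Nat.add_mul]; omega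
      · simp [Cmd.run, h23₃]
    · rintro s₃ hA₃ ⟨h22₃, -⟩
      have hb₃ : base.eval s₃ = b := hb s₃ (by
        rw [hA₃.nvar 14 (by simp [Cmd.wN])]; simpa [Cmd.run] using h14₂)
      have hmod : r - r / b * b = r % b := by
        have := Nat.div_add_mod' r b; omega
      simp only [BExp.holds_nle, NExp.eval_var, hb₃, h22₃, hmod, not_le]
      exact Nat.mod_lt _ hb0'
    · simp only [BExp.cost, NExp.cost, hc]
      have : r / b ≤ N := (Nat.div_le_self _ _).trans ((Nat.div_le_self _ _).trans hcN.le)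
      omega
    · rintro s₃ ⟨⟨h22₃, h23₃⟩, hA₃⟩
      have h19₃ : s₃.nvar 19 = c := by
        rw [hA₃.nvar 19 (by simp [Cmd.wN])]; simpa [Cmd.run] using h19₂
      have h15₃ : s₃.nvar 15 = k := by
        rw [hA₃.nvar 15 (by simp [Cmd.wN])]; simpa [Cmd.run] using h15₂
      have h10₃ : s₃.nvar 10 = j := by
        rw [hA₃.nvar 10 (by simp [Cmd.wN])]; simpa [Cmd.run] using hj₂
      have ha₃ : s₃.narr a = s₂.narr a := by
        rw [hA₃.narr a (by simp [Cmd.wNA])]; simp [Cmd.run]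
      have hmod : r - r / b * b = r % b := by
        have := Nat.div_add_mod' r b; omega
      refine Reach.straight rfl le_rfl ?_
      refine ⟨by simp [Cmd.run, h23₃, hr, pow_succ, Nat.div_div_eq_div_mul], ?_⟩
      intro c' hc' j' hj' h
      simp only [Cmd.run, State.setN_narr, State.putN_narr, if_true, NExp.eval_add, NExp.eval_mul,
        NExp.eval_var, h19₃, h15₃, h10₃, h22₃, hmod, pair_index_inj hj hj', ha₃]
      split_ifs with he
      · rw [he.1, he.2]
      · exact hI₂ c' hc' j' hj' (by omega)
  · rintro s₂ - ⟨-, hI₂⟩ c' hc' j hj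
    rw [State.setN_narr]
    exact hI₂ c' (by omega) j hj (Or.inr hj)

end RealRAM

namespace RealRAM

open Finset CubeFn

variable {n : ℕ} {f : Cube n → ℝ} {ω : ℕ → Cube n}

/-! ### Conditional averages of the candidates -/

/-- The bit of `x` at a natural-number index. -/
def bit (x : Cube n) (v : ℕ) : ℕ := if h : v < n then (x ⟨v, h⟩).toNat else 0

theorem bit_le_one (x : Cube n) (v : ℕ) : bit x v ≤ 1 := by
  unfold bit; split_ifs
  · exact Bool.toNat_le _
  · exact Nat.zero_le _

theorem sum_two_pow_mul_lt (k : ℕ) {b : ℕ → ℕ} (hb : ∀ j, b j ≤ 1) :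
    ∑ j ∈ range k, 2 ^ j * b j < 2 ^ k := by
  induction k with
  | zero => simp
  | succ k ih =>
    rw [sum_range_succ, pow_succ]
    have := Nat.mul_le_mul_left (2 ^ k) (hb k)
    omega

/-- The number whose binary digits are the bits of `x` at `V 0, …, V (k - 1)`. -/
def maskOf (k : ℕ) (V : ℕ → ℕ) (x : Cube n) : ℕ := ∑ j ∈ range k, 2 ^ j * bit x (V j)

theorem maskOf_lt (k : ℕ) (V : ℕ → ℕ) (x : Cube n) : maskOf k V x < 2 ^ k :=
  sum_two_pow_mul_lt k fun _ => bit_le_one _ _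

/-- Compute the position of the current example in the table of the candidate in the scalar `19`. -/
def maskStage : Cmd :=
  .seq (.setN 20 0) (.seq (.setN 21 1) (.forTo 10 15
    (.seq (.setN 20 (.var 20 + .var 21 * .arr 1 (.arr 2 (.arr 3 (.var 19 * .var 15 + .var 10)))))
      (.setN 21 (.var 21 * 2)))))

theorem reach_maskStage {s : State} {k c : ℕ} {V : ℕ → ℕ} {x : Cube n} (h15 : s.nvar 15 = k)
    (h19 : s.nvar 19 = c)
    (hb : ∀ j < k, s.narr 1 (s.narr 2 (s.narr 3 (c * k + j))) = bit x (V j)) :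
    Reach f ω maskStage s (2 + (2 + (k * (22 + 9) + 7))) fun s' =>
      s'.nvar 20 = maskOf k V x := by
  refine Reach.seq_straight rfl (by decide) (Reach.seq_straight rfl (by decide) ?_)
  refine Reach.forTo (N := k) (by simpa [Cmd.run] using h15) (by decide) (by decide) (by decide)
    (fun j s' => s'.nvar 21 = 2 ^ j ∧ s'.nvar 20 = ∑ j ∈ range j, 2 ^ j * bit x (V j))
    ?_ ?_ le_rfl fun s' _ h => h.2
  · simp [Cmd.run]
  · rintro j hj s₁ hA₁ hj₁ ⟨h21, h20⟩
    have h15₁ : s₁.nvar 15 = k := by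
      rw [hA₁.nvar 15 (by decide)]; simpa [Cmd.run] using h15
    have h19₁ : s₁.nvar 19 = c := by
      rw [hA₁.nvar 19 (by decide)]; simpa [Cmd.run] using h19
    have e : ∀ a, s₁.narr a = s.narr a := fun a => by
      rw [hA₁.narr a (by simp [Cmd.wNA])]; simp [Cmd.run]
    refine Reach.straight rfl (by decide) ?_
    simp [Cmd.run, h21, h20, h19₁, h15₁, hj₁, e, hb j hj, sum_range_succ, pow_succ]

/-- For every candidate, add the labels of the next examples to its table. -/
def sumStage : Cmd :=
  .forTo 9 18 (.seq (.draw 1 1) (.forTo 19 17 (.seq maskStage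
    (.putR 2 (.var 19 * .var 16 + .var 20) (.arr 2 (.var 19 * .var 16 + .var 20) + .var 1)))))

theorem reach_sumStage {s : State} {M W k d : ℕ} {V : ℕ → ℕ → ℕ} (h18 : s.nvar 18 = M)
    (h17 : s.nvar 17 = W) (h16 : s.nvar 16 = 2 ^ k) (h15 : s.nvar 15 = k) (hd : s.drawn = d)
    (hV : ∀ c < W, ∀ j < k, s.narr 2 (s.narr 3 (c * k + j)) = V c j ∧ V c j < n)
    (hz : ∀ i, s.rarr 2 i = 0) :
    Reach f ω sumStage s
      (M * ((n + 1 + (W * (((2 + (2 + (k * (22 + 9) + 7))) + 30) + 9) + 7)) + 9) + 7) fun s' =>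
      s'.drawn = d + M ∧ ∀ c < W, ∀ y < 2 ^ k, s'.rarr 2 (c * 2 ^ k + y) =
        ∑ t ∈ range M, if maskOf k (V c) (ω (d + t)) = y then f (ω (d + t)) else 0 := by
  refine Reach.forTo h18 (by decide) (by decide) (by decide) (fun T s' => s'.drawn = d + T ∧
    ∀ c < W, ∀ y < 2 ^ k, s'.rarr 2 (c * 2 ^ k + y) =
        ∑ t ∈ range T, if maskOf k (V c) (ω (d + t)) = y then f (ω (d + t)) else 0)
    ?_ ?_ le_rfl fun s' _ h => h
  · simp [hd, hz]
  rintro T hT s₁ hA₁ - ⟨hd₁, hI₁⟩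
  refine Reach.seq_draw ?_
  rw [hd₁]
  set x := ω (d + T) with hx
  set s₂ := s₁.receive 1 1 x (f x) with hs₂
  have h17₂ : s₂.nvar 17 = W := (hA₁.nvar 17 (by decide)).trans h17
  have h16₂ : s₂.nvar 16 = 2 ^ k := (hA₁.nvar 16 (by decide)).trans h16
  have h15₂ : s₂.nvar 15 = k := (hA₁.nvar 15 (by decide)).trans h15
  have hn2₂ : s₂.narr 2 = s.narr 2 := by
    rw [← hA₁.narr 2 (by decide)]; funext i; simp [hs₂]
  have hn3₂ : s₂.narr 3 = s.narr 3 := by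
    rw [← hA₁.narr 3 (by decide)]; funext i; simp [hs₂]
  refine Reach.forTo (N := W) h17₂ (by decide) (by decide) (by decide)
    (fun c s' => ∀ c' < W, ∀ y < 2 ^ k, s'.rarr 2 (c' * 2 ^ k + y) =
      (∑ t ∈ range T, if maskOf k (V c') (ω (d + t)) = y then f (ω (d + t)) else 0) +
        if c' < c then (if maskOf k (V c') x = y then f x else 0) else 0) ?_ ?_ le_rfl ?_
  · intro c' hc' y hy
    simpa [hs₂] using hI₁ c' hc' y hy
  · intro c hc s₃ hA₃ hc₃ hI₃
    have h15₃ : s₃.nvar 15 = k := (hA₃.nvar 15 (by decide)).trans h15₂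
    have hb₃ : ∀ j < k, s₃.narr 1 (s₃.narr 2 (s₃.narr 3 (c * k + j))) = bit x (V c j) := by
      intro j hj
      rw [hA₃.narr 2 (by decide), hA₃.narr 3 (by decide), hA₃.narr 1 (by decide), hn2₂, hn3₂,
        (hV c hc j hj).1]
      simp [hs₂, bit, (hV c hc j hj).2]
    refine Reach.seq ((reach_maskStage h15₃ hc₃ hb₃).frame.mono le_rfl ?_)
    rintro s₄ ⟨h20₄, hA₄⟩
    have h19₄ : s₄.nvar 19 = c := (hA₄.nvar 19 (by decide)).trans hc₃
    have h16₄ : s₄.nvar 16 = 2 ^ k := by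
      rw [hA₄.nvar 16 (by decide), hA₃.nvar 16 (by decide), h16₂]
    have hy₄ : s₄.rvar 1 = f x := by
      rw [hA₄.rvar 1 (by decide), hA₃.rvar 1 (by decide)]; simp [hs₂]
    have hr₄ : s₄.rarr 2 = s₃.rarr 2 := hA₄.rarr 2 (by decide)
    refine Reach.straight rfl (by decide) ?_
    intro c' hc' y hy
    simp only [Cmd.run, State.setN_rarr, State.putR_rarr, if_true, NExp.eval_add, NExp.eval_mul,
      NExp.eval_var, RExp.eval_add, RExp.eval_var, RExp.eval_arr, h19₄, h16₄, h20₄, hy₄, hr₄,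
      pair_index_inj (maskOf_lt k (V c) x) hy]
    rw [hI₃ c' hc' y hy]
    by_cases h1 : c' = c
    · subst h1
      by_cases h2 : y = maskOf k (V c') x
      · subst h2
        simp [hI₃ c' hc' _ (maskOf_lt k (V c') x)]
      · simp [h2, Ne.symm h2]
    · rw [if_neg (fun h => h1 h.1)]
      congr 1
      refine if_congr ?_ rfl rfl
      omega
  · intro s₃ hA₃ hI₃
    refine ⟨?_, fun c hc y hy => ?_⟩
    · rw [State.setN_drawn, hA₃.drawn (by decide), hs₂, State.receive_drawn, hd₁]; omega
    · rw [State.setN_rarr, hI₃ c hc y hy, if_pos hc, sum_range_succ]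

/-- For every candidate, add up the absolute errors of its table on the next examples. -/
def errStage : Cmd :=
  .forTo 9 18 (.seq (.draw 1 1) (.forTo 19 17 (.seq maskStage
    (.seq (.setR 2 (.var 1 - .ofNat (.var 16) * .arr 2 (.var 19 * .var 16 + .var 20) /
      .ofNat (.var 18)))
    (.ite (.rle 0 (.var 2)) (.putR 3 (.var 19) (.arr 3 (.var 19) + .var 2))
      (.putR 3 (.var 19) (.arr 3 (.var 19) - .var 2)))))))

theorem reach_errStage {s : State} {M W k d : ℕ} {V : ℕ → ℕ → ℕ} {A : ℕ → ℕ → ℝ}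
    (h18 : s.nvar 18 = M)
    (h17 : s.nvar 17 = W) (h16 : s.nvar 16 = 2 ^ k) (h15 : s.nvar 15 = k) (hd : s.drawn = d)
    (hV : ∀ c < W, ∀ j < k, s.narr 2 (s.narr 3 (c * k + j)) = V c j ∧ V c j < n)
    (hA : ∀ c < W, ∀ y < 2 ^ k, s.rarr 2 (c * 2 ^ k + y) = A c y)
    (hz : ∀ i, s.rarr 3 i = 0) :
    Reach f ω errStage s
      (M * ((n + 1 + (W * (((2 + (2 + (k * (22 + 9) + 7))) + 40) + 9) + 7)) + 9) + 7) fun s' =>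
      s'.drawn = d + M ∧ ∀ c < W, s'.rarr 3 c =
        ∑ t ∈ range M, |f (ω (d + t)) - 2 ^ k * A c (maskOf k (V c) (ω (d + t))) / M| := by
  refine Reach.forTo h18 (by decide) (by decide) (by decide) (fun T s' => s'.drawn = d + T ∧
    ∀ c < W, s'.rarr 3 c =
        ∑ t ∈ range T, |f (ω (d + t)) - 2 ^ k * A c (maskOf k (V c) (ω (d + t))) / M|)
    ?_ ?_ le_rfl fun s' _ h => h
  · simp [hd, hz]
  rintro T hT s₁ hA₁ - ⟨hd₁, hI₁⟩
  refine Reach.seq_draw ?_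
  rw [hd₁]
  set x := ω (d + T) with hx
  set s₂ := s₁.receive 1 1 x (f x) with hs₂
  have h18₂ : s₂.nvar 18 = M := (hA₁.nvar 18 (by decide)).trans h18
  have h17₂ : s₂.nvar 17 = W := (hA₁.nvar 17 (by decide)).trans h17
  have h16₂ : s₂.nvar 16 = 2 ^ k := (hA₁.nvar 16 (by decide)).trans h16
  have h15₂ : s₂.nvar 15 = k := (hA₁.nvar 15 (by decide)).trans h15
  have hn2₂ : s₂.narr 2 = s.narr 2 := by
    rw [← hA₁.narr 2 (by decide)]; funext i; simp [hs₂]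
  have hn3₂ : s₂.narr 3 = s.narr 3 := by
    rw [← hA₁.narr 3 (by decide)]; funext i; simp [hs₂]
  have hr2₂ : s₂.rarr 2 = s.rarr 2 := hA₁.rarr 2 (by decide)
  refine Reach.forTo (N := W) h17₂ (by decide) (by decide) (by decide)
    (fun c s' => ∀ c' < W, s'.rarr 3 c' =
      (∑ t ∈ range T, |f (ω (d + t)) - 2 ^ k * A c' (maskOf k (V c') (ω (d + t))) / M|) +
        if c' < c then |f x - 2 ^ k * A c' (maskOf k (V c') x) / M| else 0) ?_ ?_ le_rfl ?_
  · intro c' hc'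
    simpa [hs₂] using hI₁ c' hc'
  · intro c hc s₃ hA₃ hc₃ hI₃
    have h15₃ : s₃.nvar 15 = k := (hA₃.nvar 15 (by decide)).trans h15₂
    have hb₃ : ∀ j < k, s₃.narr 1 (s₃.narr 2 (s₃.narr 3 (c * k + j))) = bit x (V c j) := by
      intro j hj
      rw [hA₃.narr 2 (by decide), hA₃.narr 3 (by decide), hA₃.narr 1 (by decide), hn2₂, hn3₂,
        (hV c hc j hj).1]
      simp [hs₂, bit, (hV c hc j hj).2]
    refine Reach.seq ((reach_maskStage h15₃ hc₃ hb₃).frame.mono le_rfl ?_)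
    rintro s₄ ⟨h20₄, hA₄⟩
    have h19₄ : s₄.nvar 19 = c := (hA₄.nvar 19 (by decide)).trans hc₃
    have h16₄ : s₄.nvar 16 = 2 ^ k := by
      rw [hA₄.nvar 16 (by decide), hA₃.nvar 16 (by decide), h16₂]
    have h18₄ : s₄.nvar 18 = M := by
      rw [hA₄.nvar 18 (by decide), hA₃.nvar 18 (by decide), h18₂]
    have hy₄ : s₄.rvar 1 = f x := by
      rw [hA₄.rvar 1 (by decide), hA₃.rvar 1 (by decide)]; simp [hs₂]
    have hr2₄ : s₄.rarr 2 (c * 2 ^ k + maskOf k (V c) x) = A c (maskOf k (V c) x) := by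
      rw [hA₄.rarr 2 (by decide), hA₃.rarr 2 (by decide), hr2₂, hA c hc _ (maskOf_lt _ _ _)]
    have hr3₄ : s₄.rarr 3 = s₃.rarr 3 := hA₄.rarr 3 (by decide)
    set dev := f x - 2 ^ k * A c (maskOf k (V c) x) / M with hdev
    have hval : (Cmd.setR 2 (.var 1 - .ofNat (.var 16) * .arr 2 (.var 19 * .var 16 + .var 20) /
      .ofNat (.var 18))).run s₄ = s₄.setR 2 dev := by
      simp [Cmd.run, h19₄, h16₄, h18₄, h20₄, hy₄, hr2₄, hdev]
    refine (Reach.seq_straight (B₁ := 15) (B₂ := 25) rfl (by decide) ?_).mono le_rfl fun _ h => h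
    rw [hval]
    refine Reach.straight rfl (by decide) ?_
    intro c' hc'
    have habs : (Cmd.run (.ite (.rle 0 (.var 2)) (.putR 3 (.var 19) (.arr 3 (.var 19) + .var 2))
        (.putR 3 (.var 19) (.arr 3 (.var 19) - .var 2))) (s₄.setR 2 dev)).rarr 3 c' =
        if c' = c then s₃.rarr 3 c + |dev| else s₃.rarr 3 c' := by
      simp only [Cmd.run]
      by_cases h : 0 ≤ dev
      · rw [if_pos (by simpa using h)]
        simp [h19₄, hr3₄, abs_of_nonneg h]
      · rw [if_neg (by simpa using h)]
        simp [h19₄, hr3₄, abs_of_neg (not_le.mp h), sub_eq_add_neg]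
    rw [State.setN_rarr, habs, hI₃ c' hc', hI₃ c hc]
    by_cases h1 : c' = c
    · subst h1; simp [hdev]
    · rw [if_neg h1]
      congr 1
      refine if_congr ?_ rfl rfl
      omega
  · intro s₃ hA₃ hI₃
    refine ⟨?_, fun c hc => ?_⟩
    · rw [State.setN_drawn, hA₃.drawn (by decide), hs₂, State.receive_drawn, hd₁]; omega
    · rw [State.setN_rarr, hI₃ c hc, if_pos hc, sum_range_succ]

/-! ### The best candidate -/

/-- Find the candidate with the smallest error among those with increasing digits. -/
def bestStage : Cmd :=
  .seq (.setN 24 0) (.seq (.setN 29 0) (.forTo 19 17 (.seq (.setN 25 1) (.seq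
    (.forTo 10 15 (.forTo 11 15 (.ite (.and (.nle (.var 10 + 1) (.var 11))
      (.nle (.arr 3 (.var 19 * .var 15 + .var 11)) (.arr 3 (.var 19 * .var 15 + .var 10))))
      (.setN 25 0) .skip)))
    (.ite (.and (.nle 1 (.var 25)) (.not (.and (.nle 1 (.var 29))
      (.rle (.var 3) (.arr 3 (.var 19))))))
      (.seq (.setN 24 (.var 19)) (.seq (.setN 29 1) (.setR 3 (.arr 3 (.var 19))))) .skip)))))

theorem reach_bestStage {s : State} {W k : ℕ} {D : ℕ → ℕ → ℕ} {E : ℕ → ℝ}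
    (h17 : s.nvar 17 = W) (h15 : s.nvar 15 = k)
    (hD : ∀ c < W, ∀ j < k, s.narr 3 (c * k + j) = D c j) (hE : ∀ c < W, s.rarr 3 c = E c)
    (hex : ∃ c < W, ∀ i < k, ∀ j < k, i < j → D c i < D c j) :
    Reach f ω bestStage s (2 + (2 + (W * ((2 + ((k * ((k * 49 + 7) + 9) + 7) + 40)) + 9) + 7)))
      fun s' => s'.nvar 24 < W ∧ (∀ i < k, ∀ j < k, i < j → D (s'.nvar 24) i < D (s'.nvar 24) j) ∧
        ∀ c < W, (∀ i < k, ∀ j < k, i < j → D c i < D c j) → E (s'.nvar 24) ≤ E c := by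
  -- the scalar `29` tells whether a candidate with increasing digits was met
  set valid : ℕ → Prop := fun c => ∀ i < k, ∀ j < k, i < j → D c i < D c j with hvalid
  refine Reach.seq_straight rfl (by decide) (Reach.seq_straight rfl (by decide) ?_)
  refine Reach.forTo (N := W) (by simpa [Cmd.run] using h17) (by decide) (by decide) (by decide)
    (fun c s' => (s'.nvar 29 = 0 ∧ ∀ c' < c, ¬ valid c') ∨ (s'.nvar 29 = 1 ∧ s'.nvar 24 < c ∧
      valid (s'.nvar 24) ∧ s'.rvar 3 = E (s'.nvar 24) ∧
      ∀ c' < c, valid c' → E (s'.nvar 24) ≤ E c')) ?_ ?_ le_rfl ?_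
  · exact Or.inl ⟨by simp [Cmd.run], fun c' hc' => absurd hc' (Nat.not_lt_zero _)⟩
  · intro c hc s₁ hA₁ hc₁ hI₁
    refine Reach.seq_straight rfl (by decide) (Reach.seq ?_)
    have h15₁ : s₁.nvar 15 = k := by
      rw [hA₁.nvar 15 (by decide)]; simpa [Cmd.run] using h15
    have hD₁ : ∀ j < k, s₁.narr 3 (c * k + j) = D c j := fun j hj => by
      rw [hA₁.narr 3 (by decide), ← hD c hc j hj]; simp [Cmd.run]
    have hE₁ : s₁.rarr 3 c = E c := by
      rw [hA₁.rarr 3 (by decide), ← hE c hc]; simp [Cmd.run]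
    refine Reach.forTo (N := k) (B := k * 49 + 7) (by simpa [Cmd.run] using h15₁) (by decide)
      (by decide) (by decide)
      (fun i s' => 1 ≤ s'.nvar 25 ↔ ∀ i' < i, ∀ j' < k, i' < j' → D c i' < D c j') ?_ ?_ le_rfl ?_
    · simp [Cmd.run]
    · intro i hi s₂ hA₂ hi₂ hI₂
      have h15₂ : s₂.nvar 15 = k := by
        rw [hA₂.nvar 15 (by decide)]; simpa [Cmd.run] using h15₁
      refine Reach.forTo (N := k) (B := 40) h15₂ (by decide) (by decide) (by decide)
        (fun j s' => 1 ≤ s'.nvar 25 ↔ (∀ i' < i, ∀ j' < k, i' < j' → D c i' < D c j') ∧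
          ∀ j' < j, i < j' → D c i < D c j') ?_ ?_ le_rfl ?_
      · simpa using hI₂
      · intro j hj s₃ hA₃ hj₃ hI₃
        have h15₃ : s₃.nvar 15 = k := (hA₃.nvar 15 (by decide)).trans h15₂
        have h10₃ : s₃.nvar 10 = i := (hA₃.nvar 10 (by decide)).trans hi₂
        have h19₃ : s₃.nvar 19 = c := by
          rw [hA₃.nvar 19 (by decide), hA₂.nvar 19 (by decide)]; simpa [Cmd.run] using hc₁
        have e3 : s₃.narr 3 = s₁.narr 3 := by
          rw [hA₃.narr 3 (by decide), hA₂.narr 3 (by decide)]; simp [Cmd.run]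
        have hsucc : (∀ j' < j + 1, i < j' → D c i < D c j') ↔
            (∀ j' < j, i < j' → D c i < D c j') ∧ (i < j → D c i < D c j) := by
          simp only [Nat.lt_succ_iff_lt_or_eq, or_imp, forall_and, forall_eq]
        refine Reach.straight rfl (by decide) ?_
        by_cases hcond : i + 1 ≤ j ∧ D c j ≤ D c i
        · simp only [Cmd.run, BExp.holds_and, BExp.holds_nle, NExp.eval_add, NExp.eval_var,
            NExp.eval_arr, NExp.eval_mul, NExp.eval_ofNat, h10₃, h15₃, h19₃, hj₃, e3, hD₁ j hj,
            hD₁ i hi, if_pos hcond, hsucc]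
          refine iff_of_false (by simp) ?_
          rintro ⟨-, -, h⟩
          have := h hcond.1
          omega
        · simp only [Cmd.run, BExp.holds_and, BExp.holds_nle, NExp.eval_add, NExp.eval_var,
            NExp.eval_arr, NExp.eval_mul, NExp.eval_ofNat, h10₃, h15₃, h19₃, hj₃, e3, hD₁ j hj,
            hD₁ i hi, if_neg hcond, hsucc]
          have h : i < j → D c i < D c j := fun h => by
            by_contra hlt
            exact hcond ⟨h, not_lt.mp hlt⟩
          rw [and_iff_left h]
          simpa using hI₃
      · intro s₃ _ hI₃
        rw [State.setN_nvar, if_neg (by decide), hI₃]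
        simp only [Nat.lt_succ_iff_lt_or_eq, or_imp, forall_and, forall_eq]
    · intro s₂ hA₂ hI₂
      have h19₂ : s₂.nvar 19 = c := by
        rw [hA₂.nvar 19 (by decide)]; simpa [Cmd.run] using hc₁
      have h29₂ : s₂.nvar 29 = s₁.nvar 29 := by
        rw [hA₂.nvar 29 (by decide)]; simp [Cmd.run]
      have h24₂ : s₂.nvar 24 = s₁.nvar 24 := by
        rw [hA₂.nvar 24 (by decide)]; simp [Cmd.run]
      have h3₂ : s₂.rvar 3 = s₁.rvar 3 := by
        rw [hA₂.rvar 3 (by decide)]; simp [Cmd.run]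
      have hE₂ : s₂.rarr 3 c = E c := by
        rw [hA₂.rarr 3 (by decide), ← hE₁]; simp [Cmd.run]
      have hcond : (BExp.and (.nle 1 (.var 25)) (.not (.and (.nle 1 (.var 29))
          (.rle (.var 3) (.arr 3 (.var 19)))))).Holds s₂ ↔
          valid c ∧ ¬ (1 ≤ s₁.nvar 29 ∧ s₁.rvar 3 ≤ E c) := by
        simp only [BExp.holds_and, BExp.holds_not, BExp.holds_nle, BExp.holds_rle, NExp.eval_var,
          NExp.eval_ofNat, RExp.eval_var, RExp.eval_arr, h19₂, h29₂, h3₂, hE₂, hI₂]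
        rfl
      refine Reach.straight rfl (by decide) ?_
      by_cases hc' : valid c ∧ ¬ (1 ≤ s₁.nvar 29 ∧ s₁.rvar 3 ≤ E c)
      · simp only [Cmd.run, if_pos (hcond.mpr hc')]
        refine Or.inr ⟨by simp, by simp [h19₂], by simpa [h19₂] using hc'.1, by simp [h19₂, hE₂],
          ?_⟩
        intro c' hlt hv
        simp only [State.setN_nvar, State.setR_nvar]
        simp only [NExp.eval_var, h19₂]
        norm_num
        rcases Nat.lt_succ_iff_lt_or_eq.mp hlt with h | rfl
        · rcases hI₁ with ⟨-, h1⟩ | ⟨h1, -, -, h3, h4⟩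
          · exact absurd hv (h1 c' h)
          · have h5 : ¬ s₁.rvar 3 ≤ E c := fun h6 => hc'.2 ⟨h1.ge, h6⟩
            have := h4 c' h hv
            linarith
        · exact le_rfl
      · simp only [Cmd.run, if_neg (fun h => hc' (hcond.mp h))]
        simp only [State.setN_nvar, State.setN_rvar, h29₂, h24₂, h3₂]
        norm_num
        rcases hI₁ with ⟨h1, h2⟩ | ⟨h1, h2, h3, h4, h5⟩
        · refine Or.inl ⟨h1, fun c' hlt => ?_⟩
          rcases Nat.lt_or_eq_of_le hlt with h | rfl
          · exact h2 c' h
          · exact fun hv => hc' ⟨hv, fun h => by omega⟩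
        · refine Or.inr ⟨h1, by omega, h3, h4, fun c' hlt hv => ?_⟩
          rcases Nat.lt_or_eq_of_le hlt with h | rfl
          · exact h5 c' h hv
          · rw [← h4]
            by_contra h6
            exact hc' ⟨hv, fun h => h6 h.2⟩
  · rintro s₁ - (⟨-, h⟩ | ⟨-, h1, h2, -, h3⟩)
    · obtain ⟨c, hc, hv⟩ := hex
      exact absurd hv (h c hc)
    · exact ⟨h1, h2, h3⟩

end RealRAM

namespace RealRAM

open Finset CubeFn

variable {n : ℕ} {f : Cube n → ℝ} {ω : ℕ → Cube n}

/-! ### The output table -/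

/-- List the coordinates of the candidate in the scalar `24`. -/
def listStage : Cmd :=
  .forTo 10 15 (.putN 0 (.var 10) (.arr 2 (.arr 3 (.var 24 * .var 15 + .var 10))))

theorem reach_listStage {s : State} {k : ℕ} (h15 : s.nvar 15 = k) :
    Reach f ω listStage s (k * (10 + 9) + 7) fun s' =>
      ∀ j < k, s'.narr 0 j = s.narr 2 (s.narr 3 (s.nvar 24 * k + j)) := by
  refine Reach.forTo h15 (by decide) (by decide) (by decide) (fun i s' =>
    ∀ j < i, s'.narr 0 j = s.narr 2 (s.narr 3 (s.nvar 24 * k + j))) ?_ ?_ le_rfl fun s' _ h => h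
  · intro j hj; exact absurd hj (Nat.not_lt_zero _)
  · intro i hi s₁ hA₁ hi₁ hI₁
    refine Reach.straight rfl (by decide) ?_
    intro j hj
    have h24 : s₁.nvar 24 = s.nvar 24 := hA₁.nvar 24 (by decide)
    have h15₁ : s₁.nvar 15 = k := (hA₁.nvar 15 (by decide)).trans h15
    have e2 : s₁.narr 2 = s.narr 2 := hA₁.narr 2 (by decide)
    have e3 : s₁.narr 3 = s.narr 3 := hA₁.narr 3 (by decide)
    simp only [Cmd.run, State.setN_narr, State.putN_narr, if_true, NExp.eval_var, NExp.eval_arr,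
      NExp.eval_add, NExp.eval_mul, hi₁, h24, h15₁, e2, e3]
    split_ifs with h
    · rw [h]
    · exact hI₁ j (by omega)

/-- The value of the output at a point with `d` bits set, where `v` estimates the conditional
average within `1 / N`: a multiple of `k² - d²` makes the function submodular, and the denominator
brings its values into the unit interval. -/
noncomputable def repaired (k N d : ℕ) (v : ℝ) : ℝ :=
  (N * v + (2 * (k * k - d * d) : ℕ)) / (N + 1 + 2 * (k * k) : ℕ)

/-- Fill the output table. -/
def tableStage : Cmd :=
  .forTo 19 16 (.seq (.setN 31 0) (.seq
    (.forTo 10 15 (.setN 31 (.var 31 + .arr 4 (.var 19 * .var 15 + .var 10))))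
    (.putR 0 (.var 19)
      ((.ofNat (.var 28) * (.ofNat (.var 16) * .arr 2 (.var 24 * .var 16 + .var 19) /
          .ofNat (.var 18)) + .ofNat (2 * (.var 5 * .var 5 - .var 31 * .var 31))) /
        .ofNat (.var 28 + 1 + 2 * (.var 5 * .var 5))))))

theorem reach_tableStage {s : State} {k k' N M c : ℕ} {β : ℕ → ℕ → ℕ} {A : ℕ → ℝ}
    (h16 : s.nvar 16 = 2 ^ k') (h15 : s.nvar 15 = k') (h5 : s.nvar 5 = k) (h28 : s.nvar 28 = N)
    (h18 : s.nvar 18 = M) (h24 : s.nvar 24 = c)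
    (hβ : ∀ y < 2 ^ k', ∀ j < k', s.narr 4 (y * k' + j) = β y j)
    (hA : ∀ y < 2 ^ k', s.rarr 2 (c * 2 ^ k' + y) = A y) :
    Reach f ω tableStage s (2 ^ k' * ((2 + ((k' * (10 + 9) + 7) + 50)) + 9) + 7) fun s' =>
      ∀ y < 2 ^ k', s'.rarr 0 y =
        repaired k N (∑ j ∈ range k', β y j) (2 ^ k' * A y / M) := by
  refine Reach.forTo h16 (by decide) (by decide) (by decide) (fun i s' =>
    ∀ y < i, s'.rarr 0 y = repaired k N (∑ j ∈ range k', β y j) (2 ^ k' * A y / M))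
    ?_ ?_ le_rfl fun s' _ h => h
  · intro j hj; exact absurd hj (Nat.not_lt_zero _)
  intro y hy s₁ hA₁ hy₁ hI₁
  refine Reach.seq_straight rfl (by decide) (Reach.seq ?_)
  have h15₁ : s₁.nvar 15 = k' := by rw [hA₁.nvar 15 (by decide), h15]
  refine Reach.forTo (N := k') (B := 10) (by simpa [Cmd.run] using h15₁) (by decide) (by decide)
    (by decide) (fun i s' => s'.nvar 31 = ∑ j ∈ range i, β y j) ?_ ?_ le_rfl ?_
  · simp [Cmd.run]
  · intro j hj s₂ hA₂ hj₂ hI₂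
    have h19₂ : s₂.nvar 19 = y := by
      rw [hA₂.nvar 19 (by decide)]; simpa [Cmd.run] using hy₁
    have h15₂ : s₂.nvar 15 = k' := by
      rw [hA₂.nvar 15 (by decide)]; simpa [Cmd.run] using h15₁
    have e4 : s₂.narr 4 (y * k' + j) = β y j := by
      rw [hA₂.narr 4 (by decide), ← hβ y hy j hj]; simp [Cmd.run, hA₁.narr 4 (by decide)]
    refine Reach.straight rfl (by decide) ?_
    simp [Cmd.run, h19₂, h15₂, hj₂, e4, hI₂, sum_range_succ]
  · intro s₂ hA₂ hI₂
    have e : ∀ v, v ≠ 31 → v ≠ 10 → s₂.nvar v = s₁.nvar v := fun v h1 h2 => by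
      rw [hA₂.nvar v (by simp [Cmd.wN, h1, h2])]; simp [Cmd.run, h1]
    have e' : ∀ v, v ≠ 31 → v ≠ 10 → v ≠ 19 → s₂.nvar v = s.nvar v := fun v h1 h2 h3 => by
      rw [e v h1 h2, hA₁.nvar v (by simp [Cmd.wN, Cmd.forTo, h1, h2, h3])]
    have h19₂ : s₂.nvar 19 = y := by rw [e 19 (by decide) (by decide), hy₁]
    have h5₂ : s₂.nvar 5 = k := by rw [e' 5 (by decide) (by decide) (by decide), h5]
    have h28₂ : s₂.nvar 28 = N := by rw [e' 28 (by decide) (by decide) (by decide), h28]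
    have h16₂ : s₂.nvar 16 = 2 ^ k' := by rw [e' 16 (by decide) (by decide) (by decide), h16]
    have h18₂ : s₂.nvar 18 = M := by rw [e' 18 (by decide) (by decide) (by decide), h18]
    have h24₂ : s₂.nvar 24 = c := by rw [e' 24 (by decide) (by decide) (by decide), h24]
    have hr2 : s₂.rarr 2 (c * 2 ^ k' + y) = A y := by
      rw [hA₂.rarr 2 (by decide), ← hA y hy]; simp [Cmd.run, hA₁.rarr 2 (by decide)]
    have hr0 : s₂.rarr 0 = s₁.rarr 0 := by
      rw [hA₂.rarr 0 (by decide)]; simp [Cmd.run]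
    refine Reach.straight rfl (by decide) ?_
    intro y' hy'
    simp only [Cmd.run, State.setN_rarr, State.putR_rarr, if_true, NExp.eval_var, h19₂, hr0]
    split_ifs with h
    · subst h
      simp only [RExp.eval_div, RExp.eval_add, RExp.eval_mul, RExp.eval_nat, RExp.eval_arr,
        NExp.eval_add, NExp.eval_mul, NExp.eval_sub, NExp.eval_var, NExp.eval_ofNat, h5₂, h28₂,
        h16₂, h18₂, h24₂, h19₂, hr2, hI₂, repaired]
      push_cast
      rfl
    · exact hI₁ y' (by omega)

/-- The table `H` on the numbers with `k` binary digits given by `β` is submodular with values in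
the unit interval. The digit of the union is `b + b' - b * b'` and that of the intersection is
`b * b'`. -/
def TableGood (k : ℕ) (β : ℕ → ℕ → ℕ) (H : ℕ → ℝ) : Prop :=
  ∀ x < 2 ^ k, ∀ y < 2 ^ k,
    H (∑ j ∈ range k, 2 ^ j * (β x j + β y j - β x j * β y j)) +
      H (∑ j ∈ range k, 2 ^ j * (β x j * β y j)) ≤ H x + H y ∧ 0 ≤ H x ∧ H x ≤ 1

/-- Replace the output table by zeros if it is not submodular with values in the unit interval. -/
def checkStage : Cmd :=
  .seq (.setN 25 0) (.seq
    (.forTo 19 16 (.forTo 26 16 (.seq (.setN 20 0) (.seq (.setN 27 0) (.seq (.setN 21 1) (.seq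
      (.forTo 10 15 (.seq
        (.setN 20 (.var 20 + .var 21 * (.arr 4 (.var 19 * .var 15 + .var 10) +
          .arr 4 (.var 26 * .var 15 + .var 10) - .arr 4 (.var 19 * .var 15 + .var 10) *
          .arr 4 (.var 26 * .var 15 + .var 10)))) (.seq
        (.setN 27 (.var 27 + .var 21 * (.arr 4 (.var 19 * .var 15 + .var 10) *
          .arr 4 (.var 26 * .var 15 + .var 10))))
        (.setN 21 (.var 21 * 2)))))
      (.ite (.and (.rle (.arr 0 (.var 20) + .arr 0 (.var 27)) (.arr 0 (.var 19) + .arr 0 (.var 26)))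
        (.and (.rle 0 (.arr 0 (.var 19))) (.rle (.arr 0 (.var 19)) 1))) .skip (.setN 25 1))))))))
    (.ite (.nle 1 (.var 25)) (.forTo 19 16 (.putR 0 (.var 19) 0)) .skip))

theorem reach_checkStage {s : State} {k : ℕ} {β : ℕ → ℕ → ℕ} {H : ℕ → ℝ}
    (h16 : s.nvar 16 = 2 ^ k) (h15 : s.nvar 15 = k)
    (hβ : ∀ y < 2 ^ k, ∀ j < k, s.narr 4 (y * k + j) = β y j) (hβ1 : ∀ y j, β y j ≤ 1)
    (hH : ∀ y < 2 ^ k, s.rarr 0 y = H y) :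
    Reach f ω checkStage s (2 + ((2 ^ k * ((2 ^ k *
      ((2 + (2 + (2 + ((k * (80 + 9) + 7) + 40)))) + 9) + 7) + 9) + 7) +
        (4 + (2 ^ k * (4 + 9) + 7)))) fun s' =>
      (TableGood k β H ∧ ∀ y < 2 ^ k, s'.rarr 0 y = H y) ∨
      (¬ TableGood k β H ∧ ∀ y < 2 ^ k, s'.rarr 0 y = 0) := by
  -- `P x y` is the condition on one pair of rows; the scalar `25` flags a violation
  set P : ℕ → ℕ → Prop := fun x y =>
    H (∑ j ∈ range k, 2 ^ j * (β x j + β y j - β x j * β y j)) +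
      H (∑ j ∈ range k, 2 ^ j * (β x j * β y j)) ≤ H x + H y ∧ 0 ≤ H x ∧ H x ≤ 1 with hP
  refine Reach.seq_straight rfl (by decide) (Reach.seq ?_)
  refine Reach.forTo (N := 2 ^ k) (by simpa [Cmd.run] using h16) (by decide) (by decide)
    (by decide) (fun i s' => s'.nvar 25 = 0 ↔ ∀ x < i, ∀ y < 2 ^ k, P x y) ?_ ?_ le_rfl ?_
  · simp [Cmd.run]
  · intro x hx s₁ hA₁ hx₁ hI₁
    have h16₁ : s₁.nvar 16 = 2 ^ k := by
      rw [hA₁.nvar 16 (by decide)]; simpa [Cmd.run] using h16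
    refine Reach.forTo (N := 2 ^ k) h16₁ (by decide) (by decide)
      (by decide) (fun i s' => s'.nvar 25 = 0 ↔
        (∀ x' < x, ∀ y < 2 ^ k, P x' y) ∧ ∀ y < i, P x y) ?_ ?_ le_rfl ?_
    · simpa using hI₁
    · intro y hy s₂ hA₂ hy₂ hI₂
      have h15₂ : s₂.nvar 15 = k := by
        rw [hA₂.nvar 15 (by decide), hA₁.nvar 15 (by decide)]; simpa [Cmd.run] using h15
      have h19₂ : s₂.nvar 19 = x := (hA₂.nvar 19 (by decide)).trans hx₁
      have e4₂ : s₂.narr 4 = s.narr 4 := by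
        rw [hA₂.narr 4 (by decide), hA₁.narr 4 (by decide)]; simp [Cmd.run]
      have e0₂ : s₂.rarr 0 = s.rarr 0 := by
        rw [hA₂.rarr 0 (by decide), hA₁.rarr 0 (by decide)]; simp [Cmd.run]
      refine Reach.seq_straight rfl (by decide) (Reach.seq_straight rfl (by decide)
        (Reach.seq_straight rfl (by decide) (Reach.seq ?_)))
      refine Reach.forTo (N := k) (B := 80) (by simpa [Cmd.run] using h15₂) (by decide) (by decide)
        (by decide) (fun j s' => s'.nvar 21 = 2 ^ j ∧
          s'.nvar 20 = ∑ j ∈ range j, 2 ^ j * (β x j + β y j - β x j * β y j) ∧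
          s'.nvar 27 = ∑ j ∈ range j, 2 ^ j * (β x j * β y j)) ?_ ?_ le_rfl ?_
      · simp [Cmd.run]
      · rintro j hj s₃ hA₃ hj₃ ⟨h21₃, h20₃, h27₃⟩
        have h19₃ : s₃.nvar 19 = x := by
          rw [hA₃.nvar 19 (by decide)]; simpa [Cmd.run] using h19₂
        have h26₃ : s₃.nvar 26 = y := by
          rw [hA₃.nvar 26 (by decide)]; simpa [Cmd.run] using hy₂
        have h15₃ : s₃.nvar 15 = k := by
          rw [hA₃.nvar 15 (by decide)]; simpa [Cmd.run] using h15₂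
        have e4₃ : s₃.narr 4 = s.narr 4 := by
          rw [hA₃.narr 4 (by decide)]; simpa [Cmd.run] using e4₂
        refine Reach.straight rfl (by decide) ?_
        simp [Cmd.run, h19₃, h26₃, h15₃, hj₃, e4₃, hβ x hx j hj, hβ y hy j hj, h21₃, h20₃, h27₃,
          sum_range_succ, pow_succ]
      · rintro s₃ hA₃ ⟨-, h20₃, h27₃⟩
        have h19₃ : s₃.nvar 19 = x := by
          rw [hA₃.nvar 19 (by decide)]; simpa [Cmd.run] using h19₂
        have h26₃ : s₃.nvar 26 = y := by
          rw [hA₃.nvar 26 (by decide)]; simpa [Cmd.run] using hy₂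
        have h25₃ : s₃.nvar 25 = s₂.nvar 25 := by
          rw [hA₃.nvar 25 (by decide)]; simp [Cmd.run]
        have e0₃ : s₃.rarr 0 = s.rarr 0 := by
          rw [hA₃.rarr 0 (by decide)]; simpa [Cmd.run] using e0₂
        have hj : ∀ j, β x j + β y j - β x j * β y j ≤ 1 := by
          intro j
          have h1 := hβ1 x j
          have h2 := hβ1 y j
          interval_cases β x j <;> interval_cases β y j <;> simp
        have hm : ∀ j, β x j * β y j ≤ 1 := fun j => Nat.mul_le_mul (hβ1 x j) (hβ1 y j)
        have hcond : (BExp.and (.rle (.arr 0 (.var 20) + .arr 0 (.var 27))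
            (.arr 0 (.var 19) + .arr 0 (.var 26)))
            (.and (.rle 0 (.arr 0 (.var 19))) (.rle (.arr 0 (.var 19)) 1))).Holds s₃ ↔ P x y := by
          simp only [BExp.holds_and, BExp.holds_rle, RExp.eval_add, RExp.eval_arr, NExp.eval_var,
            RExp.eval_ofNat, h19₃, h26₃, h20₃, h27₃, e0₃, hH x hx, hH y hy,
            hH _ (sum_two_pow_mul_lt k hj), hH _ (sum_two_pow_mul_lt k hm), hP]
          norm_num
        have hsucc : (∀ y' < y + 1, P x y') ↔ (∀ y' < y, P x y') ∧ P x y := by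
          simp only [Nat.lt_succ_iff_lt_or_eq, or_imp, forall_and, forall_eq]
        refine Reach.straight rfl (by decide) ?_
        simp only [hsucc]
        by_cases hc : P x y
        · simp only [Cmd.run, if_pos (hcond.mpr hc)]
          simp only [State.setN_nvar, h25₃]
          rw [if_neg (by decide), hI₂, and_iff_left hc]
        · simp only [Cmd.run, if_neg (fun h => hc (hcond.mp h))]
          refine iff_of_false (by simp) fun h => hc h.2.2
    · intro s₂ _ hI₂
      rw [State.setN_nvar, if_neg (by decide), hI₂]
      simp only [Nat.lt_succ_iff_lt_or_eq, or_imp, forall_and, forall_eq]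
  · intro s₁ hA₁ hI₁
    have e0₁ : s₁.rarr 0 = s.rarr 0 := by
      rw [hA₁.rarr 0 (by decide)]; simp [Cmd.run]
    have h16₁ : s₁.nvar 16 = 2 ^ k := by
      rw [hA₁.nvar 16 (by decide)]; simpa [Cmd.run] using h16
    refine Reach.ite (fun hb => ?_) fun hb => ?_
    · have hbad : ¬ TableGood k β H := fun hg => by
        have := hI₁.mpr hg
        simp [this] at hb
      refine Reach.forTo (N := 2 ^ k) h16₁ (by decide) (by decide) (by decide)
        (fun i s' => ∀ y < i, s'.rarr 0 y = 0) ?_ ?_ le_rfl fun s' _ h => Or.inr ⟨hbad, h⟩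
      · intro j hj; exact absurd hj (Nat.not_lt_zero _)
      · intro i hi s₂ hA₂ hi₂ hI₂
        refine Reach.straight rfl (by decide) ?_
        intro y hy
        simp only [Cmd.run, State.setN_rarr, State.putR_rarr, if_true, NExp.eval_var, hi₂,
          RExp.eval_ofNat]
        split_ifs with h
        · norm_num
        · exact hI₂ y (by omega)
    · have hgood : TableGood k β H := hI₁.mp (by simpa using hb)
      refine Reach.straight rfl (by
        have := Nat.one_le_two_pow (n := k); simp only [Cmd.maxCost]; omega) ?_
      exact Or.inl ⟨hgood, fun y hy => by simp only [Cmd.run]; rw [e0₁, hH y hy]⟩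

/-! ### The parameters -/

/-- Compute the parameters. The loops find the least powers of two with `1 ≤ 2 ^ l * ε` and
`n ≤ 2 ^ Λ`. -/
def paramStage : Cmd :=
  .seq (.seq (.setN 1 0) (.setN 2 1)) (.seq
    (.while (.not (.rle 1 (.ofNat (.var 2) * .var 0)))
      (.seq (.setN 2 (.var 2 * 2)) (.setN 1 (.var 1 + 1)))) (.seq
    (.seq (.setN 3 0) (.setN 4 1)) (.seq
    (.while (.not (.nle (.var 0) (.var 4)))
      (.seq (.setN 4 (.var 4 * 2)) (.setN 3 (.var 3 + 1))))
    (.seq (.setN 5 (10240 * (.var 2 * .var 2) * .var 1)) (.seq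
      (.setN 6 (16 * .var 2 * (.var 5 * .var 5))) (.seq
      (.setN 7 (8 * (.var 6 * .var 6))) (.seq
      (.setN 8 (160 * (.var 6 * .var 6) * (.var 3 + 1))) (.seq
      (.setN 12 (.var 0 + 1))
      (.setN 28 (3 * .var 6))))))))))

theorem reach_paramStage {s : State} {l Λ : ℕ} (h0 : s.nvar 0 = n)
    (hl : ∀ i < l, 2 ^ i * s.rvar 0 < 1) (hl' : 1 ≤ 2 ^ l * s.rvar 0)
    (hΛ : ∀ i < Λ, 2 ^ i < n) (hΛ' : n ≤ 2 ^ Λ) :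
    Reach f ω paramStage s (4 + ((l * 16 + 8) + (4 + ((Λ * 13 + 5) + 70)))) fun s' =>
      s'.nvar 5 = juntaSize (2 ^ l) l ∧ s'.nvar 6 = invThr (2 ^ l) l ∧
      s'.nvar 7 = 8 * (invThr (2 ^ l) l * invThr (2 ^ l) l) ∧
      s'.nvar 8 = 160 * (invThr (2 ^ l) l * invThr (2 ^ l) l) * (Λ + 1) ∧
      s'.nvar 12 = n + 1 ∧ s'.nvar 28 = 3 * invThr (2 ^ l) l := by
  refine Reach.seq_straight rfl (by decide) (Reach.seq ?_)
  refine (Reach.whileLoop (N := l) (B := 8) (fun i s' => s'.nvar 2 = 2 ^ i ∧ s'.nvar 1 = i)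
    ?_ ?_ ?_).frame.mono le_rfl ?_
  · simp [Cmd.run]
  · rintro i hi s₁ hA₁ ⟨h2, h1⟩
    have hr : s₁.rvar 0 = s.rvar 0 := by rw [hA₁.rvar 0 (by decide)]; simp [Cmd.run]
    have := hl i hi
    refine ⟨?_, Reach.straight rfl (by decide) ?_⟩
    · simpa [h2, hr] using this
    · simp [Cmd.run, h2, h1, pow_succ]
  · rintro s₁ hA₁ ⟨h2, h1⟩
    have hr : s₁.rvar 0 = s.rvar 0 := by rw [hA₁.rvar 0 (by decide)]; simp [Cmd.run]
    simpa [h2, hr] using hl'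
  rintro s₁ ⟨⟨h2₁, h1₁⟩, hA₁⟩
  have h0₁ : s₁.nvar 0 = n := by rw [hA₁.nvar 0 (by decide)]; simpa [Cmd.run] using h0
  refine Reach.seq_straight rfl (by decide) (Reach.seq ?_)
  refine (Reach.whileLoop (N := Λ) (B := 8) (fun i s' => s'.nvar 4 = 2 ^ i ∧ s'.nvar 3 = i)
    ?_ ?_ ?_).frame.mono le_rfl ?_
  · simp [Cmd.run]
  · rintro i hi s₂ hA₂ ⟨h4, h3⟩
    have h0₂ : s₂.nvar 0 = n := by rw [hA₂.nvar 0 (by decide)]; simpa [Cmd.run] using h0₁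
    have := hΛ i hi
    refine ⟨?_, Reach.straight rfl (by decide) ?_⟩
    · simpa [h4, h0₂] using this
    · simp [Cmd.run, h4, h3, pow_succ]
  · rintro s₂ hA₂ ⟨h4, h3⟩
    have h0₂ : s₂.nvar 0 = n := by rw [hA₂.nvar 0 (by decide)]; simpa [Cmd.run] using h0₁
    simpa [h4, h0₂] using hΛ'
  rintro s₂ ⟨⟨h4₂, h3₂⟩, hA₂⟩
  have h0₂ : s₂.nvar 0 = n := by rw [hA₂.nvar 0 (by decide)]; simpa [Cmd.run] using h0₁
  have h1₂ : s₂.nvar 1 = l := by rw [hA₂.nvar 1 (by decide)]; simpa [Cmd.run] using h1₁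
  have h2₂ : s₂.nvar 2 = 2 ^ l := by rw [hA₂.nvar 2 (by decide)]; simpa [Cmd.run] using h2₁
  refine Reach.straight rfl (by decide) ?_
  simp [Cmd.run, h0₂, h1₂, h2₂, h3₂, juntaSize, invThr]

/-- Compute the size `k'` of the candidates, the size of their tables, their number, and the number
of examples that are used for their evaluation. -/
def sizeStage : Cmd :=
  .seq (.ite (.nle (.var 5) (.var 14)) (.setN 15 (.var 5)) (.setN 15 (.var 14))) (.seq
    (powStage 16 15 2) (.seq (powStage 17 15 (.var 14)) (.seq (powStage 30 5 4)
    (.setN 18 (2 * .var 30 * (.var 28 * .var 28) * (4 + .var 5 + .var 5 * .var 7))))))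

theorem reach_sizeStage {s : State} {k L N cap : ℕ} (h5 : s.nvar 5 = k) (h14 : s.nvar 14 = L)
    (h28 : s.nvar 28 = N) (h7 : s.nvar 7 = cap) :
    Reach f ω sizeStage s (6 + ((2 + (k * 13 + 7)) + ((2 + (k * 13 + 7)) +
      ((2 + (k * 13 + 7)) + 20)))) fun s' =>
      s'.nvar 15 = min k L ∧ s'.nvar 16 = 2 ^ min k L ∧ s'.nvar 17 = L ^ min k L ∧
      s'.nvar 18 = 2 * 4 ^ k * (N * N) * (4 + k + k * cap) := by
  refine Reach.seq ((Reach.straight (Q := fun s' => s'.nvar 15 = min k L) rfl (by decide)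
    ?_).frame.mono le_rfl ?_)
  · simp only [Cmd.run, BExp.holds_nle, NExp.eval_var, h5, h14]
    split_ifs with h
    · simpa using h
    · simpa using (not_le.mp h).le
  rintro s₁ ⟨h15₁, hA₁⟩
  have h14₁ : s₁.nvar 14 = L := (hA₁.nvar 14 (by decide)).trans h14
  refine Reach.seq ((reach_powStage (b := 2) h15₁ (by decide) (by decide) (by decide) rfl
    (fun _ _ => rfl) (by decide)).frame.mono (by have := min_le_left k L; omega) ?_)
  rintro s₂ ⟨h16₂, hA₂⟩
  have h15₂ : s₂.nvar 15 = min k L := (hA₂.nvar 15 (by decide)).trans h15₁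
  have h14₂ : s₂.nvar 14 = L := (hA₂.nvar 14 (by decide)).trans h14₁
  refine Reach.seq ((reach_powStage (b := L) h15₂ (by decide) (by decide) (by decide) rfl
    (fun s' h => by simp [h, h14₂]) (by decide)).frame.mono
      (by have := min_le_left k L; omega) ?_)
  rintro s₃ ⟨h17₃, hA₃⟩
  have h5₃ : s₃.nvar 5 = k := by
    rw [hA₃.nvar 5 (by decide), hA₂.nvar 5 (by decide), hA₁.nvar 5 (by decide), h5]
  refine Reach.seq ((reach_powStage (b := 4) h5₃ (by decide) (by decide) (by decide) rfl
    (fun _ _ => rfl) (by decide)).frame.mono le_rfl ?_)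
  rintro s₄ ⟨h30₄, hA₄⟩
  have h5₄ : s₄.nvar 5 = k := (hA₄.nvar 5 (by decide)).trans h5₃
  have h28₄ : s₄.nvar 28 = N := by
    rw [hA₄.nvar 28 (by decide), hA₃.nvar 28 (by decide), hA₂.nvar 28 (by decide),
      hA₁.nvar 28 (by decide), h28]
  have h7₄ : s₄.nvar 7 = cap := by
    rw [hA₄.nvar 7 (by decide), hA₃.nvar 7 (by decide), hA₂.nvar 7 (by decide),
      hA₁.nvar 7 (by decide), h7]
  have h15₄ : s₄.nvar 15 = min k L := by
    rw [hA₄.nvar 15 (by decide), hA₃.nvar 15 (by decide), h15₂]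
  have h16₄ : s₄.nvar 16 = 2 ^ min k L := by
    rw [hA₄.nvar 16 (by decide), hA₃.nvar 16 (by decide), h16₂]
  have h17₄ : s₄.nvar 17 = L ^ min k L := (hA₄.nvar 17 (by decide)).trans h17₃
  refine Reach.straight rfl (by decide) ?_
  simp [Cmd.run, h5₄, h28₄, h7₄, h15₄, h16₄, h17₄, h30₄]

end RealRAM

namespace RealRAM

open Finset CubeFn

variable {n : ℕ} {f : Cube n → ℝ} {ω : ℕ → Cube n}

/-! ### The program -/

/-- The number of examples for the coefficients, where `n ≤ 2 ^ Λ`. -/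
def numCoef (l Λ : ℕ) : ℕ := 160 * (invThr (2 ^ l) l * invThr (2 ^ l) l) * (Λ + 1)

/-- The maximal number of relevant coordinates. -/
def numRel (l : ℕ) : ℕ := 8 * (invThr (2 ^ l) l * invThr (2 ^ l) l)

/-- The number of examples for the conditional averages, and again for their errors. -/
def numCond (l : ℕ) : ℕ :=
  2 * 4 ^ juntaSize (2 ^ l) l * (3 * invThr (2 ^ l) l * (3 * invThr (2 ^ l) l)) *
    (4 + juntaSize (2 ^ l) l + juntaSize (2 ^ l) l * numRel l)

/-- The list of the relevant coordinates. -/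
noncomputable def relevant (f : Cube n → ℝ) (ω : ℕ → Cube n) (l Λ : ℕ) : List ℕ :=
  relevantList (fun i j => ∑ t ∈ range (numCoef l Λ), f (ω t) * chi (ω t) i * chi (ω t) j) n
    (numCoef l Λ) (invThr (2 ^ l) l) (numRel l) n

/-- The coordinate at position `j` of the candidate number `c`: the digits of `c` are positions in
the list `ℓ`. -/
def cand (ℓ : List ℕ) (c j : ℕ) : ℕ := ℓ.getD (c / ℓ.length ^ j % ℓ.length) 0

/-- The candidates are the numbers whose digits increase. -/
def Valid (L k c : ℕ) : Prop := ∀ i < k, ∀ j < k, i < j → c / L ^ i % L < c / L ^ j % L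

/-- The estimate of the conditional average of `f` on the coordinates `V 0, …, V (k - 1)` from the
examples `m, …, m + M - 1`. -/
noncomputable def estimate (f : Cube n → ℝ) (ω : ℕ → Cube n) (m M k : ℕ) (V : ℕ → ℕ) (y : ℕ) : ℝ :=
  2 ^ k * (∑ t ∈ range M, if maskOf k V (ω (m + t)) = y then f (ω (m + t)) else 0) / M

/-- The total error of the estimate on the next `M` examples. -/
noncomputable def estError (f : Cube n → ℝ) (ω : ℕ → Cube n) (m M k : ℕ) (V : ℕ → ℕ) : ℝ :=
  ∑ t ∈ range M,
    |f (ω (m + M + t)) - estimate f ω m M k V (maskOf k V (ω (m + M + t)))|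

/-- The table that is computed for the best candidate, as a function of binary digits. -/
noncomputable def outTable (f : Cube n → ℝ) (ω : ℕ → Cube n) (m M K k N : ℕ) (V : ℕ → ℕ) (y : ℕ) :
    ℝ :=
  repaired K N (∑ j ∈ range k, y / 2 ^ j % 2) (estimate f ω m M k V y)

/-- The whole program. The storage is used as follows.

* Natural scalars: `0` the dimension and finally the size of the output; `1`, `2`, `3`, `4` the
  numbers `l`, `2 ^ l`, `Λ`, `2 ^ Λ`; `5` the bound for the size of the junta; `6` the inverse
  threshold; `7` the bound for the number of relevant coordinates; `8` and `18` the numbers of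
  examples per stage; `12` the dimension plus one; `14` the number of relevant coordinates; `15` the
  size of the candidates; `16` and `17` the size of a table and the number of candidates; `24` the
  best candidate; `28` the precision `N` of the estimates; `30` a power of `4`. The others are
  counters, flags and local variables.
* Real scalars: `0` the accuracy, `1` the label of the current example, `2` its deviation, `3` the
  least error.
* Natural arrays: `0` the output coordinates, `1` the current example, `2` the relevant coordinates,
  `3` the digits of the candidates, `4` the binary digits.
* Real arrays: `0` the output table, `1` the sums for the coefficients, `2` the sums for the
  conditional averages, `3` the errors. -/
def mainProg : Cmd :=
  .ite (.rle (1 / 2) (.var 0)) (.seq (.setN 0 0) (.putR 0 0 (1 / 2)))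
    (.seq paramStage (.seq coefStage (.seq selectStage (.seq sizeStage
      (.seq (digitStage 3 17 (.var 14)) (.seq (digitStage 4 16 2) (.seq sumStage (.seq errStage
        (.seq bestStage (.seq listStage (.seq tableStage (.seq checkStage
          (.setN 0 (.var 15))))))))))))))

/-- The running time for accuracy below `1 / 2`, with `L` relevant coordinates and candidates of
size `k`. -/
def mainCost (n l Λ L k : ℕ) : ℕ :=
  6 + ((4 + ((l * 16 + 8) + (4 + ((Λ * 13 + 5) + 70)))) +
  ((numCoef l Λ * (n + 1 + (n * ((n + 1) * 59 + 16) + 7) + 9) + 7) +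
  ((2 + (n * ((2 + ((n + 1) * 59 + 7 + 30)) + 9) + 7)) +
  ((6 + ((2 + (juntaSize (2 ^ l) l * 13 + 7)) + ((2 + (juntaSize (2 ^ l) l * 13 + 7)) +
      ((2 + (juntaSize (2 ^ l) l * 13 + 7)) + 20)))) +
  ((L ^ k * ((2 + (k * ((L ^ k * 12 + 15) + 9) + 7)) + 9) + 7) +
  ((2 ^ k * ((2 + (k * ((2 ^ k * 12 + 15) + 9) + 7)) + 9) + 7) +
  ((numCond l * ((n + 1 + (L ^ k * (((2 + (2 + (k * (22 + 9) + 7))) + 30) + 9) + 7)) + 9) + 7) +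
  ((numCond l * ((n + 1 + (L ^ k * (((2 + (2 + (k * (22 + 9) + 7))) + 40) + 9) + 7)) + 9) + 7) +
  ((2 + (2 + (L ^ k * ((2 + ((k * ((k * 49 + 7) + 9) + 7) + 40)) + 9) + 7))) +
  ((k * (10 + 9) + 7) +
  ((2 ^ k * ((2 + ((k * (10 + 9) + 7) + 50)) + 9) + 7) +
  ((2 + ((2 ^ k * ((2 ^ k * ((2 + (2 + (2 + ((k * (80 + 9) + 7) + 40)))) + 9) + 7) + 9) + 7) +
        (4 + (2 ^ k * (4 + 9) + 7)))) + 2))))))))))))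

theorem exists_digits {L k : ℕ} (g : Fin k → Fin L) :
    ∃ c < L ^ k, ∀ j : Fin k, c / L ^ (j : ℕ) % L = g j := by
  refine ⟨finFunctionFinEquiv g, (finFunctionFinEquiv g).2, fun j => ?_⟩
  have h := congrFun (finFunctionFinEquiv.symm_apply_apply g) j
  exact congrArg Fin.val h

/-- There is a candidate to choose. -/
theorem exists_valid {L k : ℕ} (h : k ≤ L) : ∃ c < L ^ k, Valid L k c := by
  obtain ⟨c, hc, hd⟩ := exists_digits (Fin.castLE h)
  refine ⟨c, hc, fun i hi j hj hij => ?_⟩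
  have h1 := hd ⟨i, hi⟩
  have h2 := hd ⟨j, hj⟩
  simp only [Fin.val_castLE] at h1 h2
  rw [h1, h2]
  exact hij

theorem lt_of_mem_relevant {l Λ i : ℕ} (h : i ∈ relevant f ω l Λ) : i < n := by
  have := List.mem_of_mem_take h
  rw [List.mem_filter, List.mem_range] at this
  exact this.1

theorem nodup_relevant (l Λ : ℕ) : (relevant f ω l Λ).Nodup :=
  (List.nodup_range.filter _).sublist (List.take_sublist _ _)

theorem length_relevant_le (l Λ : ℕ) : (relevant f ω l Λ).length ≤ numRel l := by
  unfold relevant relevantList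
  rw [List.length_take]
  exact min_le_left _ _

theorem cand_mem {ℓ : List ℕ} (h : 0 < ℓ.length) (c j : ℕ) : cand ℓ c j ∈ ℓ := by
  unfold cand
  rw [List.getD_eq_getElem _ _ (Nat.mod_lt _ h)]
  exact List.getElem_mem _

theorem cand_lt {l Λ k c j : ℕ} (hj : j < min k (relevant f ω l Λ).length) :
    cand (relevant f ω l Λ) c j < n :=
  lt_of_mem_relevant (cand_mem (by omega) c j)

theorem reach_mainProg_large {ε : ℝ} (hε : 1 / 2 ≤ ε) :
    Reach f ω mainProg (State.init n ε) 13 fun s =>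
      s.nvar 0 = 0 ∧ s.rarr 0 0 = 1 / 2 ∧ s.drawn = 0 := by
  refine Reach.ite (B := 7) (fun _ => ?_) fun hb => ?_
  · refine Reach.straight rfl (by decide) ?_
    simp [Cmd.run, State.init]
  · refine absurd ?_ hb
    simpa [State.init] using hε

set_option maxHeartbeats 1000000 in
/-- What the program computes: the first block of examples determines the list `ℓ`, and the chosen
candidate `c` minimizes the estimated error. -/
theorem reach_mainProg_small {ε : ℝ} {l Λ k N : ℕ} {ℓ : List ℕ} (hε : ε < 1 / 2)
    (hl : ∀ i < l, 2 ^ i * ε < 1) (hl' : 1 ≤ 2 ^ l * ε)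
    (hΛ : ∀ i < Λ, 2 ^ i < n) (hΛ' : n ≤ 2 ^ Λ) (hℓ : ℓ = relevant f ω l Λ)
    (hk : k = min (juntaSize (2 ^ l) l) ℓ.length) (hN : N = 3 * invThr (2 ^ l) l) :
    Reach f ω mainProg (State.init n ε) (mainCost n l Λ ℓ.length k) fun s =>
      s.drawn = numCoef l Λ + numCond l + numCond l ∧ s.nvar 0 = k ∧
      ∃ c < ℓ.length ^ k, Valid ℓ.length k c ∧
        (∀ c' < ℓ.length ^ k, Valid ℓ.length k c' →
          estError f ω (numCoef l Λ) (numCond l) k (cand ℓ c) ≤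
            estError f ω (numCoef l Λ) (numCond l) k (cand ℓ c')) ∧
        (∀ j < k, s.narr 0 j = cand ℓ c j) ∧
        ((TableGood k (fun y j => y / 2 ^ j % 2)
            (outTable f ω (numCoef l Λ) (numCond l) (juntaSize (2 ^ l) l) k N (cand ℓ c)) ∧
          ∀ y < 2 ^ k, s.rarr 0 y =
            outTable f ω (numCoef l Λ) (numCond l) (juntaSize (2 ^ l) l) k N (cand ℓ c) y) ∨
        (¬ TableGood k (fun y j => y / 2 ^ j % 2)
            (outTable f ω (numCoef l Λ) (numCond l) (juntaSize (2 ^ l) l) k N (cand ℓ c)) ∧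
          ∀ y < 2 ^ k, s.rarr 0 y = 0)) := by
  unfold mainCost
  refine Reach.ite (fun hb => ?_) fun _ => ?_
  · refine absurd ?_ (not_le.mpr hε)
    simpa [State.init] using hb
  set s₀ := State.init n ε with hs₀
  have h0₀ : s₀.nvar 0 = n := by simp [hs₀, State.init]
  have hr₀ : s₀.rvar 0 = ε := by simp [hs₀, State.init]
  refine Reach.seq ((reach_paramStage h0₀ (by rwa [hr₀]) (by rwa [hr₀]) hΛ hΛ').frame.mono
    le_rfl ?_)
  rintro s₁ ⟨⟨h5₁, h6₁, h7₁, h8₁, h12₁, h28₁⟩, hA₁⟩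
  have h0₁ : s₁.nvar 0 = n := (hA₁.nvar 0 (by decide)).trans h0₀
  have hz₁ : ∀ a, s₁.rarr a = fun _ => 0 := fun a => by
    rw [hA₁.rarr a (by simp [paramStage, Cmd.wRA])]; rfl
  have hd₁ : s₁.drawn = 0 := hA₁.drawn (by decide)
  have hn₁ : s₁.narr 1 n = 0 := by rw [hA₁.narr 1 (by decide)]; rfl
  refine Reach.seq ((reach_coefStage (m := numCoef l Λ) h0₁ h12₁ h8₁ (fun i => by rw [hz₁ 1]) hn₁
    hd₁).frame.mono le_rfl ?_)
  rintro s₂ ⟨⟨hd₂, hc₂⟩, hA₂⟩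
  have h0₂ : s₂.nvar 0 = n := (hA₂.nvar 0 (by decide)).trans h0₁
  have h5₂ := (hA₂.nvar 5 (by decide)).trans h5₁
  have h6₂ := (hA₂.nvar 6 (by decide)).trans h6₁
  have h7₂ : s₂.nvar 7 = numRel l := (hA₂.nvar 7 (by decide)).trans h7₁
  have h8₂ : s₂.nvar 8 = numCoef l Λ := (hA₂.nvar 8 (by decide)).trans h8₁
  have h12₂ := (hA₂.nvar 12 (by decide)).trans h12₁
  have h28₂ := (hA₂.nvar 28 (by decide)).trans h28₁
  have hz2₂ : ∀ i, s₂.rarr 2 i = 0 := fun i => by rw [hA₂.rarr 2 (by decide), hz₁ 2]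
  have hz3₂ : ∀ i, s₂.rarr 3 i = 0 := fun i => by rw [hA₂.rarr 3 (by decide), hz₁ 3]
  refine Reach.seq ((reach_selectStage h0₂ h12₂ h8₂ h6₂ h7₂ hc₂).frame.mono le_rfl ?_)
  rintro s₃ ⟨⟨h14₃, hl₃⟩, hA₃⟩
  change s₃.nvar 14 = (relevant f ω l Λ).length at h14₃
  change ∀ a < (relevant f ω l Λ).length, s₃.narr 2 a = (relevant f ω l Λ).getD a 0 at hl₃
  rw [← hℓ] at h14₃ hl₃
  have h5₃ := (hA₃.nvar 5 (by decide)).trans h5₂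
  have h7₃ := (hA₃.nvar 7 (by decide)).trans h7₂
  have h28₃ := (hA₃.nvar 28 (by decide)).trans h28₂
  refine Reach.seq ((reach_sizeStage h5₃ h14₃ h28₃ h7₃).frame.mono le_rfl ?_)
  rintro s₄ ⟨⟨h15₄, h16₄, h17₄, h18₄⟩, hA₄⟩
  rw [← hk] at h15₄ h16₄ h17₄
  change s₄.nvar 18 = numCond l at h18₄
  have h14₄ := (hA₄.nvar 14 (by decide)).trans h14₃
  have hL0 : k ≠ 0 → 0 < ℓ.length := by intro h; omega
  refine Reach.seq ((reach_digitStage (b := ℓ.length) h17₄ (Or.inr rfl) h15₄ rfl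
    (fun s' h => by rw [NExp.eval_var, h, h14₄]) hL0).frame.mono le_rfl ?_)
  rintro s₅ ⟨h3₅, hA₅⟩
  have h15₅ := (hA₅.nvar 15 (by decide)).trans h15₄
  have h16₅ := (hA₅.nvar 16 (by decide)).trans h16₄
  refine Reach.seq ((reach_digitStage (b := 2) h16₅ (Or.inl rfl) h15₅ rfl
    (fun s' h => rfl) (fun _ => by norm_num)).frame.mono le_rfl ?_)
  rintro s₆ ⟨h4₆, hA₆⟩
  have h15₆ := (hA₆.nvar 15 (by decide)).trans h15₅
  have h16₆ := (hA₆.nvar 16 (by decide)).trans h16₅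
  have h17₆ : s₆.nvar 17 = ℓ.length ^ k := by
    rw [hA₆.nvar 17 (by decide), hA₅.nvar 17 (by decide), h17₄]
  have h18₆ : s₆.nvar 18 = numCond l := by
    rw [hA₆.nvar 18 (by decide), hA₅.nvar 18 (by decide), h18₄]
  have hl₆ : s₆.narr 2 = s₃.narr 2 := by
    rw [hA₆.narr 2 (by decide), hA₅.narr 2 (by decide), hA₄.narr 2 (by decide)]
  have h3₆ : s₆.narr 3 = s₅.narr 3 := hA₆.narr 3 (by decide)
  have hV₆ : ∀ c < ℓ.length ^ k, ∀ j < k,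
      s₆.narr 2 (s₆.narr 3 (c * k + j)) = cand ℓ c j ∧ cand ℓ c j < n := by
    intro c hc j hj
    refine ⟨?_, ?_⟩
    · rw [hl₆, h3₆, h3₅ c hc j hj, hl₃ _ (Nat.mod_lt _ (hL0 (by omega)))]
      rfl
    · subst hℓ
      exact cand_lt (k := juntaSize (2 ^ l) l) (by omega)
  have hd₆ : s₆.drawn = numCoef l Λ := by
    rw [hA₆.drawn (by decide), hA₅.drawn (by decide), hA₄.drawn (by decide), hA₃.drawn (by decide),
      hd₂]
  have hz2₆ : ∀ i, s₆.rarr 2 i = 0 := fun i => by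
    rw [hA₆.rarr 2 (by decide), hA₅.rarr 2 (by decide), hA₄.rarr 2 (by decide),
      hA₃.rarr 2 (by decide), hz2₂]
  have hz3₆ : ∀ i, s₆.rarr 3 i = 0 := fun i => by
    rw [hA₆.rarr 3 (by decide), hA₅.rarr 3 (by decide), hA₄.rarr 3 (by decide),
      hA₃.rarr 3 (by decide), hz3₂]
  refine Reach.seq ((reach_sumStage h18₆ h17₆ h16₆ h15₆ hd₆ hV₆ hz2₆).frame.mono le_rfl ?_)
  rintro s₇ ⟨⟨hd₇, hS₇⟩, hA₇⟩
  have h15₇ := (hA₇.nvar 15 (by decide)).trans h15₆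
  have h16₇ := (hA₇.nvar 16 (by decide)).trans h16₆
  have h17₇ := (hA₇.nvar 17 (by decide)).trans h17₆
  have h18₇ := (hA₇.nvar 18 (by decide)).trans h18₆
  have hV₇ : ∀ c < ℓ.length ^ k, ∀ j < k,
      s₇.narr 2 (s₇.narr 3 (c * k + j)) = cand ℓ c j ∧ cand ℓ c j < n := by
    rw [hA₇.narr 2 (by decide), hA₇.narr 3 (by decide)]; exact hV₆
  have hz3₇ : ∀ i, s₇.rarr 3 i = 0 := fun i => by rw [hA₇.rarr 3 (by decide), hz3₆]
  refine Reach.seq ((reach_errStage h18₇ h17₇ h16₇ h15₇ hd₇ hV₇ hS₇ hz3₇).frame.mono le_rfl ?_)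
  rintro s₈ ⟨⟨hd₈, hE₈⟩, hA₈⟩
  have h15₈ := (hA₈.nvar 15 (by decide)).trans h15₇
  have h16₈ := (hA₈.nvar 16 (by decide)).trans h16₇
  have h17₈ := (hA₈.nvar 17 (by decide)).trans h17₇
  have h18₈ := (hA₈.nvar 18 (by decide)).trans h18₇
  have hD₈ : ∀ c < ℓ.length ^ k, ∀ j < k,
      s₈.narr 3 (c * k + j) = c / ℓ.length ^ j % ℓ.length := by
    rw [hA₈.narr 3 (by decide), hA₇.narr 3 (by decide), h3₆]; exact h3₅
  refine Reach.seq ((reach_bestStage h17₈ h15₈ hD₈ hE₈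
    (exists_valid (by omega))).frame.mono le_rfl ?_)
  rintro s₉ ⟨⟨hc₉, hv₉, hm₉⟩, hA₉⟩
  set c := s₉.nvar 24 with hc
  have h15₉ := (hA₉.nvar 15 (by decide)).trans h15₈
  refine Reach.seq ((reach_listStage h15₉).frame.mono le_rfl ?_)
  rintro s₁₀ ⟨hl₁₀, hA₁₀⟩
  have hl₁₀' : ∀ j < k, s₁₀.narr 0 j = cand ℓ c j := fun j hj => by
    rw [hl₁₀ j hj, hA₉.narr 2 (by decide), hA₉.narr 3 (by decide), hA₈.narr 2 (by decide),
      hA₈.narr 3 (by decide)]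
    exact (hV₇ c hc₉ j hj).1
  have h15₁₀ := (hA₁₀.nvar 15 (by decide)).trans h15₉
  have h16₁₀ : s₁₀.nvar 16 = 2 ^ k := by
    rw [hA₁₀.nvar 16 (by decide), hA₉.nvar 16 (by decide), h16₈]
  have h18₁₀ : s₁₀.nvar 18 = numCond l := by
    rw [hA₁₀.nvar 18 (by decide), hA₉.nvar 18 (by decide), h18₈]
  have h24₁₀ : s₁₀.nvar 24 = c := hA₁₀.nvar 24 (by decide)
  have h5₁₀ : s₁₀.nvar 5 = juntaSize (2 ^ l) l := by
    rw [hA₁₀.nvar 5 (by decide), hA₉.nvar 5 (by decide), hA₈.nvar 5 (by decide),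
      hA₇.nvar 5 (by decide), hA₆.nvar 5 (by decide), hA₅.nvar 5 (by decide),
      hA₄.nvar 5 (by decide), h5₃]
  have h28₁₀ : s₁₀.nvar 28 = N := by
    rw [hA₁₀.nvar 28 (by decide), hA₉.nvar 28 (by decide), hA₈.nvar 28 (by decide),
      hA₇.nvar 28 (by decide), hA₆.nvar 28 (by decide), hA₅.nvar 28 (by decide),
      hA₄.nvar 28 (by decide), h28₃, hN]
  have hβ₁₀ : ∀ y < 2 ^ k, ∀ j < k, s₁₀.narr 4 (y * k + j) = y / 2 ^ j % 2 := by
    rw [hA₁₀.narr 4 (by decide), hA₉.narr 4 (by decide), hA₈.narr 4 (by decide),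
      hA₇.narr 4 (by decide)]
    exact h4₆
  have hS₁₀ : ∀ y < 2 ^ k, s₁₀.rarr 2 (c * 2 ^ k + y) = ∑ t ∈ range (numCond l),
      if maskOf k (cand ℓ c) (ω (numCoef l Λ + t)) = y then f (ω (numCoef l Λ + t)) else 0 := by
    rw [hA₁₀.rarr 2 (by decide), hA₉.rarr 2 (by decide), hA₈.rarr 2 (by decide)]
    exact hS₇ c hc₉
  refine Reach.seq ((reach_tableStage h16₁₀ h15₁₀ h5₁₀ h28₁₀ h18₁₀ h24₁₀ hβ₁₀ hS₁₀).frame.mono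
    le_rfl ?_)
  rintro s₁₁ ⟨hT₁₁, hA₁₁⟩
  have h15₁₁ := (hA₁₁.nvar 15 (by decide)).trans h15₁₀
  have h16₁₁ := (hA₁₁.nvar 16 (by decide)).trans h16₁₀
  have hβ₁₁ : ∀ y < 2 ^ k, ∀ j < k, s₁₁.narr 4 (y * k + j) = y / 2 ^ j % 2 := by
    rw [hA₁₁.narr 4 (by decide)]; exact hβ₁₀
  change ∀ y < 2 ^ k, s₁₁.rarr 0 y =
    outTable f ω (numCoef l Λ) (numCond l) (juntaSize (2 ^ l) l) k N (cand ℓ c) y at hT₁₁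
  refine Reach.seq ((reach_checkStage h16₁₁ h15₁₁ hβ₁₁ (fun y j =>
    Nat.le_of_lt_succ (Nat.mod_lt _ (by norm_num))) hT₁₁).frame.mono le_rfl ?_)
  rintro s₁₂ ⟨hT₁₂, hA₁₂⟩
  refine Reach.straight rfl (by decide) ?_
  refine ⟨?_, ?_, c, hc₉, hv₉, hm₉, ?_, ?_⟩
  · rw [Cmd.run, State.setN_drawn, hA₁₂.drawn (by decide), hA₁₁.drawn (by decide),
      hA₁₀.drawn (by decide), hA₉.drawn (by decide), hd₈]
  · rw [Cmd.run, State.setN_nvar, if_pos rfl, NExp.eval_var, hA₁₂.nvar 15 (by decide), h15₁₁]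
  · intro j hj
    rw [Cmd.run, State.setN_narr, hA₁₂.narr 0 (by decide), hA₁₁.narr 0 (by decide), hl₁₀' j hj]
  · rw [Cmd.run, State.setN_rarr]
    exact hT₁₂

end RealRAM

namespace RealRAM

open Finset CubeFn

variable {n : ℕ} {f : Cube n → ℝ} {ω : ℕ → Cube n}

/-! ### Tables as functions on the cube -/

section Mask

variable {k : ℕ} {V : ℕ → ℕ} {v : Fin k ↪ Fin n}

theorem bit_coe (x : Cube n) (i : Fin n) : bit x i = (x i).toNat := by simp [bit]

theorem maskOf_eq_finFunctionFinEquiv (hv : ∀ j : Fin k, V j = v j) (x : Cube n) :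
    maskOf k V x = finFunctionFinEquiv fun j : Fin k => (if x (v j) then 1 else 0 : Fin 2) := by
  rw [finFunctionFinEquiv_apply, maskOf, sum_range]
  refine sum_congr rfl fun j _ => ?_
  rw [hv, bit_coe]
  cases x (v j) <;> simp

theorem maskOf_eq_sum_ite (hv : ∀ j : Fin k, V j = v j) (x : Cube n) :
    maskOf k V x = ∑ j : Fin k, if x (v j) = true then 2 ^ (j : ℕ) else 0 := by
  rw [maskOf, sum_range]
  refine sum_congr rfl fun j _ => ?_
  rw [hv, bit_coe]
  cases x (v j) <;> simp

theorem maskOf_digit (hv : ∀ j : Fin k, V j = v j) (x : Cube n) {j : ℕ} (hj : j < k) :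
    maskOf k V x / 2 ^ j % 2 = bit x (V j) := by
  have h := congrArg Fin.val (congrFun (finFunctionFinEquiv.symm_apply_apply
    fun j : Fin k => (if x (v j) then 1 else 0 : Fin 2)) ⟨j, hj⟩)
  rw [maskOf_eq_finFunctionFinEquiv hv, hv ⟨j, hj⟩, bit_coe]
  refine Eq.trans h ?_
  cases x (v ⟨j, hj⟩) <;> simp

theorem maskOf_eq_iff (hv : ∀ j : Fin k, V j = v j) (x y : Cube n) :
    maskOf k V x = maskOf k V y ↔ ∀ j, x (v j) = y (v j) := by
  constructor
  · intro h j
    have h1 := maskOf_digit hv x j.2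
    rw [h, maskOf_digit hv y j.2, hv, bit_coe, bit_coe] at h1
    revert h1
    cases x (v j) <;> cases y (v j) <;> simp
  · intro h
    rw [maskOf_eq_sum_ite hv, maskOf_eq_sum_ite hv]
    simp only [h]

theorem exists_maskOf_eq (hv : ∀ j : Fin k, V j = v j) {y : ℕ} (hy : y < 2 ^ k) :
    ∃ x : Cube n, maskOf k V x = y := by
  set g := finFunctionFinEquiv.symm (⟨y, hy⟩ : Fin (2 ^ k)) with hg
  refine ⟨Function.extend v (fun j => decide (g j = 1)) fun _ => false, ?_⟩
  have h : (fun j : Fin k => (if Function.extend v (fun j => decide (g j = 1))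
      (fun _ => false) (v j) then 1 else 0 : Fin 2)) = g := by
    funext j
    rw [v.injective.extend_apply]
    rcases Fin.exists_fin_two.mp ⟨g j, rfl⟩ with h | h <;> simp [h]
  rw [maskOf_eq_finFunctionFinEquiv hv, h, hg, Equiv.apply_symm_apply]

theorem maskOf_sup (hv : ∀ j : Fin k, V j = v j) (x y : Cube n) :
    maskOf k V (x ⊔ y) = ∑ j ∈ range k, 2 ^ j * (maskOf k V x / 2 ^ j % 2 +
      maskOf k V y / 2 ^ j % 2 - (maskOf k V x / 2 ^ j % 2) * (maskOf k V y / 2 ^ j % 2)) := by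
  rw [maskOf]
  refine sum_congr rfl fun j hj => ?_
  have hj := mem_range.mp hj
  rw [maskOf_digit hv x hj, maskOf_digit hv y hj, hv ⟨j, hj⟩, bit_coe, bit_coe, bit_coe,
    Pi.sup_apply]
  cases x (v ⟨j, hj⟩) <;> cases y (v ⟨j, hj⟩) <;> simp

theorem maskOf_inf (hv : ∀ j : Fin k, V j = v j) (x y : Cube n) :
    maskOf k V (x ⊓ y) = ∑ j ∈ range k, 2 ^ j *
      ((maskOf k V x / 2 ^ j % 2) * (maskOf k V y / 2 ^ j % 2)) := by
  rw [maskOf]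
  refine sum_congr rfl fun j hj => ?_
  have hj := mem_range.mp hj
  rw [maskOf_digit hv x hj, maskOf_digit hv y hj, hv ⟨j, hj⟩, bit_coe, bit_coe, bit_coe,
    Pi.inf_apply]
  cases x (v ⟨j, hj⟩) <;> cases y (v ⟨j, hj⟩) <;> simp

theorem sum_digits_maskOf (hv : ∀ j : Fin k, V j = v j) (x : Cube n) :
    ∑ j ∈ range k, maskOf k V x / 2 ^ j % 2 = (univ.filter fun j => x (v j) = true).card := by
  rw [card_filter, sum_range]
  refine sum_congr rfl fun j _ => ?_
  rw [maskOf_digit hv x j.2, hv, bit_coe]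
  cases x (v j) <;> simp

/-- The check of the output table is a statement about the function on the cube. -/
theorem tableGood_iff (hv : ∀ j : Fin k, V j = v j) (H : ℕ → ℝ) :
    TableGood k (fun y j => y / 2 ^ j % 2) H ↔ IsSubmodular (fun x : Cube n => H (maskOf k V x)) ∧
      ∀ x : Cube n, H (maskOf k V x) ∈ Set.Icc (0 : ℝ) 1 := by
  constructor
  · intro h
    refine ⟨fun x y => ?_, fun x => ?_⟩
    · have := (h _ (maskOf_lt k V x) _ (maskOf_lt k V y)).1
      simp only
      rwa [maskOf_sup hv, maskOf_inf hv]
    · exact (h _ (maskOf_lt k V x) _ (maskOf_lt k V x)).2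
  · rintro ⟨h1, h2⟩ a ha b hb
    obtain ⟨x, rfl⟩ := exists_maskOf_eq (n := n) hv ha
    obtain ⟨y, rfl⟩ := exists_maskOf_eq (n := n) hv hb
    refine ⟨?_, h2 x⟩
    have := h1 x y
    simp only at this
    rwa [maskOf_sup hv, maskOf_inf hv] at this

end Mask

/-! ### The estimates -/

theorem agree_filter_eq (J : Finset (Fin n)) (x z : Cube n) :
    agree J (J.filter fun i => x i = true) z = if ∀ i ∈ J, z i = x i then 1 else 0 := by
  unfold agree
  refine if_congr (forall₂_congr fun i hi => ?_) rfl rfl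
  rw [mem_filter]
  cases z i <;> cases x i <;> simp [hi]

theorem avg_indicator_eq (J : Finset (Fin n)) (x : Cube n) :
    avg (fun z => if ∀ i ∈ J, z i = x i then (1 : ℝ) else 0) = 1 / 2 ^ J.card := by
  have hset : (univ.filter fun z : Cube n => ∀ i ∈ J, z i = x i) =
      Fintype.piFinset fun i => if i ∈ J then {x i} else univ := by
    ext z
    simp only [mem_filter, mem_univ, true_and, Fintype.mem_piFinset]
    refine forall_congr' fun i => ?_
    split_ifs with h <;> simp [h]
  have hcard : (univ.filter fun z : Cube n => ∀ i ∈ J, z i = x i).card * 2 ^ J.card = 2 ^ n := by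
    have h1 : ∏ i : Fin n, (if i ∈ J then 2 else 1) = 2 ^ J.card := by
      rw [prod_ite_mem, univ_inter, prod_const]
    rw [hset, Fintype.card_piFinset, ← h1, ← prod_mul_distrib]
    have h2 : ∀ i : Fin n, (if i ∈ J then ({x i} : Finset Bool) else univ).card *
        (if i ∈ J then 2 else 1) = 2 := by
      intro i; split_ifs <;> simp
    simp only [h2, prod_const, card_univ, Fintype.card_fin]
  have hcard' : ((univ.filter fun z : Cube n => ∀ i ∈ J, z i = x i).card : ℝ) * 2 ^ J.card =
      2 ^ n := by exact_mod_cast hcard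
  rw [avg, sum_boole, div_eq_div_iff (by positivity) (by positivity), one_mul, hcard']

/-- The quantity that is estimated for a cell of the table is the conditional average times the
probability of the cell. -/
theorem avg_mul_agree_eq (f : Cube n → ℝ) (J : Finset (Fin n)) (x : Cube n) :
    avg (fun z => f z * agree J (J.filter fun i => x i = true) z) =
      condAvg J f x / 2 ^ J.card := by
  rw [← avg_condAvg J]
  have h : condAvg J (fun z => f z * agree J (J.filter fun i => x i = true) z) =
      fun z => condAvg J f x * if ∀ i ∈ J, z i = x i then (1 : ℝ) else 0 := by
    funext z
    by_cases hz : ∀ i ∈ J, z i = x i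
    · rw [if_pos hz, mul_one, ← dependsOn_condAvg J f (x := z) (y := x) hz]
      unfold condAvg
      congr 1
      funext w
      simp only
      rw [agree_filter_eq, if_pos, mul_one]
      intro i hi
      rw [piecewise_eq_of_mem _ _ _ hi, hz i hi]
    · rw [if_neg hz, mul_zero]
      unfold condAvg
      rw [← avg_const (n := n) 0]
      congr 1
      funext w
      simp only
      rw [agree_filter_eq, if_neg, mul_zero]
      refine fun hw => hz fun i hi => ?_
      rw [← hw i hi, piecewise_eq_of_mem _ _ _ hi]
  rw [h, avg_const_mul, avg_indicator_eq, mul_one_div]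

section Estimate

variable {k m M N : ℕ} {V : ℕ → ℕ} {v : Fin k ↪ Fin n}

theorem estimate_maskOf_eq (hv : ∀ j : Fin k, V j = v j) (x : Cube n) :
    estimate f ω m M k V (maskOf k V x) =
      2 ^ k * (∑ t ∈ range M, f (ω (m + t)) *
        agree (univ.map v) ((univ.map v).filter fun i => x i = true) (ω (m + t))) / M := by
  unfold estimate
  congr 2
  refine sum_congr rfl fun t _ => ?_
  rw [agree_filter_eq]
  have h : (∀ i ∈ univ.map v, ω (m + t) i = x i) ↔ maskOf k V (ω (m + t)) = maskOf k V x := by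
    rw [maskOf_eq_iff hv]; simp
  simp only [h, mul_ite, mul_one, mul_zero]

theorem abs_estimate_sub_condAvg_le (hv : ∀ j : Fin k, V j = v j) (hM : 0 < M)
    (hg : GoodCond f m M N (univ.map v) ω) (x : Cube n) :
    |estimate f ω m M k V (maskOf k V x) - condAvg (univ.map v) f x| ≤ 1 / N := by
  have h := hg.1 _ (filter_subset (fun i => x i = true) (univ.map v))
  rw [avg_mul_agree_eq, card_map, card_univ, Fintype.card_fin] at h
  rw [estimate_maskOf_eq hv]
  set S := ∑ t ∈ range M, f (ω (m + t)) *
        agree (univ.map v) ((univ.map v).filter fun i => x i = true) (ω (m + t))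
  set g := condAvg (univ.map v) f x
  have hM' : (0 : ℝ) < M := by exact_mod_cast hM
  have h2 : (0 : ℝ) < 2 ^ k := by positivity
  have e : 2 ^ k * S / M - g = (2 ^ k / M) * (S - M * (g / 2 ^ k)) := by field_simp
  rw [e, abs_mul, abs_of_pos (by positivity : (0 : ℝ) < 2 ^ k / M)]
  calc (2 : ℝ) ^ k / M * |S - M * (g / 2 ^ k)| ≤ 2 ^ k / M * (M * (1 / (N * 2 ^ k))) := by
        gcongr
    _ = 1 / N := by
        rcases Nat.eq_zero_or_pos N with rfl | hN
        · simp
        · have : (0 : ℝ) < N := by exact_mod_cast hN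
          field_simp

/-- One `1 / N` comes from the table and the other from the examples. -/
theorem abs_estError_sub_le (hv : ∀ j : Fin k, V j = v j) (hM : 0 < M)
    (hg : GoodCond f m M N (univ.map v) ω) :
    |estError f ω m M k V - M * avg (fun x => |f x - condAvg (univ.map v) f x|)| ≤
      M * (2 / N) := by
  have h2 := hg.2.le
  have h1 : |estError f ω m M k V - (∑ t ∈ range M,
      |f (ω (m + M + t)) - condAvg (univ.map v) f (ω (m + M + t))|)| ≤ M * (1 / N) := by
    unfold estError
    rw [← sum_sub_distrib]
    refine (abs_sum_le_sum_abs _ _).trans ?_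
    have : ∀ t ∈ range M, |(|f (ω (m + M + t)) -
        estimate f ω m M k V (maskOf k V (ω (m + M + t)))| -
          |f (ω (m + M + t)) - condAvg (univ.map v) f (ω (m + M + t))|)| ≤ 1 / N := by
      intro t _
      refine (abs_abs_sub_abs_le_abs_sub _ _).trans ?_
      rw [sub_sub_sub_cancel_left, abs_sub_comm]
      exact abs_estimate_sub_condAvg_le hv hM hg _
    refine (sum_le_card_nsmul _ _ _ this).trans (le_of_eq ?_)
    rw [card_range, nsmul_eq_mul]
  calc _ ≤ (M * (1 / N) : ℝ) + M * (1 / N) := (abs_sub_le _ _ _).trans (add_le_add h1 h2)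
    _ = M * (2 / N) := by ring

theorem estimate_nonneg (hf : ∀ x, f x ∈ Set.Icc (0 : ℝ) 1) (y : ℕ) :
    0 ≤ estimate f ω m M k V y := by
  unfold estimate
  refine div_nonneg (mul_nonneg (by positivity) (sum_nonneg fun t _ => ?_)) (Nat.cast_nonneg _)
  split_ifs
  · exact (hf _).1
  · exact le_rfl

/-- If the estimates are accurate, then the output table passes the check: for incomparable points
the term `2 (k² - d²)` gains at least `4`, and the estimates lose at most `4`. -/
theorem tableGood_outTable (hf : IsSubmodular f) (hf1 : ∀ x, f x ∈ Set.Icc (0 : ℝ) 1)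
    (hv : ∀ j : Fin k, V j = v j) (hM : 0 < M) (hN : 0 < N) {K : ℕ} (hkK : k ≤ K)
    (hg : GoodCond f m M N (univ.map v) ω) :
    TableGood k (fun y j => y / 2 ^ j % 2) (outTable f ω m M K k N V) := by
  set g := condAvg (univ.map v) f with hgdef
  set e : Cube n → ℝ := fun x => estimate f ω m M k V (maskOf k V x) with he
  set d : Cube n → ℕ := fun x => (univ.filter fun j => x (v j) = true).card with hd
  have hN' : (0 : ℝ) < N := by exact_mod_cast hN
  have hest : ∀ x, |N * e x - N * g x| ≤ 1 := fun x => by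
    rw [← mul_sub, abs_mul, abs_of_pos hN']
    calc (N : ℝ) * |e x - g x| ≤ N * (1 / N) := by
          gcongr
          exact abs_estimate_sub_condAvg_le hv hM hg x
      _ = 1 := by field_simp
  have hdK : ∀ x, d x ≤ K := fun x =>
    (card_le_univ _).trans (by rw [Fintype.card_fin]; exact hkK)
  have hden : (0 : ℝ) < (N + 1 + 2 * (K * K) : ℕ) := by positivity
  have hout : ∀ x, outTable f ω m M K k N V (maskOf k V x) =
      (N * e x + 2 * (K * K - d x * d x)) / (N + 1 + 2 * (K * K) : ℕ) := fun x => by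
    unfold outTable repaired
    rw [sum_digits_maskOf hv]
    have : d x * d x ≤ K * K := Nat.mul_le_mul (hdK x) (hdK x)
    rw [Nat.cast_mul, Nat.cast_sub this]
    push_cast
    rfl
  rw [tableGood_iff hv]
  refine ⟨fun x y => ?_, fun x => ?_⟩
  · -- comparable points satisfy the inequality with equality
    by_cases hxy : ∀ j, x (v j) ≤ y (v j)
    · have h1 : maskOf k V (x ⊔ y) = maskOf k V y := (maskOf_eq_iff hv _ _).mpr fun j =>
        sup_of_le_right (hxy j)
      have h2 : maskOf k V (x ⊓ y) = maskOf k V x := (maskOf_eq_iff hv _ _).mpr fun j =>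
        inf_of_le_left (hxy j)
      simp only [h1, h2]
      linarith
    by_cases hyx : ∀ j, y (v j) ≤ x (v j)
    · have h1 : maskOf k V (x ⊔ y) = maskOf k V x := (maskOf_eq_iff hv _ _).mpr fun j =>
        sup_of_le_left (hyx j)
      have h2 : maskOf k V (x ⊓ y) = maskOf k V y := (maskOf_eq_iff hv _ _).mpr fun j =>
        inf_of_le_right (hyx j)
      simp only [h1, h2]
      linarith
    have hlt : ∀ x y : Cube n, ¬ (∀ j, x (v j) ≤ y (v j)) → d (x ⊓ y) + 1 ≤ d x := by
      intro x y h
      push Not at h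
      obtain ⟨j, hj⟩ := h
      refine card_lt_card (Finset.ssubset_iff_subset_ne.mpr ⟨fun i hi => ?_, fun heq => ?_⟩)
      · simp only [mem_filter, mem_univ, true_and, Pi.inf_apply] at hi ⊢
        revert hi
        cases x (v i) <;> simp
      · have hj' : x (v j) = true ∧ y (v j) = false := by
          revert hj
          cases x (v j) <;> cases y (v j) <;> simp
        have hmem : j ∈ univ.filter fun j => x (v j) = true := by simp [hj'.1]
        rw [← heq] at hmem
        simp [hj'.2] at hmem
    have hadd : d (x ⊔ y) + d (x ⊓ y) = d x + d y := by
      simp only [hd, card_filter, ← sum_add_distrib]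
      refine sum_congr rfl fun j _ => ?_
      rw [Pi.sup_apply, Pi.inf_apply]
      generalize x (v j) = a
      generalize y (v j) = b
      revert a b
      decide
    have h1 : (d (x ⊓ y) + 1 : ℝ) ≤ d x := by exact_mod_cast hlt x y hxy
    have h2 : (d (x ⊓ y) + 1 : ℝ) ≤ d y := by
      have := hlt y x hyx
      rw [inf_comm] at this
      exact_mod_cast this
    have h3 : (d (x ⊔ y) + d (x ⊓ y) : ℝ) = d x + d y := by exact_mod_cast hadd
    have h4 : N * g (x ⊔ y) + N * g (x ⊓ y) ≤ N * g x + N * g y := by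
      rw [← mul_add, ← mul_add]
      exact mul_le_mul_of_nonneg_left (isSubmodular_condAvg hf _ x y) hN'.le
    have e1 := abs_le.mp (hest (x ⊔ y))
    have e2 := abs_le.mp (hest (x ⊓ y))
    have e3 := abs_le.mp (hest x)
    have e4 := abs_le.mp (hest y)
    simp only [hout]
    rw [← add_div, ← add_div]
    gcongr ?_ / _
    have h5 : (d (x ⊔ y) : ℝ) = d x + d y - d (x ⊓ y) := by linarith
    have h6 : (d x * d x + d y * d y + 2 : ℝ) ≤
        d (x ⊔ y) * d (x ⊔ y) + d (x ⊓ y) * d (x ⊓ y) := by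
      rw [h5]
      nlinarith
    linarith
  · have h0 : 0 ≤ e x := estimate_nonneg hf1 _
    have h1 := (condAvg_mem_Icc hf1 (univ.map v) x).2
    have h2 := abs_le.mp (hest x)
    have h3 : (d x : ℝ) ≤ K := by exact_mod_cast hdK x
    have h4 : (0 : ℝ) ≤ d x := Nat.cast_nonneg _
    have h5 : N * g x ≤ N := by
      rw [hgdef]; nlinarith
    rw [hout]
    constructor
    · refine div_nonneg ?_ hden.le
      nlinarith
    · rw [div_le_one hden]
      push_cast
      nlinarith

/-- The repair changes the values by at most `4 K² / N`. -/
theorem abs_outTable_sub_condAvg_le (hf1 : ∀ x, f x ∈ Set.Icc (0 : ℝ) 1)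
    (hv : ∀ j : Fin k, V j = v j) (hM : 0 < M) (hN : 0 < N) {K : ℕ} (hK : 0 < K)
    (hg : GoodCond f m M N (univ.map v) ω) (x : Cube n) :
    |outTable f ω m M K k N V (maskOf k V x) - condAvg (univ.map v) f x| ≤ 4 * (K * K) / N := by
  have hN' : (0 : ℝ) < N := by exact_mod_cast hN
  have hK' : (1 : ℝ) ≤ K := by exact_mod_cast hK
  obtain ⟨g0, g1⟩ := condAvg_mem_Icc hf1 (univ.map v) x
  have hest := abs_estimate_sub_condAvg_le hv hM hg x
  set g := condAvg (univ.map v) f x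
  unfold outTable repaired
  set e := estimate f ω m M k V (maskOf k V x)
  rw [sum_digits_maskOf hv]
  set d := (univ.filter fun j => x (v j) = true).card
  have hsub : ((K * K - d * d : ℕ) : ℝ) ≤ K * K := by
    have := Nat.sub_le (K * K) (d * d)
    exact_mod_cast this
  have hsub0 : (0 : ℝ) ≤ ((K * K - d * d : ℕ) : ℝ) := Nat.cast_nonneg _
  have hNe : |N * e - N * g| ≤ 1 := by
    rw [← mul_sub, abs_mul, abs_of_pos hN']
    calc (N : ℝ) * |e - g| ≤ N * (1 / N) := by gcongr
      _ = 1 := by field_simp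
  obtain ⟨h1, h2⟩ := abs_le.mp hNe
  have hden : (0 : ℝ) < (N + 1 + 2 * (K * K) : ℕ) := by positivity
  rw [div_sub' hden.ne', abs_div, abs_of_pos hden]
  have hnum : |N * e + (2 * (K * K - d * d) : ℕ) - (N + 1 + 2 * (K * K) : ℕ) * g| ≤
      4 * (K * K) := by
    push_cast
    rw [abs_le]
    constructor <;> nlinarith
  refine div_le_div₀ (by positivity) hnum hN' ?_
  push_cast
  nlinarith

end Estimate

end RealRAM

namespace RealRAM

open Finset CubeFn

variable {n : ℕ} {f : Cube n → ℝ} {ω : ℕ → Cube n} {l Λ : ℕ}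

/-! ### The relevant coordinates -/

/-- The set of the relevant coordinates. -/
noncomputable def relevantSet (f : Cube n → ℝ) (ω : ℕ → Cube n) (l Λ : ℕ) : Finset (Fin n) :=
  univ.filter fun i => (i : ℕ) ∈ relevant f ω l Λ

theorem mem_relevantSet {i : Fin n} : i ∈ relevantSet f ω l Λ ↔ (i : ℕ) ∈ relevant f ω l Λ := by
  simp [relevantSet]

theorem exists_relevantEmb (f : Cube n → ℝ) (ω : ℕ → Cube n) (l Λ : ℕ) :
    ∃ e : Fin (relevant f ω l Λ).length ↪ Fin n,
      (∀ a, (e a : ℕ) = (relevant f ω l Λ)[a]) ∧ univ.map e = relevantSet f ω l Λ := by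
  refine ⟨⟨fun a => ⟨(relevant f ω l Λ)[a], lt_of_mem_relevant (List.getElem_mem _)⟩,
    fun a b h => ?_⟩, fun a => rfl, ?_⟩
  · exact Fin.ext ((nodup_relevant l Λ).getElem_inj_iff.mp (congrArg Fin.val h))
  · ext i
    simp only [mem_map, mem_univ, true_and, mem_relevantSet]
    constructor
    · rintro ⟨a, rfl⟩
      exact List.getElem_mem _
    · intro h
      obtain ⟨a, ha, hi⟩ := List.getElem_of_mem h
      exact ⟨⟨a, ha⟩, Fin.ext hi⟩

theorem card_relevantSet : (relevantSet f ω l Λ).card = (relevant f ω l Λ).length := by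
  obtain ⟨e, -, he⟩ := exists_relevantEmb f ω l Λ
  rw [← he, card_map, card_univ, Fintype.card_fin]

/-- The relevant coordinates are determined by the first block of examples. -/
theorem relevantSet_congr {ω' : ℕ → Cube n} (h : ∀ t < numCoef l Λ, ω t = ω' t) :
    relevantSet f ω l Λ = relevantSet f ω' l Λ := by
  have : (fun i j => ∑ t ∈ range (numCoef l Λ), f (ω t) * chi (ω t) i * chi (ω t) j) =
      fun i j => ∑ t ∈ range (numCoef l Λ), f (ω' t) * chi (ω' t) i * chi (ω' t) j := by
    funext i j
    exact sum_congr rfl fun t ht => by rw [h t (mem_range.mp ht)]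
  unfold relevantSet relevant
  rw [this]

/-- A candidate with increasing digits is a set of relevant coordinates. -/
theorem exists_emb_of_valid {k c : ℕ} (hk : k ≤ (relevant f ω l Λ).length)
    (hc : Valid (relevant f ω l Λ).length k c) :
    ∃ v : Fin k ↪ Fin n, (∀ j : Fin k, cand (relevant f ω l Λ) c j = v j) ∧
      univ.map v ⊆ relevantSet f ω l Λ := by
  obtain ⟨e, he, heR⟩ := exists_relevantEmb f ω l Λ
  have hlt : ∀ j : Fin k, c / (relevant f ω l Λ).length ^ (j : ℕ) % (relevant f ω l Λ).length <
      (relevant f ω l Λ).length := fun j => Nat.mod_lt _ (by have := j.2; omega)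
  refine ⟨⟨fun j => e ⟨_, hlt j⟩, fun i j hij => ?_⟩, fun j => ?_, ?_⟩
  · have h := congrArg Fin.val (e.injective hij)
    simp only at h
    rcases lt_trichotomy (i : ℕ) j with h' | h' | h'
    · exact absurd h (hc i i.2 j j.2 h').ne
    · exact Fin.ext h'
    · exact absurd h (hc j j.2 i i.2 h').ne'
  · rw [cand, List.getD_eq_getElem _ _ (hlt j)]
    exact (he ⟨_, hlt j⟩).symm
  · rw [← heR]
    intro i hi
    obtain ⟨j, -, rfl⟩ := mem_map.mp hi
    exact mem_map_of_mem e (mem_univ _)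

/-- Every set of relevant coordinates is a candidate. -/
theorem exists_valid_of_subset {k : ℕ} {J : Finset (Fin n)} (hJ : J ⊆ relevantSet f ω l Λ)
    (hk : J.card = k) :
    ∃ c < (relevant f ω l Λ).length ^ k, Valid (relevant f ω l Λ).length k c ∧
      ∃ v : Fin k ↪ Fin n, (∀ j : Fin k, cand (relevant f ω l Λ) c j = v j) ∧ univ.map v = J := by
  obtain ⟨e, he, heR⟩ := exists_relevantEmb f ω l Λ
  rw [← heR, subset_map_iff] at hJ
  obtain ⟨I, -, rfl⟩ := hJ
  rw [card_map] at hk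
  obtain ⟨c, hc, hd⟩ := exists_digits (I.orderEmbOfFin hk)
  refine ⟨c, hc, fun i hi j hj hij => ?_, (I.orderEmbOfFin hk).toEmbedding.trans e, fun j => ?_, ?_⟩
  · have h1 := hd ⟨i, hi⟩
    have h2 := hd ⟨j, hj⟩
    simp only at h1 h2
    rw [h1, h2]
    exact (I.orderEmbOfFin hk).strictMono hij
  · simp only [Function.Embedding.trans_apply, RelEmbedding.coe_toEmbedding, he, cand, hd j]
    rw [List.getD_eq_getElem _ _ (Fin.is_lt _)]
    rfl
  · rw [← map_map]
    congr 1
    exact map_orderEmbOfFin_univ I hk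

/-- If the coefficients are estimated accurately, then at most `8 Q²` coordinates pass the test, so
that none of them is lost, and the others have coefficients of size at most `1 / Q`. -/
theorem abs_coef_le_of_notMem (hf1 : ∀ x, f x ∈ Set.Icc (0 : ℝ) 1) (hl : 0 < l)
    (hg : GoodCoef f (numCoef l Λ) (invThr (2 ^ l) l) ω) {i : Fin n}
    (hi : i ∉ relevantSet f ω l Λ) {j : ℕ} (hj : j ≤ n) (hji : j ≠ i) :
    |coef f i j| ≤ 1 / (invThr (2 ^ l) l : ℕ) := by
  classical
  set Q := invThr (2 ^ l) l with hQ
  set m := numCoef l Λ with hm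
  have hQ0 : 0 < Q := by rw [hQ]; unfold invThr juntaSize; positivity
  have hm0 : 0 < m := by rw [hm]; unfold numCoef; rw [← hQ]; positivity
  have hQ' : (0 : ℝ) < Q := by exact_mod_cast hQ0
  have hm' : (0 : ℝ) < m := by exact_mod_cast hm0
  set A : ℕ → ℕ → ℝ := fun i j => ∑ t ∈ range m, f (ω t) * chi (ω t) i * chi (ω t) j with hA
  have hest : ∀ i < n, ∀ j < n + 1, |A i j - m * coef f i j| < m * (1 / (4 * Q)) := hg
  have htest : ∀ i j, (9 * (m * m) : ℝ) ≤ 16 * (Q * Q) * (A i j * A i j) ↔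
      3 * m ≤ 4 * Q * |A i j| := by
    intro i j
    rw [← abs_mul_abs_self (A i j)]
    have h1 : (9 * (m * m) : ℝ) = (3 * m) ^ 2 := by ring
    have h2 : 16 * (Q * Q) * (|A i j| * |A i j|) = (4 * Q * |A i j|) ^ 2 := by ring
    rw [h1, h2]
    exact pow_le_pow_iff_left₀ (by positivity) (by positivity) two_ne_zero
  set F := (List.range n).filter fun i => decide (Relevant A n m Q i) with hF
  set R : Finset (Fin n) := univ.filter fun i : Fin n => Relevant A n m Q i with hR
  have hFR : F.length = R.card := by
    have hnd : F.Nodup := List.nodup_range.filter _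
    rw [← List.toFinset_card_of_nodup hnd, ← card_map Fin.valEmbedding]
    congr 1
    ext a
    simp only [hF, hR, List.mem_toFinset, List.mem_filter, List.mem_range, decide_eq_true_eq,
      mem_map, mem_filter, mem_univ, true_and, Fin.valEmbedding_apply]
    constructor
    · rintro ⟨h1, h2⟩
      exact ⟨⟨a, h1⟩, h2, rfl⟩
    · rintro ⟨b, h1, rfl⟩
      exact ⟨b.2, h1⟩
  -- a coordinate that passes the test has a coefficient of size at least `1 / (2 Q)`
  have hRc : (R.card : ℝ) * (1 / (2 * Q)) ^ 2 ≤ 2 := by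
    refine card_mul_sq_le_two hf1 (by positivity) R fun a ha => ?_
    obtain ⟨b, hb, hba, h⟩ := (mem_filter.mp ha).2
    refine ⟨b, Nat.le_of_lt_succ hb, hba, ?_⟩
    rw [htest] at h
    have h1 := hest a a.2 b hb
    have h2 := abs_sub_abs_le_abs_sub (A a b) (m * coef f a b)
    rw [abs_mul, Nat.abs_cast] at h2
    have h3 : 3 * m / (4 * Q) ≤ |A a b| := by rw [div_le_iff₀ (by positivity)]; linarith
    have h4 : (3 * m / (4 * Q) : ℝ) = m * (1 / (2 * Q)) + m * (1 / (4 * Q)) := by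
      field_simp; norm_num
    refine le_of_mul_le_mul_left ?_ hm'
    linarith
  -- hence the truncation to the first `numRel l` entries has no effect
  have hcap : F.length ≤ numRel l := by
    rw [hFR]
    have h1 : (R.card : ℝ) ≤ 8 * (Q * Q) := by
      have h2 : (R.card : ℝ) * (1 / (2 * Q)) ^ 2 = R.card / (4 * (Q * Q)) := by
        field_simp; norm_num
      rw [h2, div_le_iff₀ (by positivity)] at hRc
      linarith
    unfold numRel
    rw [← hQ]
    exact_mod_cast h1
  have hrel : ¬ Relevant A n m Q i := by
    intro h
    refine hi (mem_relevantSet.mpr ?_)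
    have : relevant f ω l Λ = F := by
      unfold relevant relevantList
      rw [List.take_of_length_le]
      exact hcap
    rw [this, hF, List.mem_filter, List.mem_range]
    exact ⟨i.2, by simpa using h⟩
  have h1 : ¬ (9 * (m * m) : ℝ) ≤ 16 * (Q * Q) * (A i j * A i j) := fun h =>
    hrel ⟨j, by omega, hji, h⟩
  rw [htest, not_le] at h1
  have h2 := hest i i.2 j (by omega)
  have h3 := abs_sub_abs_le_abs_sub (m * coef f i j) (A i j)
  rw [abs_sub_comm (m * coef f i j), abs_mul, Nat.abs_cast] at h3
  have h4 : |A i j| ≤ 3 * m / (4 * Q) := by rw [le_div_iff₀ (by positivity)]; linarith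
  have h5 : (m * (1 / Q) : ℝ) = 3 * m / (4 * Q) + m * (1 / (4 * Q)) := by
    field_simp; norm_num
  refine le_of_mul_le_mul_left ?_ hm'
  linarith

/-! ### Correctness -/

/-- The samples for which all estimates are accurate. -/
def Good (f : Cube n → ℝ) (l Λ : ℕ) (ω : ℕ → Cube n) : Prop :=
  GoodCoef f (numCoef l Λ) (invThr (2 ^ l) l) ω ∧
    ∀ J ∈ powersetCard (min (juntaSize (2 ^ l) l) (relevantSet f ω l Λ).card)
      (relevantSet f ω l Λ),
      GoodCond f (numCoef l Λ) (numCond l) (3 * invThr (2 ^ l) l) J ω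

theorem measureReal_good (hf1 : ∀ x, f x ∈ Set.Icc (0 : ℝ) 1) (hl : 0 < l) (hΛ : n ≤ 2 ^ Λ) :
    2 / 3 ≤ (exampleLaw n).real {ω | Good f l Λ ω} := by
  have hQ0 : 0 < invThr (2 ^ l) l := by unfold invThr juntaSize; positivity
  refine measureReal_good_ge hf1 hQ0 hΛ rfl (by positivity) rfl
    (by unfold numRel; positivity) (fun ω => relevantSet f ω l Λ)
    (fun ω ω' h => relevantSet_congr h) fun ω => ?_
  rw [card_relevantSet]
  exact length_relevant_le l Λ

theorem numCond_pos (hl : 0 < l) : 0 < numCond l := by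
  unfold numCond invThr juntaSize; positivity

/-- For a good sample, the table of the best candidate passes the check and is close to `f`: some
candidate has error at most `1 / (2 K)`, and the choice and the repair lose at most `1 / (6 K)`. -/
theorem good_outTable (hf : IsSubmodular f) (hf1 : ∀ x, f x ∈ Set.Icc (0 : ℝ) 1) (hl : 2 ≤ l)
    (hg : Good f l Λ ω) {k c : ℕ}
    (hk : k = min (juntaSize (2 ^ l) l) (relevant f ω l Λ).length)
    (hc : Valid (relevant f ω l Λ).length k c)
    (hmin : ∀ c' < (relevant f ω l Λ).length ^ k, Valid (relevant f ω l Λ).length k c' →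
      estError f ω (numCoef l Λ) (numCond l) k (cand (relevant f ω l Λ) c) ≤
        estError f ω (numCoef l Λ) (numCond l) k (cand (relevant f ω l Λ) c')) :
    TableGood k (fun y j => y / 2 ^ j % 2) (outTable f ω (numCoef l Λ) (numCond l)
      (juntaSize (2 ^ l) l) k (3 * invThr (2 ^ l) l) (cand (relevant f ω l Λ) c)) ∧
    avg (fun x => |f x - outTable f ω (numCoef l Λ) (numCond l) (juntaSize (2 ^ l) l) k
      (3 * invThr (2 ^ l) l) (cand (relevant f ω l Λ) c)
      (maskOf k (cand (relevant f ω l Λ) c) x)|) ≤ 1 / 2 ^ l := by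
  obtain ⟨v, hv, hvR⟩ := exists_emb_of_valid (by omega) hc
  have hM := numCond_pos (l := l) (by omega)
  have hS0 : 0 < juntaSize (2 ^ l) l := by
    have : 0 < l := by omega
    unfold juntaSize; positivity
  have hN : 0 < 3 * invThr (2 ^ l) l := by unfold invThr; positivity
  have hkS : k ≤ juntaSize (2 ^ l) l := by omega
  have hcard : ∀ v : Fin k ↪ Fin n, univ.map v ⊆ relevantSet f ω l Λ →
      GoodCond f (numCoef l Λ) (numCond l) (3 * invThr (2 ^ l) l) (univ.map v) ω := by
    intro v hv
    refine hg.2 _ (mem_powersetCard.mpr ⟨hv, ?_⟩)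
    rw [card_map, card_univ, Fintype.card_fin, card_relevantSet, hk]
  have hgv := hcard v hvR
  refine ⟨tableGood_outTable hf hf1 hv hM hN hkS hgv, ?_⟩
  obtain ⟨J, hJR, hJc, hJ⟩ := exists_subset_approx hf hf1 hl rfl (relevantSet f ω l Λ)
    fun i hi j hj hji => abs_coef_le_of_notMem hf1 (by omega) hg.1 hi hj hji
  rw [card_relevantSet, ← hk] at hJc
  obtain ⟨c', hc', hvc', v', hv', rfl⟩ := exists_valid_of_subset hJR hJc
  have e1 := abs_le.mp (abs_estError_sub_le hv hM hgv)
  have e2 := abs_le.mp (abs_estError_sub_le hv' hM (hcard v' hJR))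
  have e3 := hmin c' hc' hvc'
  have hM' : (0 : ℝ) < numCond l := by exact_mod_cast hM
  have e4 : avg (fun x => |f x - condAvg (univ.map v) f x|) ≤
      avg (fun x => |f x - condAvg (univ.map v') f x|) + 4 / (3 * invThr (2 ^ l) l : ℕ) := by
    refine le_of_mul_le_mul_left ?_ hM'
    have : (numCond l : ℝ) * (4 / (3 * invThr (2 ^ l) l : ℕ)) =
        numCond l * (2 / (3 * invThr (2 ^ l) l : ℕ)) +
          numCond l * (2 / (3 * invThr (2 ^ l) l : ℕ)) := by ring
    rw [mul_add, this]
    linarith [e1.1, e2.2]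
  have e5 : avg (fun x => |f x - outTable f ω (numCoef l Λ) (numCond l) (juntaSize (2 ^ l) l) k
      (3 * invThr (2 ^ l) l) (cand (relevant f ω l Λ) c)
      (maskOf k (cand (relevant f ω l Λ) c) x)|) ≤
      avg (fun x => |f x - condAvg (univ.map v) f x|) +
        4 * (juntaSize (2 ^ l) l * juntaSize (2 ^ l) l) / (3 * invThr (2 ^ l) l : ℕ) := by
    rw [← avg_const (n := n) (4 * (juntaSize (2 ^ l) l * juntaSize (2 ^ l) l) /
      (3 * invThr (2 ^ l) l : ℕ)), ← avg_add]
    refine avg_mono fun x => ?_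
    have := abs_outTable_sub_condAvg_le hf1 hv hM hN hS0 hgv x
    rw [abs_sub_comm] at this
    exact (abs_sub_le _ _ _).trans (add_le_add le_rfl this)
  have hS1 : (1 : ℝ) ≤ (juntaSize (2 ^ l) l : ℕ) := by exact_mod_cast hS0
  set S : ℝ := ((juntaSize (2 ^ l) l : ℕ) : ℝ) with hS
  have hN' : ((3 * invThr (2 ^ l) l : ℕ) : ℝ) = 48 * 2 ^ l * (S * S) := by
    unfold invThr; push_cast; ring
  rw [hN'] at e4 e5
  have hl0 : (0 : ℝ) < 2 ^ l := by positivity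
  have e6 : 4 * (S * S) / (48 * 2 ^ l * (S * S)) = 1 / (12 * 2 ^ l) := by field_simp; norm_num
  have e7 : 4 / (48 * 2 ^ l * (S * S)) ≤ 1 / (12 * 2 ^ l) := by
    rw [div_le_div_iff₀ (by positivity) (by positivity)]
    have : 1 ≤ S * S := by nlinarith
    nlinarith
  have e8 : (1 / (2 * 2 ^ l) + 1 / (12 * 2 ^ l) + 1 / (12 * 2 ^ l) : ℝ) ≤ 1 / 2 ^ l := by
    rw [show (1 / (2 * 2 ^ l) + 1 / (12 * 2 ^ l) + 1 / (12 * 2 ^ l) : ℝ) = (2 / 3) * (1 / 2 ^ l) by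
      field_simp; norm_num]
    have : (0 : ℝ) < 1 / 2 ^ l := by positivity
    linarith
  push_cast at hJ
  linarith

/-- The outputs of the program for accuracy below `1 / 2`. -/
theorem exists_outputs {ε : ℝ} (hf : IsSubmodular f) (hf1 : ∀ x, f x ∈ Set.Icc (0 : ℝ) 1)
    (hε : ε < 1 / 2) (hl2 : 2 ≤ l) (hl : ∀ i < l, 2 ^ i * ε < 1) (hl' : 1 ≤ 2 ^ l * ε)
    (hΛ : ∀ i < Λ, 2 ^ i < n) (hΛ' : n ≤ 2 ^ Λ) (ω : ℕ → Cube n) :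
    ∃ (J : Finset (Fin n)) (h : Cube n → ℝ) (s : State) (T L k : ℕ),
      Exec f ω mainProg (State.init n ε) s T ∧ s.Outputs J h ∧
      L ≤ numRel l ∧ k ≤ juntaSize (2 ^ l) l ∧ T ≤ mainCost n l Λ L k ∧
      s.drawn = numCoef l Λ + numCond l + numCond l ∧ J.card = k ∧
      DependsOn h (J : Set (Fin n)) ∧ IsSubmodular h ∧ (∀ x, h x ∈ Set.Icc (0 : ℝ) 1) ∧
      (Good f l Λ ω → l1Dist f h ≤ ε) := by
  set ℓ := relevant f ω l Λ with hℓ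
  obtain ⟨s, T, hexec, hT, hd, h0, c, hc, hv, hmin, hlist, htab⟩ :=
    reach_mainProg_small hε hl hl' hΛ hΛ' hℓ (k := min (juntaSize (2 ^ l) l) ℓ.length) rfl rfl
  set k := min (juntaSize (2 ^ l) l) ℓ.length with hk
  obtain ⟨v, hcv, hvR⟩ := exists_emb_of_valid (hk.le.trans (min_le_right _ _)) hv
  set H := outTable f ω (numCoef l Λ) (numCond l) (juntaSize (2 ^ l) l) k
      (3 * invThr (2 ^ l) l) (cand ℓ c) with hH
  have hgood : IsSubmodular (fun x : Cube n => s.rarr 0 (maskOf k (cand ℓ c) x)) ∧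
      ∀ x : Cube n, s.rarr 0 (maskOf k (cand ℓ c) x) ∈ Set.Icc (0 : ℝ) 1 := by
    rcases htab with ⟨hg, hr⟩ | ⟨-, hr⟩
    · have := (tableGood_iff (n := n) hcv H).mp hg
      have e : ∀ x : Cube n, s.rarr 0 (maskOf k (cand ℓ c) x) = H (maskOf k (cand ℓ c) x) :=
        fun x => hr _ (maskOf_lt _ _ _)
      simpa only [e] using this
    · have e : ∀ x : Cube n, s.rarr 0 (maskOf k (cand ℓ c) x) = 0 :=
        fun x => hr _ (maskOf_lt _ _ _)
      simp only [e]
      exact ⟨fun x y => le_rfl, fun x => by simp⟩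
  refine ⟨univ.map v, fun x => s.rarr 0 (maskOf k (cand ℓ c) x), s, T, ℓ.length, k, hexec,
    ⟨k, v, h0, rfl, fun j => ?_, fun x => ?_⟩, length_relevant_le l Λ, min_le_left _ _, hT, hd,
    ?_, ?_, hgood.1, hgood.2, fun hg => ?_⟩
  · rw [hlist j j.2, hcv j]
  · exact congrArg (s.rarr 0) (maskOf_eq_sum_ite hcv x)
  · rw [card_map, card_univ, Fintype.card_fin]
  · intro x y hxy
    have : maskOf k (cand ℓ c) x = maskOf k (cand ℓ c) y := (maskOf_eq_iff hcv x y).mpr fun j =>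
      hxy _ (by simp)
    simp only [this]
  · obtain ⟨h1, h2⟩ := good_outTable hf hf1 hl2 hg hk hv hmin
    rcases htab with ⟨-, hr⟩ | ⟨hn, -⟩
    · rw [l1Dist_eq_avg]
      have e : ∀ x : Cube n, s.rarr 0 (maskOf k (cand ℓ c) x) = H (maskOf k (cand ℓ c) x) :=
        fun x => hr _ (maskOf_lt _ _ _)
      simp only [e]
      refine h2.trans ?_
      rw [div_le_iff₀ (by positivity)]
      linarith
    · exact absurd h1 hn

end RealRAM

namespace RealRAM

open Finset CubeFn

/-! ### Bounds for the resources -/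

/-- A common bound for the quantities that do not depend on the dimension; the exponent is
`2 * juntaSize` times `49 * l`, where `2 ^ (49 * l)` bounds the number of relevant coordinates. -/
def sizeBound (l : ℕ) : ℕ := 2 ^ (1003520 * (2 ^ l * 2 ^ l) * (l * l))

theorem juntaSize_le (l : ℕ) : juntaSize (2 ^ l) l ≤ 2 ^ (14 + 3 * l) := by
  have h : l ≤ 2 ^ l := Nat.lt_two_pow_self.le
  calc juntaSize (2 ^ l) l ≤ 2 ^ 14 * (2 ^ l * 2 ^ l) * 2 ^ l := by
        unfold juntaSize
        gcongr
        norm_num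
    _ = 2 ^ (14 + 3 * l) := by rw [← pow_add, ← pow_add, ← pow_add]; congr 1; ring

theorem sixtyFour_mul_invThr_sq_le {l : ℕ} (hl : 2 ≤ l) :
    64 * (invThr (2 ^ l) l * invThr (2 ^ l) l) ≤ 2 ^ (49 * l) := by
  have h : invThr (2 ^ l) l ≤ 2 ^ (32 + 7 * l) := by
    calc invThr (2 ^ l) l ≤ 2 ^ 4 * 2 ^ l * (2 ^ (14 + 3 * l) * 2 ^ (14 + 3 * l)) := by
          unfold invThr
          gcongr
          · norm_num
          · exact juntaSize_le l
          · exact juntaSize_le l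
      _ = 2 ^ (32 + 7 * l) := by simp only [← pow_add]; congr 1; ring
  calc 64 * (invThr (2 ^ l) l * invThr (2 ^ l) l)
      ≤ 2 ^ 6 * (2 ^ (32 + 7 * l) * 2 ^ (32 + 7 * l)) := by
        gcongr
        norm_num
    _ = 2 ^ (70 + 14 * l) := by simp only [← pow_add]; congr 1; ring
    _ ≤ 2 ^ (49 * l) := Nat.pow_le_pow_right (by norm_num) (by omega)

theorem pow_invThr_le_sizeBound {l : ℕ} (hl : 2 ≤ l) :
    (64 * (invThr (2 ^ l) l * invThr (2 ^ l) l)) ^ (juntaSize (2 ^ l) l + 3) ≤ sizeBound l := by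
  calc (64 * (invThr (2 ^ l) l * invThr (2 ^ l) l)) ^ (juntaSize (2 ^ l) l + 3)
      ≤ (2 ^ (49 * l)) ^ (juntaSize (2 ^ l) l + 3) :=
        Nat.pow_le_pow_left (sixtyFour_mul_invThr_sq_le hl) _
    _ ≤ (2 ^ (49 * l)) ^ (2 * juntaSize (2 ^ l) l) := by
        refine Nat.pow_le_pow_right (by positivity) ?_
        have : 3 ≤ juntaSize (2 ^ l) l := by
          unfold juntaSize
          have : 1 ≤ 2 ^ l * 2 ^ l := Nat.mul_pos (by positivity) (by positivity)
          nlinarith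
        omega
    _ = sizeBound l := by
        rw [sizeBound, ← pow_mul]; congr 1; unfold juntaSize; ring

section Sizes

variable {l : ℕ}

theorem invThr_pos (hl : 0 < l) : 0 < invThr (2 ^ l) l := by
  unfold invThr juntaSize; positivity

theorem juntaSize_le_invThr (hl : 0 < l) : juntaSize (2 ^ l) l ≤ invThr (2 ^ l) l := by
  have h1 : 1 ≤ juntaSize (2 ^ l) l := by
    have : 0 < juntaSize (2 ^ l) l := by unfold juntaSize; positivity
    omega
  have h2 : 1 ≤ 16 * 2 ^ l := by have := Nat.one_le_two_pow (n := l); omega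
  unfold invThr
  calc juntaSize (2 ^ l) l = 1 * (1 * juntaSize (2 ^ l) l) := by ring
    _ ≤ 16 * 2 ^ l * (juntaSize (2 ^ l) l * juntaSize (2 ^ l) l) := by gcongr

theorem numCond_le_sizeBound (hl : 2 ≤ l) : numCond l ≤ sizeBound l := by
  refine le_trans ?_ (pow_invThr_le_sizeBound hl)
  have hQ := invThr_pos (l := l) (by omega)
  have hSQ := juntaSize_le_invThr (l := l) (by omega)
  unfold numCond numRel
  set Q := invThr (2 ^ l) l
  set S := juntaSize (2 ^ l) l
  have hSQ2 : S ≤ Q * Q := hSQ.trans (Nat.le_mul_of_pos_left _ hQ)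
  have h1 : 1 ≤ Q * Q := Nat.mul_pos hQ hQ
  have h2 : 1 ≤ (Q * Q) * (Q * Q) := Nat.mul_pos h1 h1
  have h3 : S ≤ (Q * Q) * (Q * Q) := hSQ2.trans (Nat.le_mul_of_pos_left _ h1)
  have h4 : S * (8 * (Q * Q)) ≤ 8 * ((Q * Q) * (Q * Q)) := by nlinarith
  calc 2 * 4 ^ S * (3 * Q * (3 * Q)) * (4 + S + S * (8 * (Q * Q)))
      ≤ 2 * 4 ^ S * (3 * Q * (3 * Q)) * (13 * ((Q * Q) * (Q * Q))) := by gcongr; omega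
    _ = 4 ^ S * (234 * (Q * Q) ^ 3) := by ring
    _ ≤ (64 * (Q * Q)) ^ S * (64 * (Q * Q)) ^ 3 := by
        rw [mul_pow 64 (Q * Q) 3]
        gcongr
        · omega
        · norm_num
    _ = (64 * (Q * Q)) ^ (S + 3) := (pow_add _ _ _).symm

theorem pow_le_sizeBound (hl : 2 ≤ l) {b k : ℕ}
    (hb : b ≤ 64 * (invThr (2 ^ l) l * invThr (2 ^ l) l)) (hk : k ≤ juntaSize (2 ^ l) l) :
    b ^ k ≤ sizeBound l := by
  refine le_trans ?_ (pow_invThr_le_sizeBound hl)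
  have hQ := invThr_pos (l := l) (by omega)
  exact (Nat.pow_le_pow_left hb k).trans (Nat.pow_le_pow_right (by positivity) (by omega))

theorem invThr_sq_le_sizeBound (hl : 2 ≤ l) :
    64 * (invThr (2 ^ l) l * invThr (2 ^ l) l) ≤ sizeBound l := by
  have h := pow_le_sizeBound hl (k := 1) le_rfl (by
    have : 0 < l := by omega
    have : 0 < juntaSize (2 ^ l) l := by unfold juntaSize; positivity
    omega)
  rwa [pow_one] at h

theorem two_pow_fourteen_le_sizeBound (hl : 2 ≤ l) : 2 ^ 14 ≤ sizeBound l := by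
  refine Nat.pow_le_pow_right (by norm_num) ?_
  have h1 : 1 ≤ 2 ^ l * 2 ^ l := Nat.mul_pos (by positivity) (by positivity)
  have h2 : 1 ≤ l * l := Nat.mul_pos (by omega) (by omega)
  nlinarith [Nat.mul_le_mul h1 h2]

end Sizes

section Cost

variable {n X k M W P : ℕ}

theorem pow_le_pow_six (hX : 1 ≤ X) : 1 ≤ X ^ 6 ∧ X ≤ X ^ 6 ∧ X ^ 2 ≤ X ^ 6 ∧ X ^ 3 ≤ X ^ 6 :=
  ⟨Nat.one_le_pow _ _ hX, Nat.le_self_pow (by norm_num) X,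
    Nat.pow_le_pow_right hX (by norm_num), Nat.pow_le_pow_right hX (by norm_num)⟩

theorem digitCost_le (hX : 1 ≤ X) (hk : k ≤ X) (hW : W ≤ X) :
    W * ((2 + (k * ((W * 12 + 15) + 9) + 7)) + 9) + 7 ≤ 100 * X ^ 6 := by
  obtain ⟨d0, d1, d2, d3⟩ := pow_le_pow_six hX
  calc W * ((2 + (k * ((W * 12 + 15) + 9) + 7)) + 9) + 7
      ≤ X * ((2 + (X * ((X * 12 + 15) + 9) + 7)) + 9) + 7 := by gcongr
    _ ≤ 100 * X ^ 6 := by linarith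

theorem sumCost_le (hX : 1 ≤ X) (hk : k ≤ X) (hW : W ≤ X) (hM : M ≤ X) {r : ℕ} (hr : r ≤ 40) :
    M * ((n + 1 + (W * (((2 + (2 + (k * (22 + 9) + 7))) + r) + 9) + 7)) + 9) + 7 ≤
      X * (n + 1) + 200 * X ^ 6 := by
  obtain ⟨d0, d1, d2, d3⟩ := pow_le_pow_six hX
  calc M * ((n + 1 + (W * (((2 + (2 + (k * (22 + 9) + 7))) + r) + 9) + 7)) + 9) + 7
      ≤ X * ((n + 1 + (X * (((2 + (2 + (X * (22 + 9) + 7))) + 40) + 9) + 7)) + 9) + 7 := by gcongr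
    _ ≤ X * (n + 1) + 200 * X ^ 6 := by linarith

theorem bestCost_le (hX : 1 ≤ X) (hk : k ≤ X) (hW : W ≤ X) :
    2 + (2 + (W * ((2 + ((k * ((k * 49 + 7) + 9) + 7) + 40)) + 9) + 7)) ≤ 200 * X ^ 6 := by
  obtain ⟨d0, d1, d2, d3⟩ := pow_le_pow_six hX
  calc 2 + (2 + (W * ((2 + ((k * ((k * 49 + 7) + 9) + 7) + 40)) + 9) + 7))
      ≤ 2 + (2 + (X * ((2 + ((X * ((X * 49 + 7) + 9) + 7) + 40)) + 9) + 7)) := by gcongr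
    _ ≤ 200 * X ^ 6 := by linarith

theorem tableCost_le (hX : 1 ≤ X) (hk : k ≤ X) (hP : P ≤ X) :
    P * ((2 + ((k * (10 + 9) + 7) + 50)) + 9) + 7 ≤ 200 * X ^ 6 := by
  obtain ⟨d0, d1, d2, d3⟩ := pow_le_pow_six hX
  calc P * ((2 + ((k * (10 + 9) + 7) + 50)) + 9) + 7
      ≤ X * ((2 + ((X * (10 + 9) + 7) + 50)) + 9) + 7 := by gcongr
    _ ≤ 200 * X ^ 6 := by linarith

theorem checkCost_le (hX : 1 ≤ X) (hk : k ≤ X) (hP : P ≤ X) :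
    2 + ((P * ((P * ((2 + (2 + (2 + ((k * (80 + 9) + 7) + 40)))) + 9) + 7) + 9) + 7) +
      (4 + (P * (4 + 9) + 7))) ≤ 300 * X ^ 6 := by
  obtain ⟨d0, d1, d2, d3⟩ := pow_le_pow_six hX
  calc 2 + ((P * ((P * ((2 + (2 + (2 + ((k * (80 + 9) + 7) + 40)))) + 9) + 7) + 9) + 7) +
        (4 + (P * (4 + 9) + 7)))
      ≤ 2 + ((X * ((X * ((2 + (2 + (2 + ((X * (80 + 9) + 7) + 40)))) + 9) + 7) + 9) + 7) +
        (4 + (X * (4 + 9) + 7))) := by gcongr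
    _ ≤ 300 * X ^ 6 := by linarith

/-- The cost of reading the later examples is shared between the two terms of the time bound. -/
theorem mul_succ_le (hX : 1 ≤ X) {m : ℕ} (hm : 1 ≤ m) :
    X * (n + 1) ≤ X ^ 6 + m * ((n + 1) * (n + 1)) := by
  have h1 : X * (n + 1) ≤ X ^ 2 + (n + 1) * (n + 1) := by
    rcases le_total X (n + 1) with h | h <;> nlinarith
  have h2 : X ^ 2 ≤ X ^ 6 := Nat.pow_le_pow_right hX (by norm_num)
  have h3 : 1 * ((n + 1) * (n + 1)) ≤ m * ((n + 1) * (n + 1)) := by gcongr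
  omega

theorem coefCost_le (m : ℕ) : m * (n + 1 + (n * ((n + 1) * 59 + 16) + 7) + 9) ≤
    100 * (m * ((n + 1) * (n + 1))) := by
  rw [mul_left_comm]
  gcongr
  nlinarith

theorem selectCost_le {m : ℕ} (hm : 160 ≤ m) :
    2 + (n * ((2 + ((n + 1) * 59 + 7 + 30)) + 9) + 7) ≤ m * ((n + 1) * (n + 1)) := by
  have : 160 * ((n + 1) * (n + 1)) ≤ m * ((n + 1) * (n + 1)) := by gcongr
  nlinarith

end Cost

/-- The cost splits into a part of order `m n²` for the coefficients and a part that does not depend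
on the dimension. -/
theorem mainCost_le {n l Λ L k : ℕ} (hl : 2 ≤ l) (hL : L ≤ numRel l)
    (hk : k ≤ juntaSize (2 ^ l) l) :
    mainCost n l Λ L k ≤
      3000 * (numCoef l Λ * ((n + 1) * (n + 1))) + 3000 * sizeBound l ^ 6 := by
  have hQ := invThr_pos (l := l) (by omega)
  have hW : L ^ k ≤ sizeBound l := pow_le_sizeBound hl (hL.trans (by unfold numRel; omega)) hk
  have hP : 2 ^ k ≤ sizeBound l := pow_le_sizeBound hl (by
    have : 1 ≤ invThr (2 ^ l) l * invThr (2 ^ l) l := Nat.mul_pos hQ hQ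
    omega) hk
  have hM := numCond_le_sizeBound hl
  have hQX := invThr_sq_le_sizeBound hl
  have hSX : juntaSize (2 ^ l) l ≤ sizeBound l := by
    have h1 := juntaSize_le_invThr (l := l) (by omega)
    have h2 : invThr (2 ^ l) l ≤ invThr (2 ^ l) l * invThr (2 ^ l) l := Nat.le_mul_of_pos_left _ hQ
    omega
  have hlX : l ≤ sizeBound l := by
    refine le_trans ?_ hSX
    unfold juntaSize
    exact Nat.le_mul_of_pos_left _ (by positivity)
  have hX1 : 1 ≤ sizeBound l := Nat.one_le_two_pow
  have hm : 160 * (Λ + 1) ≤ numCoef l Λ := by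
    unfold numCoef
    have : 1 ≤ invThr (2 ^ l) l * invThr (2 ^ l) l := Nat.mul_pos hQ hQ
    nlinarith
  have hkX : k ≤ sizeBound l := hk.trans hSX
  unfold mainCost
  generalize sizeBound l = X at *
  generalize numCoef l Λ = m at *
  generalize numCond l = M at *
  generalize juntaSize (2 ^ l) l = S at *
  generalize L ^ k = W at *
  generalize 2 ^ k = P at *
  have c1 := coefCost_le (n := n) m
  have c2 := selectCost_le (n := n) (m := m) (by omega)
  have c3 : 13 * Λ ≤ m * ((n + 1) * (n + 1)) := by
    have : m * 1 ≤ m * ((n + 1) * (n + 1)) := by gcongr; nlinarith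
    omega
  have c4 := mul_succ_le (n := n) hX1 (m := m) (by omega)
  obtain ⟨d0, d1, -, -⟩ := pow_le_pow_six hX1
  have e1 := digitCost_le hX1 hkX hW
  have e2 := digitCost_le hX1 hkX hP
  have e3 := sumCost_le (n := n) hX1 hkX hW hM (r := 30) (by norm_num)
  have e4 := sumCost_le (n := n) hX1 hkX hW hM (r := 40) (by norm_num)
  have e5 := bestCost_le hX1 hkX hW
  have e6 := tableCost_le hX1 hkX hP
  have e7 := checkCost_le hX1 hkX hP
  linarith

/-! ### The bounds in terms of the accuracy -/

theorem one_le_log_three_add {g : ℝ} (hg : 0 ≤ g) : 1 ≤ Real.log (3 + g) := by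
  rw [Real.le_log_iff_exp_le (by linarith)]
  have := Real.exp_one_lt_d9
  linarith

theorem le_two_mul_log {a : ℕ} {y : ℝ} (h : (2 : ℝ) ^ a ≤ y) : (a : ℝ) ≤ 2 * Real.log y := by
  have h1 := Real.log_le_log (by positivity) h
  rw [Real.log_pow] at h1
  have := Real.log_two_gt_d9
  have h2 : (0 : ℝ) ≤ a := Nat.cast_nonneg a
  nlinarith

/-- A constant that is large enough for all bounds of the theorem. -/
def bigConst : ℝ := 10 ^ 40

section Accuracy

variable {ε : ℝ} {l : ℕ}

theorem two_pow_le_div (hε : 0 < ε) (hl0 : 0 < l) (hl : ∀ i < l, 2 ^ i * ε < 1) :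
    (2 : ℝ) ^ l ≤ 2 / ε := by
  have h := hl (l - 1) (by omega)
  rw [le_div_iff₀ hε]
  obtain ⟨i, rfl⟩ : ∃ i, l = i + 1 := ⟨l - 1, by omega⟩
  rw [Nat.add_sub_cancel] at h
  rw [pow_succ]
  linarith

theorem sizeBound_pow_le (hε : 0 < ε) (hε2 : ε < 1 / 2) (hl2 : 2 ≤ l)
    (hl : ∀ i < l, 2 ^ i * ε < 1) :
    ((sizeBound l ^ 7 : ℕ) : ℝ) ≤ 2 ^ softO bigConst 5 (1 / ε ^ 2) := by
  have hK := two_pow_le_div hε (by omega) hl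
  set g : ℝ := 1 / ε ^ 2 with hg
  have hg0 : 0 < g := by positivity
  have hlog := one_le_log_three_add hg0.le
  have hKg : (2 : ℝ) ^ l ≤ 3 + g := by
    refine hK.trans ?_
    have h1 : g = (1 / ε) ^ 2 := by rw [hg]; ring
    have h2 : 2 / ε = 2 * (1 / ε) := by ring
    rw [h1, h2]
    nlinarith [sq_nonneg (1 / ε - 1)]
  have hll := le_two_mul_log hKg
  set t := Real.log (3 + g)
  have e : ((sizeBound l ^ 7 : ℕ) : ℝ) =
      (2 : ℝ) ^ ((1003520 * (2 ^ l * 2 ^ l) * (l * l) * 7 : ℕ) : ℝ) := by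
    rw [sizeBound, ← pow_mul, Real.rpow_natCast]
    push_cast
    rfl
  rw [e]
  refine Real.rpow_le_rpow_of_exponent_le (by norm_num) ?_
  push_cast
  have h1 : (2 : ℝ) ^ l * 2 ^ l ≤ 4 * g := by
    calc (2 : ℝ) ^ l * 2 ^ l ≤ (2 / ε) * (2 / ε) := by gcongr
      _ = 4 * g := by rw [hg]; field_simp; norm_num
  have h2 : (l : ℝ) * l ≤ 4 * t ^ 2 := by
    calc (l : ℝ) * l ≤ (2 * t) * (2 * t) := by gcongr
      _ = 4 * t ^ 2 := by ring
  have h3 : t ^ 2 ≤ t ^ 5 := pow_le_pow_right₀ hlog (by norm_num)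
  unfold softO bigConst
  calc 1003520 * ((2 : ℝ) ^ l * 2 ^ l) * (l * l) * 7
      ≤ 1003520 * (4 * g) * (4 * t ^ 5) * 7 := by
        gcongr ?_ * ?_ * 7
        · gcongr
        · linarith
    _ = 112394240 * g * t ^ 5 := by ring
    _ ≤ 10 ^ 40 * g * t ^ 5 := by gcongr; norm_num

/-- The square of the inverse threshold is of order `ε⁻¹⁰` up to logarithms. -/
theorem invThr_sq_le (hε : 0 < ε) (hl0 : 0 < l) (hl : ∀ i < l, 2 ^ i * ε < 1) {t : ℝ}
    (ht : (l : ℝ) ≤ 2 * t) :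
    ((invThr (2 ^ l) l * invThr (2 ^ l) l : ℕ) : ℝ) ≤ 10 ^ 26 * (1 / ε ^ 10) * t ^ 4 := by
  have hK := two_pow_le_div hε hl0 hl
  have e : ((invThr (2 ^ l) l * invThr (2 ^ l) l : ℕ) : ℝ) =
      256 * 10240 ^ 4 * ((2 : ℝ) ^ l) ^ 10 * (l : ℝ) ^ 4 := by
    unfold invThr juntaSize; push_cast; ring
  rw [e]
  calc 256 * 10240 ^ 4 * ((2 : ℝ) ^ l) ^ 10 * (l : ℝ) ^ 4
      ≤ 256 * 10240 ^ 4 * (2 / ε) ^ 10 * (2 * t) ^ 4 := by gcongr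
    _ = (256 * 10240 ^ 4 * 2 ^ 14) * (1 / ε ^ 10) * t ^ 4 := by rw [div_pow]; ring
    _ ≤ 10 ^ 26 * (1 / ε ^ 10) * t ^ 4 := by
        have : (0 : ℝ) ≤ t ^ 4 := by positivity
        gcongr
        norm_num

/-- For `ε < 1 / 2` the exponent `l` is at most a multiple of `log (1 / ε)`, since `2 ^ l ≤ ε⁻²`. -/
theorem juntaSize_le_log (hε : 0 < ε) (hε2 : ε < 1 / 2) (hl0 : 0 < l)
    (hl : ∀ i < l, 2 ^ i * ε < 1) :
    (juntaSize (2 ^ l) l : ℝ) ≤ bigConst * (1 / ε ^ 2 * Real.log (1 / ε)) := by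
  have hK := two_pow_le_div hε hl0 hl
  have hKε : (2 : ℝ) ^ l ≤ (1 / ε) ^ 2 := by
    refine hK.trans ?_
    have h2 : (2 : ℝ) ≤ 1 / ε := by rw [le_div_iff₀ hε]; linarith
    have h3 : 2 / ε = 2 * (1 / ε) := by ring
    rw [h3]
    nlinarith
  have hll := le_two_mul_log hKε
  rw [Real.log_pow] at hll
  set t := Real.log (1 / ε)
  have ht : 0 ≤ t := by
    have : (0 : ℝ) ≤ l := Nat.cast_nonneg l
    push_cast at hll
    linarith
  unfold juntaSize bigConst
  push_cast at hll ⊢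
  calc 10240 * ((2 : ℝ) ^ l * 2 ^ l) * l ≤ 10240 * ((2 / ε) * (2 / ε)) * (2 * (2 * t)) := by gcongr
    _ = 163840 * (1 / ε ^ 2 * t) := by field_simp; ring
    _ ≤ 10 ^ 40 * (1 / ε ^ 2 * t) := by gcongr; norm_num

theorem numCoef_zero_le (hl : 2 ≤ l) : numCoef l 0 ≤ 3 * sizeBound l := by
  have := invThr_sq_le_sizeBound hl
  unfold numCoef
  omega

theorem two_pow_succ_le {n Λ : ℕ} (hn : 1 ≤ n) (hΛ : ∀ i < Λ, 2 ^ i < n) :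
    (2 : ℝ) ^ (Λ + 1) ≤ 4 * n := by
  have : 2 ^ (Λ + 1) ≤ 4 * n := by
    rcases Nat.eq_zero_or_pos Λ with rfl | h
    · omega
    · obtain ⟨i, rfl⟩ : ∃ i, Λ = i + 1 := ⟨Λ - 1, by omega⟩
      have := hΛ i (by omega)
      rw [pow_succ, pow_succ]
      omega
  exact_mod_cast this

theorem eq_zero_of_le_one {n Λ : ℕ} (hn : n ≤ 1) (hΛ : ∀ i < Λ, 2 ^ i < n) : Λ = 0 := by
  by_contra h
  have := hΛ 0 (by omega)
  omega

theorem four_mul_le_pow_ten {u : ℝ} (hu : 2 ≤ u) : 4 * u ≤ u ^ 10 := by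
  have h1 : (2 : ℝ) ^ 9 ≤ u ^ 9 := by gcongr
  have h2 : u ^ 10 = u ^ 9 * u := by ring
  rw [h2]
  have : (4 : ℝ) ≤ u ^ 9 := le_trans (by norm_num) h1
  gcongr

theorem time_le {n Λ L k T : ℕ} (hε : 0 < ε) (hε2 : ε < 1 / 2) (hl2 : 2 ≤ l)
    (hl : ∀ i < l, 2 ^ i * ε < 1) (hΛ : ∀ i < Λ, 2 ^ i < n) (hL : L ≤ numRel l)
    (hk : k ≤ juntaSize (2 ^ l) l) (hT : T ≤ mainCost n l Λ L k) :
    (T : ℝ) ≤ softO bigConst 5 ((n : ℝ) ^ 2 / ε ^ 10) + 2 ^ softO bigConst 5 (1 / ε ^ 2) := by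
  have h1 := hT.trans (mainCost_le hl2 hL hk)
  have hX := two_pow_fourteen_le_sizeBound hl2
  have hX7 : 12000 * sizeBound l ^ 6 ≤ sizeBound l ^ 7 := by
    rw [pow_succ (sizeBound l) 6, mul_comm]
    gcongr
    omega
  have hB := sizeBound_pow_le hε hε2 hl2 hl
  -- in dimension `0` the first term vanishes, and the second one has to cover everything
  rcases Nat.eq_zero_or_pos n with rfl | hn
  · obtain rfl := eq_zero_of_le_one (by norm_num) hΛ
    have h2 : T ≤ sizeBound l ^ 7 := by
      have h3 := numCoef_zero_le hl2
      have h4 : sizeBound l ≤ sizeBound l ^ 6 := Nat.le_self_pow (by norm_num) _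
      omega
    have h3 : (T : ℝ) ≤ ((sizeBound l ^ 7 : ℕ) : ℝ) := by exact_mod_cast h2
    have h4 : softO bigConst 5 (((0 : ℕ) : ℝ) ^ 2 / ε ^ 10) = 0 := by simp [softO]
    rw [h4]
    linarith
  · have hn1 : (1 : ℝ) ≤ n := by exact_mod_cast hn
    have hu : (2 : ℝ) ≤ 1 / ε := by rw [le_div_iff₀ hε]; linarith
    set g : ℝ := (n : ℝ) ^ 2 / ε ^ 10 with hg
    have hg0 : 0 ≤ g := by positivity
    have hgu : g = n ^ 2 * (1 / ε) ^ 10 := by rw [hg]; field_simp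
    have hu10 := four_mul_le_pow_ten hu
    have hn2 : (n : ℝ) ≤ n ^ 2 := by nlinarith
    have hlog := one_le_log_three_add hg0
    have hK : (2 : ℝ) ^ l ≤ 3 + g := by
      refine (two_pow_le_div hε (by omega) hl).trans ?_
      have : 2 / ε = 2 * (1 / ε) := by ring
      rw [this, hgu]
      nlinarith
    have hΛ2 : (2 : ℝ) ^ (Λ + 1) ≤ 3 + g := by
      refine (two_pow_succ_le hn hΛ).trans ?_
      rw [hgu]
      nlinarith
    have hll := le_two_mul_log hK
    have hΛl := le_two_mul_log hΛ2
    set t := Real.log (3 + g)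
    have hQ := invThr_sq_le hε (by omega) hl hll
    have h2 : (T : ℝ) ≤ 3000 * (numCoef l Λ * ((n + 1) * (n + 1))) + 3000 * sizeBound l ^ 6 := by
      exact_mod_cast h1
    have h3 : (3000 * sizeBound l ^ 6 : ℝ) ≤ 2 ^ softO bigConst 5 (1 / ε ^ 2) := by
      refine le_trans ?_ hB
      have : 3000 * sizeBound l ^ 6 ≤ sizeBound l ^ 7 := by omega
      exact_mod_cast this
    have h4 : (numCoef l Λ : ℝ) ≤ 160 * (10 ^ 26 * (1 / ε ^ 10) * t ^ 4) * (2 * t) := by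
      have : (numCoef l Λ : ℝ) = 160 * ((invThr (2 ^ l) l * invThr (2 ^ l) l : ℕ) : ℝ) *
          ((Λ + 1 : ℕ) : ℝ) := by unfold numCoef; push_cast; ring
      rw [this]
      gcongr
    have h5 : 3000 * ((numCoef l Λ : ℝ) * ((n + 1) * (n + 1))) ≤ softO bigConst 5 g := by
      calc 3000 * ((numCoef l Λ : ℝ) * ((n + 1) * (n + 1)))
          ≤ 3000 * ((160 * (10 ^ 26 * (1 / ε ^ 10) * t ^ 4) * (2 * t)) *
            ((n + n) * (n + n))) := by gcongr
        _ = (3840000 * 10 ^ 26) * g * t ^ 5 := by rw [hg]; ring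
        _ ≤ softO bigConst 5 g := by
            unfold softO bigConst
            gcongr
            norm_num
    linarith

theorem examples_le {n Λ : ℕ} (hε : 0 < ε) (hε2 : ε < 1 / 2) (hl2 : 2 ≤ l)
    (hl : ∀ i < l, 2 ^ i * ε < 1) (hΛ : ∀ i < Λ, 2 ^ i < n) :
    ((numCoef l Λ + numCond l + numCond l : ℕ) : ℝ) ≤
      softO bigConst 5 (Real.log n / ε ^ 10) + 2 ^ softO bigConst 5 (1 / ε ^ 2) := by
  have hX := two_pow_fourteen_le_sizeBound hl2
  have hX7 : 5 * sizeBound l ≤ sizeBound l ^ 7 := by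
    rw [pow_succ (sizeBound l) 6]
    gcongr
    calc 5 ≤ sizeBound l := by omega
      _ ≤ sizeBound l ^ 6 := Nat.le_self_pow (by norm_num) _
  have hM := numCond_le_sizeBound hl2
  have hB := sizeBound_pow_le hε hε2 hl2 hl
  -- for `n ≤ 1` the logarithm vanishes, and the second term has to cover everything
  rcases Nat.lt_or_ge 1 n with hn | hn
  · have hu : (2 : ℝ) ≤ 1 / ε := by rw [le_div_iff₀ hε]; linarith
    have hn2 : Real.log 2 ≤ Real.log n := Real.log_le_log (by norm_num) (by exact_mod_cast hn)
    have hlog2 := Real.log_two_gt_d9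
    set g : ℝ := Real.log n / ε ^ 10 with hg
    have hg0 : 0 ≤ g := div_nonneg (by linarith) (by positivity)
    have hgu : g = Real.log n * (1 / ε) ^ 10 := by rw [hg]; field_simp
    have hu10 := four_mul_le_pow_ten hu
    have hlog := one_le_log_three_add hg0
    have hK : (2 : ℝ) ^ l ≤ 3 + g := by
      refine (two_pow_le_div hε (by omega) hl).trans ?_
      have : 2 / ε = 2 * (1 / ε) := by ring
      rw [this, hgu]
      nlinarith
    have hll := le_two_mul_log hK
    have hΛl : ((Λ + 1 : ℕ) : ℝ) ≤ 6 * Real.log n := by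
      have h1 := le_two_mul_log (two_pow_succ_le (by omega) hΛ)
      have hn0 : (n : ℝ) ≠ 0 := by positivity
      rw [Real.log_mul (by norm_num) hn0, show (4 : ℝ) = 2 ^ 2 by norm_num, Real.log_pow] at h1
      push_cast at h1 ⊢
      linarith
    set t := Real.log (3 + g)
    have hQ := invThr_sq_le hε (by omega) hl hll
    have h4 : (numCoef l Λ : ℝ) ≤ softO bigConst 5 g := by
      have : (numCoef l Λ : ℝ) = 160 * ((invThr (2 ^ l) l * invThr (2 ^ l) l : ℕ) : ℝ) *
          ((Λ + 1 : ℕ) : ℝ) := by unfold numCoef; push_cast; ring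
      rw [this]
      calc 160 * ((invThr (2 ^ l) l * invThr (2 ^ l) l : ℕ) : ℝ) * ((Λ + 1 : ℕ) : ℝ)
          ≤ 160 * (10 ^ 26 * (1 / ε ^ 10) * t ^ 4) * (6 * Real.log n) := by gcongr
        _ = (960 * 10 ^ 26) * g * t ^ 4 := by rw [hg]; ring
        _ ≤ 10 ^ 40 * g * t ^ 5 := by
            have : t ^ 4 ≤ t ^ 5 := pow_le_pow_right₀ hlog (by norm_num)
            gcongr
            norm_num
    have h5 : ((numCond l + numCond l : ℕ) : ℝ) ≤ 2 ^ softO bigConst 5 (1 / ε ^ 2) := by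
      refine le_trans ?_ hB
      have : numCond l + numCond l ≤ sizeBound l ^ 7 := by omega
      exact_mod_cast this
    push_cast at h5 ⊢
    linarith
  · obtain rfl := eq_zero_of_le_one hn hΛ
    have h3 := numCoef_zero_le hl2
    have h2 : numCoef l 0 + numCond l + numCond l ≤ sizeBound l ^ 7 := by omega
    have h3 : ((numCoef l 0 + numCond l + numCond l : ℕ) : ℝ) ≤ ((sizeBound l ^ 7 : ℕ) : ℝ) := by
      exact_mod_cast h2
    have h4 : Real.log n = 0 := by
      interval_cases n <;> simp
    have h5 : softO bigConst 5 (Real.log n / ε ^ 10) = 0 := by simp [softO, h4]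
    rw [h5]
    linarith

end Accuracy

end RealRAM

namespace RealRAM

open CubeFn

/-! ### The guarantee -/

/-- For accuracy at least `1 / 2` the constant function `1 / 2` is an admissible answer. -/
theorem exists_outputs_large {n : ℕ} {f : Cube n → ℝ} {ε : ℝ} (hε : 1 / 2 ≤ ε)
    (ω : ℕ → Cube n) :
    ∃ (s : State) (T : ℕ), Exec f ω mainProg (State.init n ε) s T ∧
      s.Outputs (∅ : Finset (Fin n)) (fun _ => 1 / 2) ∧ T ≤ 13 ∧ s.drawn = 0 := by
  obtain ⟨s, T, h1, h2, h3, h4, h5⟩ := reach_mainProg_large (f := f) (ω := ω) hε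
  exact ⟨s, T, h1, ⟨0, Function.Embedding.ofIsEmpty, h3, rfl, fun j => j.elim0,
    fun x => by simpa using h4.symm⟩, h2, h5⟩

theorem softO_nonneg {C g : ℝ} (hC : 0 ≤ C) (hg : 0 ≤ g) (c : ℕ) : 0 ≤ softO C c g := by
  have := one_le_log_three_add hg
  unfold softO
  positivity

theorem le_softO {C g : ℝ} (hC : 0 ≤ C) (hg : 1 ≤ g) (c : ℕ) : C ≤ softO C c g := by
  have h1 := one_le_log_three_add (by linarith : 0 ≤ g)
  have h2 : 1 ≤ Real.log (3 + g) ^ c := one_le_pow₀ h1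
  unfold softO
  calc C = C * 1 * 1 := by ring
    _ ≤ C * g * Real.log (3 + g) ^ c := by gcongr

end RealRAM

theorem mainTheorem8 :
    ∃ (prog : RealRAM.Cmd) (C : ℝ) (c : ℕ), 0 < C ∧
      ∀ (n : ℕ) (ε : ℝ), 0 < ε →
        ∀ f : Cube n → ℝ, IsSubmodular f → (∀ x, f x ∈ Set.Icc (0 : ℝ) 1) →
          ∃ (J : (ℕ → Cube n) → Finset (Fin n)) (h : (ℕ → Cube n) → Cube n → ℝ),
            (∀ ω : ℕ → Cube n,
              ∃ (s : RealRAM.State) (T : ℕ),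
                RealRAM.Exec f ω prog (RealRAM.State.init n ε) s T ∧
                s.Outputs (J ω) (h ω) ∧
                (T : ℝ) ≤ softO C c ((n : ℝ) ^ 2 / (min ε 1) ^ 10)
                  + (2 : ℝ) ^ softO C c (1 / (min ε 1) ^ 2) ∧
                (s.drawn : ℝ) ≤ softO C c (Real.log n / (min ε 1) ^ 10)
                  + (2 : ℝ) ^ softO C c (1 / (min ε 1) ^ 2) ∧
                ((J ω).card : ℝ) ≤ C * (1 / (min ε 1) ^ 2 * Real.log (1 / min ε 1)) ∧
                DependsOn (h ω) (J ω : Set (Fin n)) ∧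
                IsSubmodular (h ω) ∧
                (∀ x, h ω x ∈ Set.Icc (0 : ℝ) 1)) ∧
            (2 / 3 : ℝ) ≤ (exampleLaw n).real {ω | l1Dist f (h ω) ≤ ε} := by
  refine ⟨RealRAM.mainProg, RealRAM.bigConst, 5, by unfold RealRAM.bigConst; positivity,
    fun n ε hε f hf hf1 => ?_⟩
  have hC : 0 ≤ RealRAM.bigConst := by unfold RealRAM.bigConst; positivity
  rcases le_or_gt (1 / 2) ε with hε2 | hε2
  · refine ⟨fun _ => ∅, fun _ _ => 1 / 2, fun ω => ?_, ?_⟩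
    · obtain ⟨s, T, h1, h2, h3, h4⟩ := RealRAM.exists_outputs_large (f := f) hε2 ω
      have hδ0 : 0 < min ε 1 := lt_min hε one_pos
      have hδ1 : min ε 1 ≤ 1 := min_le_right _ _
      have hpow : (13 : ℝ) ≤ 2 ^ softO RealRAM.bigConst 5 (1 / (min ε 1) ^ 2) := by
        have h5 : (1 : ℝ) ≤ 1 / (min ε 1) ^ 2 := by
          rw [le_div_iff₀ (by positivity), one_mul]
          exact pow_le_one₀ hδ0.le hδ1
        have h6 : (4 : ℝ) ≤ softO RealRAM.bigConst 5 (1 / (min ε 1) ^ 2) :=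
          le_trans (by unfold RealRAM.bigConst; norm_num)
            (RealRAM.le_softO hC h5 5)
        calc (13 : ℝ) ≤ 2 ^ (4 : ℝ) := by norm_num
          _ ≤ _ := Real.rpow_le_rpow_of_exponent_le (by norm_num) h6
      have hT : (T : ℝ) ≤ 13 := by exact_mod_cast h3
      refine ⟨s, T, h1, h2, ?_, ?_, ?_, fun x y _ => rfl, fun x y => le_rfl, fun x => ?_⟩
      · have := RealRAM.softO_nonneg hC (show 0 ≤ (n : ℝ) ^ 2 / (min ε 1) ^ 10 by positivity) 5
        linarith
      · have := RealRAM.softO_nonneg hC (show 0 ≤ Real.log n / (min ε 1) ^ 10 from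
          div_nonneg (Real.log_natCast_nonneg n) (by positivity)) 5
        rw [h4, Nat.cast_zero]
        linarith
      · have h5 : 0 ≤ Real.log (1 / min ε 1) :=
          Real.log_nonneg (by rw [le_div_iff₀ hδ0]; linarith)
        rw [Finset.card_empty, Nat.cast_zero]
        positivity
      · norm_num
    · have h1 : {ω : ℕ → Cube n | l1Dist f (fun _ => 1 / 2) ≤ ε} = Set.univ := by
        refine Set.eq_univ_of_forall fun ω => ?_
        rw [Set.mem_ofPred_eq, CubeFn.l1Dist_eq_avg]
        refine ((CubeFn.avg_mono fun x => ?_).trans_eq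
          (CubeFn.avg_const (n := n) (1 / 2))).trans hε2
        obtain ⟨h0, h1⟩ := hf1 x
        rw [abs_le]
        constructor <;> linarith
      rw [h1, probReal_univ]
      norm_num
  · have hmin : min ε 1 = ε := min_eq_left (by linarith)
    rw [hmin]
    classical
    have hexl : ∃ l : ℕ, 1 ≤ 2 ^ l * ε := by
      obtain ⟨l, hl⟩ := pow_unbounded_of_one_lt (1 / ε) (by norm_num : (1 : ℝ) < 2)
      exact ⟨l, by rw [div_lt_iff₀ hε] at hl; exact hl.le⟩
    have hexΛ : ∃ Λ : ℕ, n ≤ 2 ^ Λ := ⟨n, Nat.lt_two_pow_self.le⟩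
    obtain ⟨l, hl', hl⟩ : ∃ l : ℕ, 1 ≤ 2 ^ l * ε ∧ ∀ i < l, 2 ^ i * ε < 1 :=
      ⟨Nat.find hexl, Nat.find_spec hexl, fun i hi => not_le.mp (Nat.find_min hexl hi)⟩
    obtain ⟨Λ, hΛ', hΛ⟩ : ∃ Λ : ℕ, n ≤ 2 ^ Λ ∧ ∀ i < Λ, 2 ^ i < n :=
      ⟨Nat.find hexΛ, Nat.find_spec hexΛ, fun i hi => not_le.mp (Nat.find_min hexΛ hi)⟩
    have hl2 : 2 ≤ l := by
      by_contra h
      have h1 : (2 : ℝ) ^ l ≤ 2 ^ 1 := pow_le_pow_right₀ (by norm_num) (by omega)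
      nlinarith
    choose J h s T L k h1 h2 h3 h4 h5 h6 h7 h8 h9 h10 h11 using
      RealRAM.exists_outputs hf hf1 hε2 hl2 hl hl' hΛ hΛ'
    refine ⟨J, h, fun ω => ⟨s ω, T ω, h1 ω, h2 ω,
      RealRAM.time_le hε hε2 hl2 hl hΛ (h3 ω) (h4 ω) (h5 ω), ?_, ?_, h8 ω, h9 ω, h10 ω⟩, ?_⟩
    · rw [h6 ω]
      exact RealRAM.examples_le hε hε2 hl2 hl hΛ
    · rw [h7 ω]
      refine le_trans ?_ (RealRAM.juntaSize_le_log hε hε2 (by omega) hl)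
      exact_mod_cast h4 ω
    · exact (RealRAM.measureReal_good hf1 (by omega) hΛ').trans
        (measureReal_mono (fun ω hω => h11 ω hω) (measure_ne_top _ _))
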